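/- **Setting.** Let $n\ge 2$, let $\kappa_0,\kappa,\kappa_n,\upsilon_0,\upsilon_n,q^{1/2}\in\mathbb C^*$ be arbitrary, $q=(q^{1/2})^2$, and put $\kappa_i=\kappa$ for $1\le i<n$, $\underline\kappa=(\kappa_0,\kappa_1,\dots,\kappa_n)$, $\underline\kappa^{-1}=(\kappa_0^{-1},\dots,\kappa_n^{-1})$. *Weyl groups.* $W_0=S_n\ltimes\{\pm1\}^n$ is generated by $s_1,\dots,s_n$, where $s_i$ ($i<n$) interchanges the $i$-th and $(i+1)$-st coordinates and $s_n$ changes the sign of the last one; $l$ is its length function. It acts on $T=(\mathbb C^*)^n$ by permutations and inversions of the coordinates. $W=W_0\ltimes\mathbb Z^n$ is the affine Weyl group, with translations $\tau(\lambda)$ ($\lambda\in\mathbb Z^n$), generated by $s_1,\dots,s_n$ and $s_0:x\mapsto(1-x_1,x_2,\dots,x_n)$. It acts on $T$ with $\tau(\lambda)\mathbf t=(q^{\lambda_1}t_1,\dots,q^{\lambda_n}t_n)$, so $s_0\mathbf t=(q t_1^{-1},t_2,\dots,t_n)$, and hence on the field $\mathcal M(T)$ of meromorphic functions on $T$ by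 $(wf)(\mathbf t)=f(w^{-1}\mathbf t)$. For $I\subseteq\{1,\dots,n\}$ let $W_{0,I}=\langle s_i\mid i\in I\rangle$ and $W_0^I=\{w\in W_0\mid l(wv)=l(w)+l(v)\ \forall v\in W_{0,I}\}$. Let $w_0$, $w_{0,I}$ be the longest elements of $W_0$, $W_{0,I}$, and put $w_0^I=w_0w_{0,I}^{-1}$ and $I^*=\{i^*\mid i\in I\}$, where $w_0^Is_i=s_{i^*}w_0^I$. *Hecke algebra.* $H(\underline\kappa)$ is the unital $\mathbb C$-algebra generated by $T_0,\dots,T_n$ with the braid relations of type $\widetilde C_n$ (that is, $T_0T_1T_0T_1=T_1T_0T_1T_0$, $T_{n-1}T_nT_{n-1}T_n=T_nT_{n-1}T_nT_{n-1}$, $T_iT_{i+1}T_i=T_{i+1}T_iT_{i+1}$ for $1\le i<n-1$, and $T_iT_j=T_jT_i$ for $|i-j|>1$) and $(T_j-\kappa_j)(T_j+\kappa_j^{-1})=0$. Put $Y_i=T_{i-1}^{-1}\cdots T_1^{-1}T_0T_1\cdots T_{n-1}T_nT_{n-1}\cdots T_i$ for $1\le i\le n$, and $T_w=T_{i_1}\cdots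 T_{i_r}$ for a reduced expression $w=s_{i_1}\cdots s_{i_r}$ of $w\in W_0$. Let $T_I^{\underline\kappa}$ be the set of $\gamma\in T$ with $\gamma_i/\gamma_{i+1}=\kappa^2$ for $i\in I$, $i<n$, and $\gamma_n=\kappa_0\kappa_n$ if $n\in I$. For $\gamma\in T_I^{\underline\kappa}$, $M_I^{\underline\kappa}(\gamma)$ is the $H(\underline\kappa)$-module induced from the character $T_i\mapsto\kappa_i$ ($i\in I$), $Y_j\mapsto\gamma_j$ ($1\le j\le n$) of the subalgebra generated by the $T_i$ ($i\in I$) and the $Y_j^{\pm1}$; $\pi$ is its representation map, and $v_w^I(\gamma;\underline\kappa)=\pi(T_w)(1\otimes 1)$. *Koornwinder operators.* Let $$c_0(\mathbf t)=\kappa_0^{-1}\frac{(1-q^{1/2}\kappa_0\upsilon_0t_1^{-1})(1+q^{1/2}\kappa_0\upsilon_0^{-1}t_1^{-1})}{1-qt_1^{-2}},\quad c_i(\mathbf t)=\kappa^{-1}\frac{1-\kappa^2t_i/t_{i+1}}{1-t_i/t_{i+1}}\ (1\le i<n),\quad c_n(\mathbf t)=\kappa_n^{-1}\frac{(1-\kappa_n\upsilon_nt_n)(1+\kappa_n\upsilon_n^{-1}t_n)}{1-t_n^2}.$$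 The formulas $\varpi_{\underline\kappa;\upsilon_0,\upsilon_n}(T_j)f=\kappa_jf+c_j\,(s_jf-f)$ define an algebra homomorphism $\varpi_{\underline\kappa;\upsilon_0,\upsilon_n}:H(\underline\kappa)\to\mathrm{End}_{\mathbb C}(\mathcal M(T))$. Write $\varpi=\varpi_{\underline\kappa^{-1};\upsilon_0^{-1},\upsilon_n^{-1}}:H(\underline\kappa^{-1})\to\mathrm{End}_{\mathbb C}(\mathcal M(T))$. For $I\subseteq\{1,\dots,n\}$ and $\gamma\in T_I^{\underline\kappa^{-1}}$ put $$\mathrm{Sp}_K^I(\gamma)=\{f\in\mathcal M(T)\mid \varpi(Y_j)f=\gamma_jf\ (1\le j\le n),\ \varpi(T_i)f=\kappa_i^{-1}f\ (i\in I)\}.$$ *Reflection quantum KZ equations.* For an $H(\underline\kappa)$-module $V$ with representation map $\pi$, put $$K_j(x)=\frac{\pi(T_j^{-1})+(\upsilon_j^{-1}-\upsilon_j)x-x^2\pi(T_j)}{\kappa_j^{-1}(1-\kappa_j\upsilon_jx)(1+\kappa_j\upsilon_j^{-1}x)}\ (j=0,n),\qquad R_i(x)=\frac{\pi(T_i^{-1})-x\,\pi(T_i)}{\kappa^{-1}(1-\kappa^2x)}\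 (1\le i<n).$$ Let $\nabla$ be the representation of $W$ on $\mathcal M(T)\otimes V$ determined by $(\nabla(s_0)f)(\mathbf t)=K_0(q^{1/2}/t_1)f(s_0\mathbf t)$, $(\nabla(s_i)f)(\mathbf t)=R_i(t_i/t_{i+1})f(s_i\mathbf t)$ for $1\le i<n$, and $(\nabla(s_n)f)(\mathbf t)=K_n(t_n)f(s_n\mathbf t)$. Let $\mathrm{Sol}_{KZ}(V)$ be the space of $f\in\mathcal M(T)\otimes V$ with $\nabla(\tau(\lambda))f=f$ for all $\lambda\in\mathbb Z^n$, and $\mathrm{Sol}_{KZ}(V)^{W_0}$ the subspace of those $f\in\mathrm{Sol}_{KZ}(V)$ with $\nabla(w)f=f$ for all $w\in W_0$. **Theorem (nonsymmetric difference Cherednik–Matsuo correspondence).** Let $I\subseteq\{1,\dots,n\}$ and $\gamma\in T_I^{\underline\kappa}$. Then $w_0^I\gamma^{-1}\in T_{I^*}^{\underline\kappa^{-1}}$, and the linear map $\mathcal M(T)\to\mathcal M(T)\otimes M_I^{\underline\kappa}(\gamma)$, $$\phi\mapsto\sum_{w\in W_0^I}\varpi\bigl(T_{w(w_0^I)^{-1}}\bigr)\phi\otimes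 v_w^I(\gamma;\underline\kappa),$$ restricts to a linear isomorphism $$\mathrm{Sp}_K^{I^*}(w_0^I\gamma^{-1})\ \overset{\sim}{\longrightarrow}\ \mathrm{Sol}_{KZ}\bigl(M_I^{\underline\kappa}(\gamma)\bigr)^{W_0}.$$ -/

import Mathlib

open scoped TensorProduct Topology

noncomputable section

namespace CherednikMatsuo

/-! ### The hyperoctahedral group and the affine Weyl group -/

/-- The finite Weyl group `W₀ ≃ S_n ⋉ {±1}^n`; an element `⟨ε, σ⟩` is the signed permutation
`x ↦ (k ↦ ε k * x (σ⁻¹ k))`. -/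
abbrev W0 (n : ℕ) : Type := (Fin n → ℤˣ) ⋊[mulAutArrow] Equiv.Perm (Fin n)

instance (n : ℕ) : Finite (W0 n) := Finite.of_equiv _ SemidirectProduct.equivProd.symm

/-- The action of `W₀` on `G^n`, for an abelian group `G` written multiplicatively, by
permutations and inversions of the coordinates. -/
def signedAct (n : ℕ) (G : Type*) [CommGroup G] : W0 n →* MulAut (Fin n → G) where
  toFun w :=
    { toFun := fun t k => t (w.right⁻¹ k) ^ ((w.left k : ℤˣ) : ℤ)
      invFun := fun t k => t (w.right k) ^ ((w.left (w.right k) : ℤˣ) : ℤ)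
      left_inv := fun t => by
        funext k
        have hk : w.right⁻¹ (w.right k) = k := by simp
        change (t (w.right⁻¹ (w.right k)) ^ ((w.left (w.right k) : ℤˣ) : ℤ)) ^
          ((w.left (w.right k) : ℤˣ) : ℤ) = t k
        rw [← zpow_mul, ← Units.val_mul, Int.units_mul_self, Units.val_one, zpow_one, hk]
      right_inv := fun t => by
        funext k
        have hk : w.right (w.right⁻¹ k) = k := by simp
        change (t (w.right (w.right⁻¹ k)) ^ ((w.left (w.right (w.right⁻¹ k)) : ℤˣ) : ℤ)) ^
          ((w.left k : ℤˣ) : ℤ) = t k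
        rw [hk, ← zpow_mul, ← Units.val_mul, Int.units_mul_self, Units.val_one, zpow_one]
      map_mul' := fun t u => by
        funext k
        simp [mul_zpow] }
  map_one' := by
    ext t k
    simp
  map_mul' := fun w v => by
    ext t k
    simp only [SemidirectProduct.mul_left, SemidirectProduct.mul_right, MulAut.mul_apply,
      MulEquiv.coe_mk, Equiv.coe_fn_mk, Pi.mul_apply, mul_inv_rev, Equiv.Perm.mul_apply,
      Units.val_mul]
    rw [← zpow_mul, mul_comm]
    rfl

theorem signedAct_apply {n : ℕ} {G : Type*} [CommGroup G] (w : W0 n) (t : Fin n → G) (k : Fin n) :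
    signedAct n G w t k = t (w.right⁻¹ k) ^ ((w.left k : ℤˣ) : ℤ) := rfl

/-- The simple reflection `s_{i+1}` of `W₀` (so `i : Fin n` stands for the index `i + 1` in
`{1, …, n}`): for `i + 1 < n` it interchanges the coordinates number `i + 1` and `i + 2`, and for
`i + 1 = n` it changes the sign of the last coordinate. -/
def simple {n : ℕ} (i : Fin n) : W0 n :=
  if h : i.val + 1 < n then SemidirectProduct.inr (Equiv.swap i ⟨i.val + 1, h⟩)
  else SemidirectProduct.inl (Pi.mulSingle i (-1))

/-- The affine Weyl group `W = W₀ ⋉ ℤ^n`, with `ℤ^n` written multiplicatively. -/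
abbrev AffW (n : ℕ) : Type :=
  (Fin n → Multiplicative ℤ) ⋊[signedAct n (Multiplicative ℤ)] W0 n

/-- The translation `τ(l) ∈ W`, for `l ∈ ℤ^n`. -/
def transl {n : ℕ} (l : Fin n → ℤ) : AffW n :=
  SemidirectProduct.inl fun k => Multiplicative.ofAdd (l k)

/-- The simple reflections `s_0, …, s_n` of `W`. Here `s_0` is the affine reflection
`(x_1, …, x_n) ↦ (1 - x_1, x_2, …, x_n)`. -/
def affSimple {n : ℕ} [NeZero n] : Fin (n + 1) → AffW n :=
  Fin.cases
    (transl (Pi.single 0 1) * SemidirectProduct.inr (SemidirectProduct.inl (Pi.mulSingle 0 (-1))))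
    (fun i => SemidirectProduct.inr (simple i))

/-- The element of `W` represented by a word in the simple reflections. -/
def affWord {n : ℕ} [NeZero n] (l : List (Fin (n + 1))) : AffW n := (l.map affSimple).prod

/-- The element of `W₀` represented by a word in the simple reflections `s_1, …, s_n`. -/
def word {n : ℕ} (l : List (Fin n)) : W0 n := (l.map simple).prod

/-- The length function of `W₀`. -/
def len {n : ℕ} (w : W0 n) : ℕ := sInf {r | ∃ l : List (Fin n), l.length = r ∧ word l = w}

/-- A reduced expression of `w ∈ W₀`. -/
def reducedWord {n : ℕ} (w : W0 n) : List (Fin n) :=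
  Classical.epsilon fun l => word l = w ∧ l.length = len w

/-- The parabolic subgroup `W_{0,I}`. -/
def parabolic {n : ℕ} (I : Set (Fin n)) : Subgroup (W0 n) := Subgroup.closure (simple '' I)

/-- The element of maximal length of the parabolic subgroup `W_{0,I}`. -/
def longest {n : ℕ} (I : Set (Fin n)) : W0 n :=
  Classical.epsilon fun w => w ∈ parabolic I ∧ ∀ v ∈ parabolic I, len v ≤ len w

/-- The element `w_0^I = w_0 w_{0,I}⁻¹`. -/
def w0I {n : ℕ} (I : Set (Fin n)) : W0 n := longest Set.univ * (longest I)⁻¹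

/-- The set `W_0^I` of minimal coset representatives of `W₀ / W_{0,I}`. -/
def minReps {n : ℕ} (I : Set (Fin n)) : Set (W0 n) :=
  {w | ∀ v ∈ parabolic I, len (w * v) = len w + len v}

/-- The set `I^* = {i^* | i ∈ I}`, where `w_0^I s_i = s_{i^*} w_0^I`. -/
def starSet {n : ℕ} (I : Set (Fin n)) : Set (Fin n) :=
  {j | ∃ i ∈ I, w0I I * simple i = simple j * w0I I}

/-! ### The affine Hecke algebra -/

/-- The Hecke parameters `(κ_0, κ, …, κ, κ_n)`. -/
@[ext] structure Kappa where
  zero : ℂˣ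
  mid : ℂˣ
  last : ℂˣ

instance : Inv Kappa := ⟨fun κ => ⟨κ.zero⁻¹, κ.mid⁻¹, κ.last⁻¹⟩⟩

/-- The parameter `κ_j` for `0 ≤ j ≤ n`. -/
def Kappa.at {n : ℕ} (κ : Kappa) : Fin (n + 1) → ℂˣ :=
  Fin.cases κ.zero fun i => if i.val + 1 < n then κ.mid else κ.last

/-- The defining relations of the affine Hecke algebra of type `C̃_n`, in the free algebra on the
generators `T_0, …, T_n`. -/
inductive HeckeRel (n : ℕ) (κ : Kappa) :
    FreeAlgebra ℂ (Fin (n + 1)) → FreeAlgebra ℂ (Fin (n + 1)) → Prop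
  | quadratic (j : Fin (n + 1)) : HeckeRel n κ
      ((FreeAlgebra.ι ℂ j - algebraMap ℂ _ (κ.at j : ℂ)) *
        (FreeAlgebra.ι ℂ j + algebraMap ℂ _ (κ.at j : ℂ)⁻¹)) 0
  | commute (i j : Fin (n + 1)) (h : i.val + 1 < j.val) : HeckeRel n κ
      (FreeAlgebra.ι ℂ i * FreeAlgebra.ι ℂ j) (FreeAlgebra.ι ℂ j * FreeAlgebra.ι ℂ i)
  | braid_mid (i j : Fin (n + 1)) (h0 : 0 < i.val) (h : j.val = i.val + 1) (hn : j.val < n) :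
      HeckeRel n κ
      (FreeAlgebra.ι ℂ i * FreeAlgebra.ι ℂ j * FreeAlgebra.ι ℂ i)
      (FreeAlgebra.ι ℂ j * FreeAlgebra.ι ℂ i * FreeAlgebra.ι ℂ j)
  | braid_left (i j : Fin (n + 1)) (h0 : i.val = 0) (h : j.val = 1) (hn : j.val < n) :
      HeckeRel n κ
      (FreeAlgebra.ι ℂ i * FreeAlgebra.ι ℂ j * FreeAlgebra.ι ℂ i * FreeAlgebra.ι ℂ j)
      (FreeAlgebra.ι ℂ j * FreeAlgebra.ι ℂ i * FreeAlgebra.ι ℂ j * FreeAlgebra.ι ℂ i)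
  | braid_right (i j : Fin (n + 1)) (h0 : 0 < i.val) (h : j.val = i.val + 1) (hn : j.val = n) :
      HeckeRel n κ
      (FreeAlgebra.ι ℂ i * FreeAlgebra.ι ℂ j * FreeAlgebra.ι ℂ i * FreeAlgebra.ι ℂ j)
      (FreeAlgebra.ι ℂ j * FreeAlgebra.ι ℂ i * FreeAlgebra.ι ℂ j * FreeAlgebra.ι ℂ i)

/-- The affine Hecke algebra `H(κ)`. -/
abbrev Hecke (n : ℕ) (κ : Kappa) : Type := RingQuot (HeckeRel n κ)

/-- The generator `T_j` of `H(κ)`, for `0 ≤ j ≤ n`. -/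
def heckeT {n : ℕ} (κ : Kappa) (j : Fin (n + 1)) : Hecke n κ :=
  RingQuot.mkAlgHom ℂ (HeckeRel n κ) (FreeAlgebra.ι ℂ j)

/-- The inverse `T_j⁻¹ = T_j - κ_j + κ_j⁻¹` of `T_j`. -/
def heckeTinv {n : ℕ} (κ : Kappa) (j : Fin (n + 1)) : Hecke n κ :=
  heckeT κ j - algebraMap ℂ _ (κ.at j : ℂ) + algebraMap ℂ _ (κ.at j : ℂ)⁻¹

theorem heckeT_quadratic {n : ℕ} (κ : Kappa) (j : Fin (n + 1)) :
    (heckeT κ j - algebraMap ℂ _ (κ.at j : ℂ)) *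
      (heckeT κ j + algebraMap ℂ _ (κ.at j : ℂ)⁻¹) = 0 := by
  have h := RingQuot.mkAlgHom_rel ℂ (HeckeRel.quadratic (n := n) (κ := κ) j)
  simpa only [map_mul, map_sub, map_add, map_zero, AlgHom.commutes, heckeT] using h

theorem heckeT_mul_heckeTinv {n : ℕ} (κ : Kappa) (j : Fin (n + 1)) :
    heckeT κ j * heckeTinv κ j = 1 := by
  have h := heckeT_quadratic κ j
  have hc : (algebraMap ℂ (Hecke n κ)) (κ.at j : ℂ) * algebraMap ℂ _ (κ.at j : ℂ)⁻¹ = 1 := by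
    rw [← map_mul, mul_inv_cancel₀ (κ.at j).ne_zero, map_one]
  have hcomm := Algebra.commutes (κ.at j : ℂ) (heckeT κ j)
  rw [sub_mul, mul_add, mul_add, hc, hcomm] at h
  rw [heckeTinv, mul_add, mul_sub, ← sub_eq_zero, ← h]
  abel

/-- The element
`Y_i = T_{i-1}⁻¹ ⋯ T_1⁻¹ T_0 T_1 ⋯ T_{n-1} T_n T_{n-1} ⋯ T_i` of `H(κ)`, where the element `i` of
`Fin n` stands for the index `i + 1` in `{1, …, n}`. -/
def heckeY {n : ℕ} (κ : Kappa) (i : Fin n) : Hecke n κ :=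
  ((((List.finRange (n + 1)).filter fun j => 0 < j.val ∧ j.val ≤ i.val).reverse).map
      (heckeTinv κ)).prod *
    ((List.finRange (n + 1)).map (heckeT κ)).prod *
    ((((List.finRange (n + 1)).filter fun j => i.val < j.val ∧ j.val < n).reverse).map
      (heckeT κ)).prod

/-- The element `T_w = T_{i_1} ⋯ T_{i_r}` of `H(κ)`, where `w = s_{i_1} ⋯ s_{i_r}` is a reduced
expression of `w ∈ W₀`. -/
def heckeTW {n : ℕ} (κ : Kappa) (w : W0 n) : Hecke n κ :=
  ((reducedWord w).map fun i => heckeT κ i.succ).prod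

/-! ### Principal series modules -/

/-- The complex torus `T = (ℂ^*)^n`. -/
abbrev Torus (n : ℕ) : Type := Fin n → ℂˣ

/-- The set `T_I^κ`. -/
def torusI {n : ℕ} (κ : Kappa) (I : Set (Fin n)) : Set (Torus n) :=
  {γ | ∀ i ∈ I, (∀ h : i.val + 1 < n, γ i / γ ⟨i.val + 1, h⟩ = κ.mid ^ 2) ∧
    (i.val + 1 = n → γ i = κ.zero * κ.last)}

/-- The left ideal of `H(κ)` generated by `T_i - κ_i` (`i ∈ I`) and `Y_j - γ_j` (`1 ≤ j ≤ n`). -/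
def charIdeal {n : ℕ} (κ : Kappa) (I : Set (Fin n)) (γ : Torus n) :
    Submodule (Hecke n κ) (Hecke n κ) :=
  Submodule.span (Hecke n κ)
    ({h | ∃ i ∈ I, h = heckeT κ i.succ - algebraMap ℂ _ (κ.at i.succ : ℂ)} ∪
      {h | ∃ j : Fin n, h = heckeY κ j - algebraMap ℂ _ (γ j : ℂ)})

/-- The principal series module `M_I^κ(γ) = H(κ) ⊗_{H_I(κ)} ℂ_{I,γ}`. The kernel of the character
`χ_{I,γ}` of `H_I(κ)` is generated, as a left ideal, by the elements `T_i - κ_i` (`i ∈ I`) and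
`Y_j - γ_j`, so the induced module is the quotient of `H(κ)` by the left ideal generated by
these elements, with `h ⊗ 1` the class of `h`. -/
def PrincipalSeries {n : ℕ} (κ : Kappa) (I : Set (Fin n)) (γ : Torus n) : Type :=
  Hecke n κ ⧸ charIdeal κ I γ

section

variable {n : ℕ} (κ : Kappa) (I : Set (Fin n)) (γ : Torus n)

instance : AddCommGroup (PrincipalSeries κ I γ) :=
  inferInstanceAs (AddCommGroup (Hecke n κ ⧸ charIdeal κ I γ))

instance : Module (Hecke n κ) (PrincipalSeries κ I γ) :=
  inferInstanceAs (Module (Hecke n κ) (Hecke n κ ⧸ charIdeal κ I γ))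

instance : Module ℂ (PrincipalSeries κ I γ) :=
  inferInstanceAs (Module ℂ (Hecke n κ ⧸ charIdeal κ I γ))

instance : IsScalarTower ℂ (Hecke n κ) (PrincipalSeries κ I γ) :=
  inferInstanceAs (IsScalarTower ℂ (Hecke n κ) (Hecke n κ ⧸ charIdeal κ I γ))

end

/-- The vector `v_w^I(γ; κ) = T_w (1 ⊗ 1)`. -/
def vvec {n : ℕ} (κ : Kappa) (I : Set (Fin n)) (γ : Torus n) (w : W0 n) :
    PrincipalSeries κ I γ :=
  heckeTW κ w • (show PrincipalSeries κ I γ from (charIdeal κ I γ).mkQ 1)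

/-! ### Meromorphic functions on the torus -/

/-- The inclusion of the torus in `ℂ^n`. -/
def toC {n : ℕ} (t : Torus n) : Fin n → ℂ := fun k => (t k : ℂ)

/-- `f` is given, near each point of the torus, by a quotient `g / h` of holomorphic functions,
with `h` not identically zero near that point. The values of `f` where `h = 0` are irrelevant. -/
def IsMero {n : ℕ} (f : Torus n → ℂ) : Prop :=
  ∀ p : Torus n, ∃ g h : (Fin n → ℂ) → ℂ, AnalyticAt ℂ g (toC p) ∧ AnalyticAt ℂ h (toC p) ∧
    (¬ ∀ᶠ z in 𝓝 (toC p), h z = 0) ∧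
    ∀ᶠ t in 𝓝 p, h (toC t) ≠ 0 → f t = g (toC t) / h (toC t)

/-- `f` vanishes, near each point of the torus, outside the zero set of a holomorphic function
that is not identically zero near that point. -/
def IsNull {n : ℕ} (f : Torus n → ℂ) : Prop :=
  ∀ p : Torus n, ∃ h : (Fin n → ℂ) → ℂ, AnalyticAt ℂ h (toC p) ∧
    (¬ ∀ᶠ z in 𝓝 (toC p), h z = 0) ∧ ∀ᶠ t in 𝓝 p, h (toC t) ≠ 0 → f t = 0

theorem isOpenEmbedding_toC {n : ℕ} : Topology.IsOpenEmbedding (toC (n := n)) := by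
  have := Topology.IsOpenEmbedding.piMap (f := fun (_ : Fin n) => ((↑) : ℂˣ → ℂ))
    (fun _ => Units.isOpenEmbedding_val)
  exact this

theorem eventually_toC {n : ℕ} {p : Torus n} {P : (Fin n → ℂ) → Prop} :
    (∀ᶠ z in 𝓝 (toC p), P z) ↔ ∀ᶠ t in 𝓝 p, P (toC t) := by
  rw [← isOpenEmbedding_toC.map_nhds_eq p, Filter.eventually_map]

theorem germ_mul {n : ℕ} {g h : (Fin n → ℂ) → ℂ} {z₀ : Fin n → ℂ} (hg : AnalyticAt ℂ g z₀)
    (hh : AnalyticAt ℂ h z₀) (hg0 : ¬ ∀ᶠ z in 𝓝 z₀, g z = 0) (hh0 : ¬ ∀ᶠ z in 𝓝 z₀, h z = 0) :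
    ¬ ∀ᶠ z in 𝓝 z₀, g z * h z = 0 := by
  intro hgh
  obtain ⟨r, hr, hball⟩ := Metric.eventually_nhds_iff_ball.1
    ((hg.eventually_analyticAt.and hh.eventually_analyticAt).and hgh)
  apply hh0
  obtain ⟨z₁, hz₁, hgz₁⟩ : ∃ z ∈ Metric.ball z₀ r, g z ≠ 0 := by
    by_contra hcon
    push Not at hcon
    exact hg0 (Metric.eventually_nhds_iff_ball.2 ⟨r, hr, hcon⟩)
  have hn : ∀ᶠ z in 𝓝 z₁, h z = 0 := by
    filter_upwards [((hball z₁ hz₁).1.1.continuousAt).eventually_ne hgz₁,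
      Metric.isOpen_ball.mem_nhds hz₁] with z h1 h2
    exact (mul_eq_zero.1 (hball z h2).2).resolve_left h1
  have hA : AnalyticOnNhd ℂ h (Metric.ball z₀ r) := fun z hz => (hball z hz).1.2
  have := hA.eqOn_zero_of_preconnected_of_eventuallyEq_zero
    (convex_ball z₀ r).isPreconnected hz₁ hn
  exact Metric.eventually_nhds_iff_ball.2 ⟨r, hr, fun z hz => this hz⟩

theorem germ_one {n : ℕ} (z₀ : Fin n → ℂ) : ¬ ∀ᶠ _ in 𝓝 z₀, (1 : ℂ) = 0 := by
  intro h
  exact one_ne_zero h.self_of_nhds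

/-- The algebra of functions on the torus that represent meromorphic functions. -/
def meroFun (n : ℕ) : Subalgebra ℂ (Torus n → ℂ) where
  carrier := {f | IsMero f}
  mul_mem' := by
    intro a b ha hb p
    obtain ⟨g, h, hg, hh, h0, he⟩ := ha p
    obtain ⟨g', h', hg', hh', h0', he'⟩ := hb p
    refine ⟨fun z => g z * g' z, fun z => h z * h' z, hg.mul hg', hh.mul hh',
      germ_mul hh hh' h0 h0', ?_⟩
    filter_upwards [he, he'] with t h1 h2 h3
    rw [Pi.mul_apply, h1 (left_ne_zero_of_mul h3), h2 (right_ne_zero_of_mul h3),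
      div_mul_div_comm]
  add_mem' := by
    intro a b ha hb p
    obtain ⟨g, h, hg, hh, h0, he⟩ := ha p
    obtain ⟨g', h', hg', hh', h0', he'⟩ := hb p
    refine ⟨fun z => g z * h' z + h z * g' z, fun z => h z * h' z,
      (hg.mul hh').add (hh.mul hg'), hh.mul hh', germ_mul hh hh' h0 h0', ?_⟩
    filter_upwards [he, he'] with t h1 h2 h3
    rw [Pi.add_apply, h1 (left_ne_zero_of_mul h3), h2 (right_ne_zero_of_mul h3),
      div_add_div _ _ (left_ne_zero_of_mul h3) (right_ne_zero_of_mul h3)]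
  algebraMap_mem' := by
    intro c p
    refine ⟨fun _ => c, fun _ => 1, analyticAt_const, analyticAt_const, germ_one _, ?_⟩
    filter_upwards with t _
    simp

/-- The ideal of functions that represent zero. -/
def nullIdeal (n : ℕ) : Ideal (meroFun n) where
  carrier := {f | IsNull f.1}
  zero_mem' := fun p => ⟨fun _ => 1, analyticAt_const, germ_one _, by simp⟩
  add_mem' := by
    intro a b ha hb p
    obtain ⟨h, hh, h0, he⟩ := ha p
    obtain ⟨h', hh', h0', he'⟩ := hb p
    refine ⟨fun z => h z * h' z, hh.mul hh', germ_mul hh hh' h0 h0', ?_⟩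
    filter_upwards [he, he'] with t h1 h2 h3
    simp [h1 (left_ne_zero_of_mul h3), h2 (right_ne_zero_of_mul h3)]
  smul_mem' := by
    intro c a ha p
    obtain ⟨h, hh, h0, he⟩ := ha p
    refine ⟨h, hh, h0, ?_⟩
    filter_upwards [he] with t h1 h2
    simp [h1 h2]

/-- The algebra `M(T)` of meromorphic functions on the torus. -/
def Mero (n : ℕ) : Type := meroFun n ⧸ nullIdeal n

instance (n : ℕ) : CommRing (Mero n) := inferInstanceAs (CommRing (meroFun n ⧸ nullIdeal n))

instance (n : ℕ) : Algebra ℂ (Mero n) := inferInstanceAs (Algebra ℂ (meroFun n ⧸ nullIdeal n))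

/-- The meromorphic function represented by a function on the torus. -/
def toMero (n : ℕ) : meroFun n →ₐ[ℂ] Mero n := Ideal.Quotient.mkₐ ℂ (nullIdeal n)

/-! ### The `q`-dependent action of the affine Weyl group -/

/-- The action of the simple reflections `s_0, …, s_n` on the torus, where `qh` is the chosen
square root of `q`. -/
def torusRefl {n : ℕ} [NeZero n] (qh : ℂˣ) : Fin (n + 1) → Torus n → Torus n :=
  Fin.cases (fun t => Function.update t 0 (qh ^ 2 * (t 0)⁻¹))
    (fun i t => signedAct n ℂˣ (simple i) t)

theorem simple_mul_self {n : ℕ} (i : Fin n) : simple i * simple i = 1 := by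
  unfold simple
  split_ifs with h
  · rw [← map_mul, Equiv.swap_mul_self, map_one]
  · rw [← map_mul, ← Pi.mulSingle_mul]
    simp

theorem torusRefl_torusRefl {n : ℕ} [NeZero n] (qh : ℂˣ) (j : Fin (n + 1)) (t : Torus n) :
    torusRefl qh j (torusRefl qh j t) = t := by
  refine Fin.cases ?_ (fun i => ?_) j
  · simp [torusRefl]
  · simp only [torusRefl, Fin.cases_succ]
    rw [← MulAut.mul_apply, ← map_mul, simple_mul_self, map_one, MulAut.one_apply]

theorem torusRefl_coord {n : ℕ} [NeZero n] (qh : ℂˣ) (j : Fin (n + 1)) (k : Fin n) :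
    ∃ k' : Fin n, (∀ t : Torus n, torusRefl qh j t k = t k') ∨
      ∃ c : ℂˣ, ∀ t : Torus n, torusRefl qh j t k = c * (t k')⁻¹ := by
  refine Fin.cases ?_ (fun i => ?_) j
  · by_cases hk : k = 0
    · subst hk
      exact ⟨0, Or.inr ⟨qh ^ 2, fun t => by simp [torusRefl]⟩⟩
    · exact ⟨k, Or.inl fun t => by simp [torusRefl, hk]⟩
  · refine ⟨(simple i).right⁻¹ k, ?_⟩
    rcases Int.units_eq_one_or ((simple i).left k) with h | h
    · left
      intro t
      simp [torusRefl, signedAct, h]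
    · right
      refine ⟨1, fun t => ?_⟩
      simp [torusRefl, signedAct, h]

theorem toC_ne_zero {n : ℕ} (p : Torus n) (k : Fin n) : toC p k ≠ 0 := (p k).ne_zero

theorem torusRefl_extends {n : ℕ} [NeZero n] (qh : ℂˣ) (j : Fin (n + 1)) :
    ∃ S : (Fin n → ℂ) → (Fin n → ℂ), (∀ p : Torus n, AnalyticAt ℂ S (toC p)) ∧
      ∀ t, S (toC t) = toC (torusRefl qh j t) := by
  have key : ∀ k : Fin n, ∃ F : (Fin n → ℂ) → ℂ, (∀ p : Torus n, AnalyticAt ℂ F (toC p)) ∧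
      ∀ t, F (toC t) = torusRefl qh j t k := by
    intro k
    have hproj : ∀ (k' : Fin n) (z : Fin n → ℂ), AnalyticAt ℂ (fun z : Fin n → ℂ => z k') z :=
      fun k' z => (ContinuousLinearMap.proj (R := ℂ) (φ := fun _ : Fin n => ℂ) k').analyticAt z
    obtain ⟨k', h | ⟨c, h⟩⟩ := torusRefl_coord qh j k
    · exact ⟨fun z => z k', fun p => hproj k' _, fun t => by rw [h]; rfl⟩
    · refine ⟨fun z => (c : ℂ) * (z k')⁻¹, fun p => ?_, fun t => by
        rw [h, Units.val_mul, Units.val_inv_eq_inv_val]; rfl⟩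
      exact analyticAt_const.mul ((hproj k' _).inv (toC_ne_zero p k'))
  choose F hF hF' using key
  exact ⟨fun z k => F k z, fun p => analyticAt_pi_iff.2 fun k => hF k p, fun t => by
    funext k; exact hF' k t⟩

theorem continuous_torusRefl {n : ℕ} [NeZero n] (qh : ℂˣ) (j : Fin (n + 1)) :
    Continuous (torusRefl qh j) := by
  refine continuous_pi fun k => ?_
  obtain ⟨k', h | ⟨c, h⟩⟩ := torusRefl_coord qh j k
  · simp only [h]
    exact continuous_apply k'
  · simp only [h]
    exact continuous_const.mul (continuous_apply k').inv

/-- Pulling back a nonzero holomorphic germ along a simple reflection. -/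
theorem germ_comp {n : ℕ} [NeZero n] (qh : ℂˣ) (j : Fin (n + 1)) {S : (Fin n → ℂ) → (Fin n → ℂ)}
    (hS : ∀ t, S (toC t) = toC (torusRefl qh j t)) (p : Torus n) {h : (Fin n → ℂ) → ℂ}
    (h0 : ¬ ∀ᶠ z in 𝓝 (toC (torusRefl qh j p)), h z = 0) :
    ¬ ∀ᶠ z in 𝓝 (toC p), h (S z) = 0 := by
  intro hc
  rw [eventually_toC] at hc h0
  apply h0
  have hcont := (continuous_torusRefl qh j).tendsto (torusRefl qh j p)
  rw [torusRefl_torusRefl] at hcont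
  filter_upwards [hcont.eventually hc] with t ht
  rwa [hS, torusRefl_torusRefl] at ht

theorem IsMero.comp {n : ℕ} [NeZero n] (qh : ℂˣ) (j : Fin (n + 1)) {f : Torus n → ℂ}
    (hf : IsMero f) : IsMero (fun t => f (torusRefl qh j t)) := by
  obtain ⟨S, hSa, hS⟩ := torusRefl_extends qh j
  intro p
  obtain ⟨g, h, hg, hh, h0, he⟩ := hf (torusRefl qh j p)
  refine ⟨fun z => g (S z), fun z => h (S z), AnalyticAt.fun_comp (by rwa [hS]) (hSa p),
    AnalyticAt.fun_comp (by rwa [hS]) (hSa p), germ_comp qh j hS p h0, ?_⟩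
  filter_upwards [((continuous_torusRefl qh j).tendsto p).eventually he] with t ht
  simpa only [hS] using ht

theorem IsNull.comp {n : ℕ} [NeZero n] (qh : ℂˣ) (j : Fin (n + 1)) {f : Torus n → ℂ}
    (hf : IsNull f) : IsNull (fun t => f (torusRefl qh j t)) := by
  obtain ⟨S, hSa, hS⟩ := torusRefl_extends qh j
  intro p
  obtain ⟨h, hh, h0, he⟩ := hf (torusRefl qh j p)
  refine ⟨fun z => h (S z), AnalyticAt.fun_comp (by rwa [hS]) (hSa p), germ_comp qh j hS p h0, ?_⟩
  filter_upwards [((continuous_torusRefl qh j).tendsto p).eventually he] with t ht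
  simpa only [hS] using ht

/-- The action `(s_j f)(t) = f(s_j t)` of the simple reflections on `M(T)`. -/
def meroRefl {n : ℕ} [NeZero n] (qh : ℂˣ) (j : Fin (n + 1)) : Mero n →ₐ[ℂ] Mero n :=
  Ideal.quotientMapₐ (nullIdeal n)
    { toFun := fun f => ⟨fun t => f.1 (torusRefl qh j t), IsMero.comp qh j f.2⟩
      map_one' := rfl
      map_mul' := fun _ _ => rfl
      map_zero' := rfl
      map_add' := fun _ _ => rfl
      commutes' := fun _ => rfl }
    (fun f hf => IsNull.comp qh j (f := f.1) hf)

/-! ### The rational coefficient functions -/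

/-- The functions `q^{1/2} / t_1`, `t_i / t_{i+1}` (`1 ≤ i < n`) and `t_n` attached to
`s_0`, `s_i` and `s_n`. -/
def spectral {n : ℕ} [NeZero n] (qh : ℂˣ) : Fin (n + 1) → Torus n → ℂˣ :=
  Fin.cases (fun t => qh / t 0)
    (fun i t => if h : i.val + 1 < n then t i / t ⟨i.val + 1, h⟩ else t i)

theorem spectral_scale {n : ℕ} [NeZero n] (qh : ℂˣ) (j : Fin (n + 1)) :
    ∃ k : Fin n, ∃ e : ℤ, (e = 1 ∨ e = -1) ∧ ∀ (t : Torus n) (u : ℂˣ),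
      spectral qh j (Function.update t k (t k * u)) = spectral qh j t * u ^ e := by
  refine Fin.cases ?_ (fun i => ?_) j
  · refine ⟨0, -1, Or.inr rfl, fun t u => ?_⟩
    simp [spectral, div_eq_mul_inv, mul_comm, mul_left_comm]
  · refine ⟨i, 1, Or.inl rfl, fun t u => ?_⟩
    simp only [spectral, Fin.cases_succ]
    split_ifs with h
    · have : (⟨i.val + 1, h⟩ : Fin n) ≠ i := by
        intro hc
        have := congrArg Fin.val hc
        simp at this
      simp [Function.update_of_ne this, div_mul_eq_mul_div]
    · simp

theorem spectral_extends {n : ℕ} [NeZero n] (qh : ℂˣ) (j : Fin (n + 1)) :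
    ∃ X : (Fin n → ℂ) → ℂ, (∀ p : Torus n, AnalyticAt ℂ X (toC p)) ∧
      ∀ t, X (toC t) = spectral qh j t := by
  have hproj : ∀ (k' : Fin n) (z : Fin n → ℂ), AnalyticAt ℂ (fun z : Fin n → ℂ => z k') z :=
    fun k' z => (ContinuousLinearMap.proj (R := ℂ) (φ := fun _ : Fin n => ℂ) k').analyticAt z
  refine Fin.cases ?_ (fun i => ?_) j
  · refine ⟨fun z => (qh : ℂ) / z 0, fun p => analyticAt_const.div (hproj 0 _) (toC_ne_zero p 0),
      fun t => ?_⟩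
    simp [spectral, toC]
  · by_cases h : i.val + 1 < n
    · refine ⟨fun z => z i / z ⟨i.val + 1, h⟩,
        fun p => (hproj _ _).div (hproj _ _) (toC_ne_zero p _), fun t => ?_⟩
      simp [spectral, toC, h]
    · refine ⟨fun z => z i, fun p => hproj _ _, fun t => ?_⟩
      simp [spectral, toC, h]

/-- If `x` is a holomorphic function on the torus that is homogeneous of degree `±1` in some
coordinate, and `D` a nonzero polynomial, then `D(x)` has no identically vanishing germ. -/
theorem germ_poly {n : ℕ} (x : Torus n → ℂˣ) (X : (Fin n → ℂ) → ℂ)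
    (hX' : ∀ t, X (toC t) = x t) (k : Fin n) (e : ℤ) (he : e = 1 ∨ e = -1)
    (hk : ∀ (t : Torus n) (u : ℂˣ), x (Function.update t k (t k * u)) = x t * u ^ e)
    (D : Polynomial ℂ) (hD : D ≠ 0) (p : Torus n) :
    ¬ ∀ᶠ z in 𝓝 (toC p), D.eval (X z) = 0 := by
  rw [eventually_toC]
  intro hc
  have hcont : Filter.Tendsto (fun u : ℂˣ => Function.update p k (p k * u)) (𝓝 1) (𝓝 p) := by
    have : Continuous (fun u : ℂˣ => Function.update p k (p k * u)) :=
      continuous_const.update k (continuous_const.mul continuous_id)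
    have h1 := this.tendsto 1
    simpa using h1
  have hroot := hcont.eventually hc
  have hinj : Function.Injective fun u : ℂˣ => ((x p * u ^ e : ℂˣ) : ℂ) := by
    intro u v huv
    have h1 : x p * u ^ e = x p * v ^ e := Units.ext huv
    have h2 := mul_left_cancel h1
    rcases he with rfl | rfl
    · simpa using h2
    · simpa using h2
  have hinf : {u : ℂˣ | D.eval ((x p * u ^ e : ℂˣ) : ℂ) = 0}.Infinite := by
    have hmem : {u : ℂˣ | D.eval ((x p * u ^ e : ℂˣ) : ℂ) = 0} ∈ 𝓝 (1 : ℂˣ) := by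
      filter_upwards [hroot] with u hu
      rw [hX', hk] at hu
      exact hu
    have hmem' := (Units.isOpenEmbedding_val (R := ℂ)).image_mem_nhds.2 hmem
    exact Set.Infinite.of_image _ (infinite_of_mem_nhds _ hmem')
  refine hD (Polynomial.eq_zero_of_infinite_isRoot D ((hinf.image hinj.injOn).mono ?_))
  rintro _ ⟨u, hu, rfl⟩
  exact hu

/-- A quotient of polynomials, evaluated at one of the functions `q^{1/2} / t_1`,
`t_i / t_{i+1}`, `t_n`, is meromorphic. -/
theorem isMero_rat {n : ℕ} [NeZero n] (qh : ℂˣ) (j : Fin (n + 1)) (N D : Polynomial ℂ)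
    (hD : D ≠ 0) :
    IsMero (fun t : Torus n => N.eval (spectral qh j t : ℂ) / D.eval (spectral qh j t : ℂ)) := by
  obtain ⟨X, hX, hX'⟩ := spectral_extends (n := n) qh j
  obtain ⟨k, e, he, hk⟩ := spectral_scale (n := n) qh j
  intro p
  have hev : ∀ P : Polynomial ℂ, AnalyticAt ℂ (fun z => P.eval (X z)) (toC p) := fun P => by
    simpa using (hX p).aeval_polynomial P
  exact ⟨fun z => N.eval (X z), fun z => D.eval (X z), hev N, hev D,
    germ_poly _ X hX' k e he hk D hD p, Filter.Eventually.of_forall fun t _ => by simp only [hX']⟩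

/-- `P` holds outside the zero set of a holomorphic function, near each point. -/
def Generic {n : ℕ} (P : Torus n → Prop) : Prop :=
  ∀ p : Torus n, ∃ h : (Fin n → ℂ) → ℂ, AnalyticAt ℂ h (toC p) ∧
    (¬ ∀ᶠ z in 𝓝 (toC p), h z = 0) ∧ ∀ᶠ t in 𝓝 p, h (toC t) ≠ 0 → P t

theorem Generic.and {n : ℕ} {P Q : Torus n → Prop} (hP : Generic P) (hQ : Generic Q) :
    Generic fun t => P t ∧ Q t := by
  intro p
  obtain ⟨h, hh, h0, he⟩ := hP p
  obtain ⟨h', hh', h0', he'⟩ := hQ p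
  refine ⟨fun z => h z * h' z, hh.mul hh', germ_mul hh hh' h0 h0', ?_⟩
  filter_upwards [he, he'] with t h1 h2 h3
  exact ⟨h1 (left_ne_zero_of_mul h3), h2 (right_ne_zero_of_mul h3)⟩

theorem Generic.mono {n : ℕ} {P Q : Torus n → Prop} (hP : Generic P) (h : ∀ t, P t → Q t) :
    Generic Q := by
  intro p
  obtain ⟨g, hg, h0, he⟩ := hP p
  refine ⟨g, hg, h0, ?_⟩
  filter_upwards [he] with t h1 h2
  exact h t (h1 h2)

theorem generic_poly {n : ℕ} (x : Torus n → ℂˣ) (X : (Fin n → ℂ) → ℂ)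
    (hX : ∀ p : Torus n, AnalyticAt ℂ X (toC p))
    (hX' : ∀ t, X (toC t) = x t) (k : Fin n) (e : ℤ) (he : e = 1 ∨ e = -1)
    (hk : ∀ (t : Torus n) (u : ℂˣ), x (Function.update t k (t k * u)) = x t * u ^ e)
    (D : Polynomial ℂ) (hD : D ≠ 0) : Generic fun t => D.eval (x t : ℂ) ≠ 0 := by
  intro p
  refine ⟨fun z => D.eval (X z), by simpa using (hX p).aeval_polynomial D,
    germ_poly x X hX' k e he hk D hD p, Filter.Eventually.of_forall fun t ht => ?_⟩
  simpa only [hX'] using ht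

theorem generic_spectral {n : ℕ} [NeZero n] (qh : ℂˣ) (j : Fin (n + 1)) :
    Generic fun t : Torus n => (spectral qh j t : ℂ) ≠ 1 ∧ (spectral qh j t : ℂ) ^ 2 ≠ 1 := by
  obtain ⟨X, hX, hX'⟩ := spectral_extends (n := n) qh j
  obtain ⟨k, e, he, hk⟩ := spectral_scale (n := n) qh j
  refine (generic_poly _ X hX hX' k e he hk (Polynomial.X ^ 2 - Polynomial.C 1)
    (Polynomial.X_pow_sub_C_ne_zero two_pos 1)).mono fun t ht => ?_
  have h2 : (spectral qh j t : ℂ) ^ 2 ≠ 1 := by simpa [sub_eq_zero] using ht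
  exact ⟨fun h => h2 (by rw [h, one_pow]), h2⟩

theorem analyticAt_coord {n : ℕ} (k : Fin n) (z : Fin n → ℂ) :
    AnalyticAt ℂ (fun z : Fin n → ℂ => z k) z :=
  (ContinuousLinearMap.proj (R := ℂ) (φ := fun _ : Fin n => ℂ) k).analyticAt z

theorem generic_sq {n : ℕ} (a : Fin n) (c : ℂ) :
    Generic fun t : Torus n => (t a : ℂ) ^ 2 ≠ c := by
  refine (generic_poly (fun t => t a) (fun z => z a) (fun p => analyticAt_coord a _)
    (fun t => rfl) a 1 (Or.inl rfl) (fun t u => by simp) (Polynomial.X ^ 2 - Polynomial.C c)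
    (Polynomial.X_pow_sub_C_ne_zero two_pos c)).mono fun t ht => ?_
  simpa [sub_eq_zero] using ht

theorem generic_mul {n : ℕ} {a b : Fin n} (hab : a ≠ b) (c : ℂ) :
    Generic fun t : Torus n => (t a : ℂ) * t b ≠ c := by
  refine (generic_poly (fun t => t a * t b) (fun z => z a * z b)
    (fun p => (analyticAt_coord a _).mul (analyticAt_coord b _))
    (fun t => rfl) a 1 (Or.inl rfl)
    (fun t u => by simp [Function.update_of_ne hab.symm, mul_right_comm])
    (Polynomial.X - Polynomial.C c) (Polynomial.X_sub_C_ne_zero c)).mono fun t ht => ?_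
  simpa [sub_eq_zero] using ht

theorem generic_ne {n : ℕ} {a b : Fin n} (hab : a ≠ b) :
    Generic fun t : Torus n => t a ≠ t b := by
  refine (generic_poly (fun t => t a / t b) (fun z => z a / z b)
    (fun p => (analyticAt_coord a _).div (analyticAt_coord b _) (toC_ne_zero p b))
    (fun t => by simp [toC]) a 1 (Or.inl rfl)
    (fun t u => by simp [Function.update_of_ne hab.symm, div_mul_eq_mul_div])
    (Polynomial.X - Polynomial.C 1) (Polynomial.X_sub_C_ne_zero 1)).mono fun t ht h => ht ?_
  simp [h]

/-- The rational function `κ⁻¹ (1 - κ² x) / (1 - x)`. -/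
def cMid (k x : ℂ) : ℂ := k⁻¹ * ((1 - k ^ 2 * x) / (1 - x))

/-- The rational function `κ⁻¹ (1 - κ υ x) (1 + κ υ⁻¹ x) / (1 - x²)`. -/
def cEnd (k u x : ℂ) : ℂ := k⁻¹ * ((1 - k * u * x) * (1 + k * u⁻¹ * x) / (1 - x ^ 2))

/-- The functions `c_j(t; κ; υ_0, υ_n)` for `0 ≤ j ≤ n`. -/
def cFun {n : ℕ} [NeZero n] (qh : ℂˣ) (κ : Kappa) (u0 un : ℂˣ) (j : Fin (n + 1)) (t : Torus n) :
    ℂ :=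
  if j.val = 0 then cEnd κ.zero u0 (spectral qh j t)
  else if j.val < n then cMid κ.mid (spectral qh j t)
  else cEnd κ.last un (spectral qh j t)

open Polynomial in
theorem isMero_cFun {n : ℕ} [NeZero n] (qh : ℂˣ) (κ : Kappa) (u0 un : ℂˣ) (j : Fin (n + 1)) :
    IsMero (cFun (n := n) qh κ u0 un j) := by
  have hE : ∀ k u : ℂ, IsMero (fun t : Torus n => cEnd k u (spectral qh j t)) := fun k u => by
    have := isMero_rat (n := n) qh j (C k⁻¹ * ((1 - C (k * u) * X) * (1 + C (k * u⁻¹) * X)))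
      (1 - X ^ 2) (by
        intro h
        have := congrArg (Polynomial.eval 0) h
        simp at this)
    simpa [cEnd, mul_div_assoc] using this
  have hM : ∀ k : ℂ, IsMero (fun t : Torus n => cMid k (spectral qh j t)) := fun k => by
    have := isMero_rat (n := n) qh j (C k⁻¹ * (1 - C (k ^ 2) * X)) (1 - X) (by
        intro h
        have := congrArg (Polynomial.eval 0) h
        simp at this)
    simpa [cMid, mul_div_assoc] using this
  unfold cFun
  split_ifs
  · exact hE _ _
  · exact hM _
  · exact hE _ _

/-- The operator `f ↦ κ_j f + c_j (s_j f - f)` on functions. -/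
def koornFun {n : ℕ} [NeZero n] (qh : ℂˣ) (κ : Kappa) (u0 un : ℂˣ) (j : Fin (n + 1))
    (f : Torus n → ℂ) (t : Torus n) : ℂ :=
  κ.at j * f t + cFun qh κ u0 un j t * (f (torusRefl qh j t) - f t)

/-- The operator `f ↦ κ_j f + c_j (s_j f - f)` on `M(T)`. -/
def koornOp {n : ℕ} [NeZero n] (qh : ℂˣ) (κ : Kappa) (u0 un : ℂˣ) (j : Fin (n + 1)) :
    Module.End ℂ (Mero n) :=
  (κ.at j : ℂ) • LinearMap.id +
    LinearMap.mulLeft ℂ (toMero n ⟨_, isMero_cFun qh κ u0 un j⟩) ∘ₗ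
      ((meroRefl qh j).toLinearMap - LinearMap.id)

/-- The operator on functions representing meromorphic functions. -/
def koornRep {n : ℕ} [NeZero n] (qh : ℂˣ) (κ : Kappa) (u0 un : ℂˣ) (j : Fin (n + 1))
    (f : meroFun n) : meroFun n :=
  (κ.at j : ℂ) • f + ⟨_, isMero_cFun qh κ u0 un j⟩ * (⟨_, IsMero.comp qh j f.2⟩ - f)

theorem koornRep_val {n : ℕ} [NeZero n] (qh : ℂˣ) (κ : Kappa) (u0 un : ℂˣ) (j : Fin (n + 1))
    (f : meroFun n) : (koornRep qh κ u0 un j f).1 = koornFun qh κ u0 un j f.1 := rfl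

theorem koornOp_mk {n : ℕ} [NeZero n] (qh : ℂˣ) (κ : Kappa) (u0 un : ℂˣ) (j : Fin (n + 1))
    (f : meroFun n) : koornOp qh κ u0 un j (toMero n f) =
      toMero n (koornRep qh κ u0 un j f) := rfl

theorem mk_eq_of_generic {n : ℕ} {f g : meroFun n} (h : Generic fun t => f.1 t = g.1 t) :
    toMero n f = toMero n g := by
  refine Ideal.Quotient.eq.2 ?_
  exact h.mono fun t ht => by simpa [sub_eq_zero] using ht

theorem cMid_inv {k x : ℂ} (hk : k ≠ 0) (hx : x ≠ 0) (h1 : x ≠ 1) :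
    cMid k x⁻¹ = k + k⁻¹ - cMid k x := by
  have h2 : 1 - x ≠ 0 := sub_ne_zero.2 h1.symm
  have h3 : 1 - x⁻¹ ≠ 0 := sub_ne_zero.2 fun h => h1 (by rw [← inv_inv x, ← h, inv_one])
  have e : (1 - k ^ 2 * x⁻¹) / (1 - x⁻¹) = (k ^ 2 - x) / (1 - x) := by
    rw [div_eq_div_iff h3 h2]
    field_simp
    ring
  unfold cMid
  rw [e]
  field_simp
  ring

theorem cEnd_inv {k u x : ℂ} (hk : k ≠ 0) (hu : u ≠ 0) (hx : x ≠ 0) (h1 : x ^ 2 ≠ 1) :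
    cEnd k u x⁻¹ = k + k⁻¹ - cEnd k u x := by
  have h2 : 1 - x ^ 2 ≠ 0 := sub_ne_zero.2 h1.symm
  have h3 : 1 - x⁻¹ ^ 2 ≠ 0 := sub_ne_zero.2 fun h => h1 (by
    rw [inv_pow] at h
    rw [← inv_inv (x ^ 2), ← h, inv_one])
  have e : ((1 - k * u * x⁻¹) * (1 + k * u⁻¹ * x⁻¹)) / (1 - x⁻¹ ^ 2) =
      ((k * u - x) * (x + k * u⁻¹)) / (1 - x ^ 2) := by
    rw [div_eq_div_iff h3 h2]
    field_simp
    ring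
  unfold cEnd
  rw [e]
  field_simp
  ring

theorem c_relation {k k' u x y : ℂ} (hk : k ≠ 0) (hk' : k' ≠ 0) (hu : u ≠ 0) (hy : y ≠ 0)
    (h1 : x ^ 2 ≠ 1) (h2 : y ^ 2 ≠ 1) (h3 : x ≠ y) (h4 : x * y ≠ 1) :
    cEnd k' u y * (cMid k (x / y) - cMid k (x * y)) +
      cEnd k' u x * (k + k⁻¹ - cMid k (x / y) - cMid k (x * y)) +
      k'⁻¹ * (cMid k (x * y) - k) - k' * (k⁻¹ - cMid k (x * y)) = 0 := by
  have k1 : y - x ≠ 0 := sub_ne_zero.2 h3.symm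
  have e1 : cMid k (x / y) = (y - k ^ 2 * x) / (k * (y - x)) := by
    unfold cMid
    field_simp
  have k2 : 1 - x * y ≠ 0 := sub_ne_zero.2 h4.symm
  have k2' : 1 - y * x ≠ 0 := by rwa [mul_comm]
  have k3 : 1 - x ^ 2 ≠ 0 := sub_ne_zero.2 h1.symm
  have k4 : 1 - y ^ 2 ≠ 0 := sub_ne_zero.2 h2.symm
  rw [e1]
  unfold cEnd cMid
  field_simp
  ring

theorem quadratic_aux {A : Type*} [Ring A] [Algebra ℂ A] {a : A} {k : ℂ} (hk : k ≠ 0)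
    (h : a * a = (k - k⁻¹) • a + 1) :
    (a - algebraMap ℂ _ k) * (a + algebraMap ℂ _ k⁻¹) = 0 := by
  have hc : (algebraMap ℂ A) k * algebraMap ℂ _ k⁻¹ = 1 := by
    rw [← map_mul, mul_inv_cancel₀ hk, map_one]
  rw [sub_mul, mul_add, mul_add, hc, h, sub_smul, Algebra.smul_def, Algebra.smul_def,
    Algebra.commutes k⁻¹ a]
  abel

theorem at_zero {n : ℕ} (κ : Kappa) : κ.at (0 : Fin (n + 1)) = κ.zero := rfl

theorem at_mid {n : ℕ} (κ : Kappa) (i : Fin n) (h : i.val + 1 < n) : κ.at i.succ = κ.mid := by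
  simp [Kappa.at, h]

theorem at_last {n : ℕ} (κ : Kappa) (i : Fin n) (h : ¬ i.val + 1 < n) : κ.at i.succ = κ.last := by
  simp [Kappa.at, h]

theorem mero_ext {n : ℕ} {A B : Module.End ℂ (Mero n)}
    (h : ∀ f : meroFun n, A (toMero n f) = B (toMero n f)) : A = B := by
  refine LinearMap.ext fun x => ?_
  obtain ⟨f, rfl⟩ := Ideal.Quotient.mk_surjective x
  exact h f

section Relations

variable {n : ℕ} [NeZero n] (qh : ℂˣ) (κ : Kappa) (u0 un : ℂˣ)

theorem koornFun_braid4 (i j : Fin (n + 1)) (u : ℂˣ) (U : ℂˣ → ℂˣ → Torus n)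
    (hci : ∀ t : Torus n, cFun qh κ u0 un i t = cMid (κ.at i) (spectral qh i t))
    (hcj : ∀ t : Torus n, cFun qh κ u0 un j t = cEnd (κ.at j) u (spectral qh j t))
    (hri : ∀ x y, torusRefl qh i (U x y) = U y x)
    (hrj : ∀ x y, torusRefl qh j (U x y) = U x y⁻¹)
    (hsi : ∀ x y, spectral qh i (U x y) = x / y)
    (hsj : ∀ x y, spectral qh j (U x y) = y) (f : Torus n → ℂ) (x y : ℂˣ)
    (h1 : (x : ℂ) ^ 2 ≠ 1) (h2 : (y : ℂ) ^ 2 ≠ 1) (h3 : (x : ℂ) ≠ y) (h4 : (x : ℂ) * y ≠ 1) :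
    koornFun qh κ u0 un i (koornFun qh κ u0 un j (koornFun qh κ u0 un i
      (koornFun qh κ u0 un j f))) (U x y) =
    koornFun qh κ u0 un j (koornFun qh κ u0 un i (koornFun qh κ u0 un j
      (koornFun qh κ u0 un i f))) (U x y) := by
  simp only [koornFun, hci, hcj, hri, hrj, hsi, hsj, inv_inv, Units.val_div_eq_div_val,
    Units.val_inv_eq_inv_val]
  have hk := (κ.at i).ne_zero
  have hk' := (κ.at j).ne_zero
  have hu := u.ne_zero
  have hx := x.ne_zero
  have hy := y.ne_zero
  have E := c_relation hk hk' hu hy h1 h2 h3 h4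
  have e2 : cMid (κ.at i) ((y : ℂ) / x) = κ.at i + (κ.at i : ℂ)⁻¹ - cMid (κ.at i) (x / y) := by
    rw [← cMid_inv hk (div_ne_zero hx hy) (fun h => h3 ((div_eq_one_iff_eq hy).1 h)), inv_div]
  have e5 : cMid (κ.at i) ((y : ℂ)⁻¹ / x) =
      κ.at i + (κ.at i : ℂ)⁻¹ - cMid (κ.at i) (x * y) := by
    rw [← cMid_inv hk (mul_ne_zero hx hy) h4, mul_inv_rev, div_eq_mul_inv]
  have e8 : (y : ℂ)⁻¹ / (x : ℂ)⁻¹ = x / y := by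
    rw [inv_div_inv]
  have f1 := cEnd_inv hk' hu hx h1
  have f2 := cEnd_inv hk' hu hy h2
  simp only [e2, e5, e8, f1, f2, div_inv_eq_mul, mul_comm (y : ℂ) (x : ℂ)]
  generalize cMid (κ.at i) ((x : ℂ) / y) = p at *
  generalize cMid (κ.at i) ((x : ℂ) * y) = r at *
  generalize cEnd (κ.at j) u x = m at *
  generalize cEnd (κ.at j) u y = v at *
  linear_combination E * (p * (v - m) * f (U y x) + v * (r - p) * f (U x y⁻¹)
    + p * m * f (U y x⁻¹) - v * r * f (U y⁻¹ x))

theorem koornFun_braid3 (i j : Fin (n + 1)) (hij : κ.at i = κ.at j) (U : ℂˣ → ℂˣ → ℂˣ → Torus n)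
    (hci : ∀ t : Torus n, cFun qh κ u0 un i t = cMid (κ.at i) (spectral qh i t))
    (hcj : ∀ t : Torus n, cFun qh κ u0 un j t = cMid (κ.at j) (spectral qh j t))
    (hri : ∀ x y z, torusRefl qh i (U x y z) = U y x z)
    (hrj : ∀ x y z, torusRefl qh j (U x y z) = U x z y)
    (hsi : ∀ x y z, spectral qh i (U x y z) = x / y)
    (hsj : ∀ x y z, spectral qh j (U x y z) = y / z) (f : Torus n → ℂ) (x y z : ℂˣ)
    (h1 : (x : ℂ) ≠ y) (h2 : (y : ℂ) ≠ z) (h3 : (x : ℂ) ≠ z) :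
    koornFun qh κ u0 un i (koornFun qh κ u0 un j (koornFun qh κ u0 un i f)) (U x y z) =
    koornFun qh κ u0 un j (koornFun qh κ u0 un i (koornFun qh κ u0 un j f)) (U x y z) := by
  simp only [koornFun, hci, hcj, hri, hrj, hsi, hsj, Units.val_div_eq_div_val, hij]
  have hk := (κ.at j).ne_zero
  have hx := x.ne_zero
  have hy := y.ne_zero
  have hz := z.ne_zero
  generalize (κ.at j : ℂ) = k at *
  have e1 : cMid k ((y : ℂ) / x) = k + k⁻¹ - cMid k (x / y) := by
    rw [← cMid_inv hk (div_ne_zero hx hy) (fun h => h1 ((div_eq_one_iff_eq hy).1 h)), inv_div]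
  have e2 : cMid k ((z : ℂ) / y) = k + k⁻¹ - cMid k (y / z) := by
    rw [← cMid_inv hk (div_ne_zero hy hz) (fun h => h2 ((div_eq_one_iff_eq hz).1 h)), inv_div]
  have E : cMid k ((x : ℂ) / y) * cMid k ((y : ℂ) / z) -
      cMid k ((x : ℂ) / z) * cMid k ((x : ℂ) / y) -
      cMid k ((x : ℂ) / z) * cMid k ((y : ℂ) / z) + (k + k⁻¹) * cMid k ((x : ℂ) / z) - 1 = 0 := by
    have g : ∀ a b : ℂ, b ≠ 0 → a ≠ b → cMid k (a / b) = (b - k ^ 2 * a) / (k * (b - a)) := by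
      intro a b hb hab
      have : b - a ≠ 0 := sub_ne_zero.2 hab.symm
      unfold cMid
      field_simp
    rw [g _ _ hy h1, g _ _ hz h2, g _ _ hz h3]
    have k1 : (y : ℂ) - x ≠ 0 := sub_ne_zero.2 h1.symm
    have k2 : (z : ℂ) - y ≠ 0 := sub_ne_zero.2 h2.symm
    have k3 : (z : ℂ) - x ≠ 0 := sub_ne_zero.2 h3.symm
    field_simp
    ring
  have hkk : k * k⁻¹ = 1 := mul_inv_cancel₀ hk
  simp only [e1, e2]
  generalize cMid k ((x : ℂ) / y) = p at *
  generalize cMid k ((y : ℂ) / z) = v at *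
  generalize cMid k ((x : ℂ) / z) = r at *
  generalize k⁻¹ = k' at *
  linear_combination E * (p * (f (U y x z) - f (U x y z)) - v * (f (U x z y) - f (U x y z)))  -
    hkk * (p * (f (U y x z) - f (U x y z)) - v * (f (U x z y) - f (U x y z)))

theorem koornFun_commute (i j : Fin (n + 1))
    (hci : ∀ t : Torus n, cFun qh κ u0 un i (torusRefl qh j t) = cFun qh κ u0 un i t)
    (hcj : ∀ t : Torus n, cFun qh κ u0 un j (torusRefl qh i t) = cFun qh κ u0 un j t)
    (hr : ∀ t : Torus n, torusRefl qh i (torusRefl qh j t) = torusRefl qh j (torusRefl qh i t))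
    (f : Torus n → ℂ) (t : Torus n) :
    koornFun qh κ u0 un i (koornFun qh κ u0 un j f) t =
    koornFun qh κ u0 un j (koornFun qh κ u0 un i f) t := by
  simp only [koornFun, hci, hcj, hr]
  ring

theorem torusRefl_zero (t : Torus n) :
    torusRefl qh 0 t = Function.update t 0 (qh ^ 2 * (t 0)⁻¹) := rfl

theorem torusRefl_mid (i : Fin n) (h : i.val + 1 < n) (t : Torus n) (k : Fin n) :
    torusRefl qh i.succ t k = t (Equiv.swap i ⟨i.val + 1, h⟩ k) := by
  simp [torusRefl, signedAct, simple, h]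

theorem torusRefl_last (i : Fin n) (h : ¬ i.val + 1 < n) (t : Torus n) :
    torusRefl qh i.succ t = Function.update t i (t i)⁻¹ := by
  funext k
  have e : torusRefl qh i.succ t k = t k ^ (((Pi.mulSingle i (-1) : Fin n → ℤˣ) k : ℤˣ) : ℤ) := by
    change signedAct n ℂˣ (simple i) t k = _
    rw [signedAct_apply, simple, dif_neg h]
    rfl
  rw [e]
  by_cases hk : k = i
  · subst hk
    simp
  · simp [hk]

theorem spectral_zero (t : Torus n) : spectral qh 0 t = qh / t 0 := rfl

theorem spectral_mid (i : Fin n) (h : i.val + 1 < n) (t : Torus n) :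
    spectral qh i.succ t = t i / t ⟨i.val + 1, h⟩ := by
  simp [spectral, h]

theorem spectral_last (i : Fin n) (h : ¬ i.val + 1 < n) (t : Torus n) :
    spectral qh i.succ t = t i := by
  simp [spectral, h]

theorem cFun_zero (t : Torus n) :
    cFun qh κ u0 un 0 t = cEnd (κ.at (0 : Fin (n + 1))) u0 (spectral qh 0 t) := rfl

theorem cFun_mid (i : Fin n) (h : i.val + 1 < n) (t : Torus n) :
    cFun qh κ u0 un i.succ t = cMid (κ.at i.succ) (spectral qh i.succ t) := by
  simp [cFun, h, at_mid]

theorem cFun_last (i : Fin n) (h : ¬ i.val + 1 < n) (t : Torus n) :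
    cFun qh κ u0 un i.succ t = cEnd (κ.at i.succ) un (spectral qh i.succ t) := by
  simp [cFun, h, at_last]

theorem spectral_torusRefl (j : Fin (n + 1)) (t : Torus n) :
    spectral qh j (torusRefl qh j t) = (spectral qh j t)⁻¹ := by
  refine Fin.cases ?_ (fun i => ?_) j
  · rw [spectral_zero, spectral_zero, torusRefl_zero, Function.update_self]
    rw [div_eq_mul_inv, mul_inv_rev, inv_inv, inv_div, div_eq_mul_inv, mul_left_comm, pow_two,
      mul_inv_rev, mul_inv_cancel_left]
  · by_cases h : i.val + 1 < n
    · rw [spectral_mid qh i h, spectral_mid qh i h, torusRefl_mid qh i h, torusRefl_mid qh i h]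
      simp
    · rw [spectral_last qh i h, spectral_last qh i h, torusRefl_last qh i h]
      simp

theorem cFun_torusRefl (j : Fin (n + 1)) (t : Torus n) (h1 : (spectral qh j t : ℂ) ≠ 1)
    (h2 : (spectral qh j t : ℂ) ^ 2 ≠ 1) :
    cFun qh κ u0 un j (torusRefl qh j t) =
      κ.at j + (κ.at j : ℂ)⁻¹ - cFun qh κ u0 un j t := by
  revert h1 h2
  refine Fin.cases ?_ (fun i => ?_) j
  · intro h1 h2
    rw [cFun_zero, cFun_zero, spectral_torusRefl, Units.val_inv_eq_inv_val,
      cEnd_inv (Units.ne_zero _) (Units.ne_zero _) (Units.ne_zero _) h2]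
  · intro h1 h2
    by_cases h : i.val + 1 < n
    · rw [cFun_mid qh κ u0 un i h, cFun_mid qh κ u0 un i h, spectral_torusRefl,
        Units.val_inv_eq_inv_val, cMid_inv (Units.ne_zero _) (Units.ne_zero _) h1]
    · rw [cFun_last qh κ u0 un i h, cFun_last qh κ u0 un i h, spectral_torusRefl,
        Units.val_inv_eq_inv_val,
        cEnd_inv (Units.ne_zero _) (Units.ne_zero _) (Units.ne_zero _) h2]

theorem koornOp_quadratic (j : Fin (n + 1)) :
    (koornOp qh κ u0 un j - algebraMap ℂ _ (κ.at j : ℂ)) *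
      (koornOp qh κ u0 un j + algebraMap ℂ _ (κ.at j : ℂ)⁻¹) = 0 := by
  have key : koornOp qh κ u0 un j * koornOp qh κ u0 un j =
      ((κ.at j : ℂ) - (κ.at j : ℂ)⁻¹) • koornOp qh κ u0 un j + 1 := by
    refine mero_ext fun f => ?_
    have : toMero n (koornRep qh κ u0 un j (koornRep qh κ u0 un j f)) =
        toMero n
          (((κ.at j : ℂ) - (κ.at j : ℂ)⁻¹) • koornRep qh κ u0 un j f + f) := by
      refine mk_eq_of_generic ((generic_spectral qh j).mono fun t ht => ?_)
      change koornFun qh κ u0 un j (koornFun qh κ u0 un j f.1) t =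
        ((κ.at j : ℂ) - (κ.at j : ℂ)⁻¹) * koornFun qh κ u0 un j f.1 t + f.1 t
      simp only [koornFun, torusRefl_torusRefl, cFun_torusRefl qh κ u0 un j t ht.1 ht.2]
      have hkk : (κ.at j : ℂ) * (κ.at j : ℂ)⁻¹ = 1 := mul_inv_cancel₀ (Units.ne_zero _)
      linear_combination f.1 t * hkk
    exact this
  exact quadratic_aux (Units.ne_zero _) key

theorem koornOp_commute (i j : Fin (n + 1)) (h : i.val + 1 < j.val) :
    koornOp qh κ u0 un i * koornOp qh κ u0 un j = koornOp qh κ u0 un j * koornOp qh κ u0 un i := by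
  refine mero_ext fun f => congrArg (toMero n) (Subtype.ext (funext fun t => ?_))
  change koornFun qh κ u0 un i (koornFun qh κ u0 un j f.1) t =
    koornFun qh κ u0 un j (koornFun qh κ u0 un i f.1) t
  have hs : ∀ t : Torus n, spectral qh i (torusRefl qh j t) = spectral qh i t ∧
      spectral qh j (torusRefl qh i t) = spectral qh j t ∧
      torusRefl qh i (torusRefl qh j t) = torusRefl qh j (torusRefl qh i t) := by
    intro t
    obtain ⟨b, rfl⟩ := Fin.exists_succ_eq.2 (show j ≠ 0 from fun hj => by simp [hj] at h)
    revert h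
    refine Fin.cases ?_ (fun a => ?_) i
    · intro h
      have hb0 : (0 : Fin n) ≠ b := fun h' => by
        rw [← h', Fin.val_succ, Fin.val_zero, Fin.val_zero] at h
        omega
      by_cases hb : b.val + 1 < n
      · have hb0' : (0 : Fin n) ≠ ⟨b.val + 1, hb⟩ := fun h' => by
          have h'' := congrArg Fin.val h'
          rw [Fin.val_zero] at h''
          simp only at h''
          omega
        refine ⟨?_, ?_, ?_⟩
        · rw [spectral_zero, spectral_zero, torusRefl_mid qh b hb,
            Equiv.swap_apply_of_ne_of_ne hb0 hb0']
        · rw [spectral_mid qh b hb, spectral_mid qh b hb, torusRefl_zero,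
            Function.update_of_ne hb0.symm, Function.update_of_ne hb0'.symm]
        · funext k
          rw [torusRefl_mid qh b hb, torusRefl_zero, torusRefl_zero, torusRefl_mid qh b hb,
            Equiv.swap_apply_of_ne_of_ne hb0 hb0']
          by_cases hk : k = 0
          · rw [hk, Equiv.swap_apply_of_ne_of_ne hb0 hb0', Function.update_self,
              Function.update_self]
          · have : Equiv.swap b ⟨b.val + 1, hb⟩ k ≠ 0 := fun h' => hk (by
              rw [← Equiv.swap_apply_of_ne_of_ne hb0 hb0'] at h'
              exact (Equiv.swap b _).injective h')
            rw [Function.update_of_ne hk, Function.update_of_ne this, torusRefl_mid qh b hb]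
      · refine ⟨?_, ?_, ?_⟩
        · rw [spectral_zero, spectral_zero, torusRefl_last qh b hb, Function.update_of_ne hb0]
        · rw [spectral_last qh b hb, spectral_last qh b hb, torusRefl_zero,
            Function.update_of_ne hb0.symm]
        · rw [torusRefl_last qh b hb, torusRefl_last qh b hb, torusRefl_zero, torusRefl_zero,
            Function.update_of_ne hb0, Function.update_of_ne hb0.symm,
            Function.update_comm hb0]
    · intro h
      simp only [Fin.val_succ] at h
      have ha : a.val + 1 < n := by omega
      have hab : a ≠ b := fun h' => by rw [h'] at h; omega
      have hab' : (⟨a.val + 1, ha⟩ : Fin n) ≠ b := fun h' => by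
        rw [Fin.ext_iff] at h'
        simp only at h'
        omega
      by_cases hb : b.val + 1 < n
      · have h3 : a ≠ ⟨b.val + 1, hb⟩ := fun h' => by
          rw [Fin.ext_iff] at h'
          simp only at h'
          omega
        have h4 : (⟨a.val + 1, ha⟩ : Fin n) ≠ ⟨b.val + 1, hb⟩ := fun h' => by
          rw [Fin.ext_iff] at h'
          simp only at h'
          omega
        refine ⟨?_, ?_, ?_⟩
        · rw [spectral_mid qh a ha, spectral_mid qh a ha, torusRefl_mid qh b hb,
            torusRefl_mid qh b hb, Equiv.swap_apply_of_ne_of_ne hab h3,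
            Equiv.swap_apply_of_ne_of_ne hab' h4]
        · rw [spectral_mid qh b hb, spectral_mid qh b hb, torusRefl_mid qh a ha,
            torusRefl_mid qh a ha, Equiv.swap_apply_of_ne_of_ne hab.symm hab'.symm,
            Equiv.swap_apply_of_ne_of_ne h3.symm h4.symm]
        · funext k
          rw [torusRefl_mid qh a ha, torusRefl_mid qh b hb, torusRefl_mid qh b hb,
            torusRefl_mid qh a ha]
          congr 1
          by_cases k1 : k = a
          · rw [k1, Equiv.swap_apply_left, Equiv.swap_apply_of_ne_of_ne hab' h4,
              Equiv.swap_apply_of_ne_of_ne hab h3, Equiv.swap_apply_left]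
          by_cases k2 : k = ⟨a.val + 1, ha⟩
          · rw [k2, Equiv.swap_apply_right, Equiv.swap_apply_of_ne_of_ne hab' h4,
              Equiv.swap_apply_of_ne_of_ne hab h3, Equiv.swap_apply_right]
          have e : Equiv.swap a ⟨a.val + 1, ha⟩ (Equiv.swap b ⟨b.val + 1, hb⟩ k) =
              Equiv.swap b ⟨b.val + 1, hb⟩ k := by
            refine Equiv.swap_apply_of_ne_of_ne (fun h' => k1 ?_) (fun h' => k2 ?_)
            · refine (Equiv.swap b ⟨b.val + 1, hb⟩).injective (h'.trans ?_)
              rw [Equiv.swap_apply_of_ne_of_ne hab h3]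
            · refine (Equiv.swap b ⟨b.val + 1, hb⟩).injective (h'.trans ?_)
              rw [Equiv.swap_apply_of_ne_of_ne hab' h4]
          rw [e, Equiv.swap_apply_of_ne_of_ne k1 k2]
      · refine ⟨?_, ?_, ?_⟩
        · rw [spectral_mid qh a ha, spectral_mid qh a ha, torusRefl_last qh b hb,
            Function.update_of_ne hab, Function.update_of_ne hab']
        · rw [spectral_last qh b hb, spectral_last qh b hb, torusRefl_mid qh a ha,
            Equiv.swap_apply_of_ne_of_ne hab.symm hab'.symm]
        · funext k
          rw [torusRefl_mid qh a ha, torusRefl_last qh b hb, torusRefl_last qh b hb,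
            torusRefl_mid qh a ha, Equiv.swap_apply_of_ne_of_ne hab.symm hab'.symm]
          by_cases hk : k = b
          · rw [hk, Equiv.swap_apply_of_ne_of_ne hab.symm hab'.symm, Function.update_self,
              Function.update_self]
          · have : Equiv.swap a ⟨a.val + 1, ha⟩ k ≠ b := fun h' => hk (by
              rw [← Equiv.swap_apply_of_ne_of_ne hab.symm hab'.symm] at h'
              exact (Equiv.swap a _).injective h')
            rw [Function.update_of_ne hk, Function.update_of_ne this, torusRefl_mid qh a ha]
  refine koornFun_commute qh κ u0 un i j (fun t => ?_) (fun t => ?_) (fun t => (hs t).2.2) _ _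
  · simp only [cFun, (hs t).1]
  · simp only [cFun, (hs t).2.1]

theorem koornOp_braid_mid (i j : Fin (n + 1)) (h0 : 0 < i.val) (h : j.val = i.val + 1)
    (hn : j.val < n) :
    koornOp qh κ u0 un i * koornOp qh κ u0 un j * koornOp qh κ u0 un i =
      koornOp qh κ u0 un j * koornOp qh κ u0 un i * koornOp qh κ u0 un j := by
  obtain ⟨a, rfl⟩ := Fin.exists_succ_eq.2 (show i ≠ 0 from fun hi => by simp [hi] at h0)
  obtain ⟨b, rfl⟩ := Fin.exists_succ_eq.2 (show j ≠ 0 from fun hj => by simp [hj] at h)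
  simp only [Fin.val_succ] at h hn
  have hb : b.val = a.val + 1 := by omega
  have ha' : a.val + 1 < n := by omega
  have hb' : b.val + 1 < n := hn
  set c : Fin n := ⟨b.val + 1, hb'⟩ with hc
  have hab' : (⟨a.val + 1, ha'⟩ : Fin n) = b := Fin.ext hb.symm
  have hab : a ≠ b := fun h => by rw [h] at hb; omega
  have hac : a ≠ c := fun h => by rw [hc, Fin.ext_iff] at h; simp at h; omega
  have hbc : b ≠ c := fun h => by rw [hc, Fin.ext_iff] at h; simp at h
  refine mero_ext fun f => ?_
  have : toMero n (koornRep qh κ u0 un a.succ (koornRep qh κ u0 un b.succ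
      (koornRep qh κ u0 un a.succ f))) = toMero n (koornRep qh κ u0 un b.succ
      (koornRep qh κ u0 un a.succ (koornRep qh κ u0 un b.succ f))) := by
    refine mk_eq_of_generic
      (((generic_ne hab).and ((generic_ne hbc).and (generic_ne hac))).mono fun t ht => ?_)
    simp only [koornRep_val]
    have hU : t = Function.update (Function.update (Function.update t a (t a)) b (t b)) c (t c) := by
      simp
    rw [hU]
    refine koornFun_braid3 qh κ u0 un a.succ b.succ
      (by rw [at_mid κ a ha', at_mid κ b hb'])
      (fun x y z => Function.update (Function.update (Function.update t a x) b y) c z)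
      (cFun_mid qh κ u0 un a ha') (cFun_mid qh κ u0 un b hb') ?_ ?_ ?_ ?_ _ _ _ _
      (fun h => ht.1 (Units.ext h)) (fun h => ht.2.1 (Units.ext h))
      (fun h => ht.2.2 (Units.ext h))
    · intro x y z
      funext k
      rw [torusRefl_mid qh a ha', hab']
      by_cases h1 : k = a
      · subst h1
        simp [hab, hac, hbc]
      by_cases h2 : k = b
      · subst h2
        simp [hab, hac, hbc]
      rw [Equiv.swap_apply_of_ne_of_ne h1 h2]
      simp [Function.update_apply, h1, h2]
    · intro x y z
      funext k
      rw [torusRefl_mid qh b hb', ← hc]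
      by_cases h1 : k = b
      · subst h1
        simp [hbc]
      by_cases h2 : k = c
      · subst h2
        simp [hbc]
      rw [Equiv.swap_apply_of_ne_of_ne h1 h2]
      simp [Function.update_apply, h1, h2]
    · intro x y z
      rw [spectral_mid qh a ha', hab']
      simp [hab, hac, hbc]
    · intro x y z
      rw [spectral_mid qh b hb', ← hc]
      simp [hbc]
  exact this

theorem koornOp_braid_right (i j : Fin (n + 1)) (h0 : 0 < i.val) (h : j.val = i.val + 1)
    (hn : j.val = n) :
    koornOp qh κ u0 un i * koornOp qh κ u0 un j * koornOp qh κ u0 un i * koornOp qh κ u0 un j =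
      koornOp qh κ u0 un j * koornOp qh κ u0 un i * koornOp qh κ u0 un j *
        koornOp qh κ u0 un i := by
  obtain ⟨a, rfl⟩ := Fin.exists_succ_eq.2 (show i ≠ 0 from fun hi => by simp [hi] at h0)
  obtain ⟨b, rfl⟩ := Fin.exists_succ_eq.2 (show j ≠ 0 from fun hj => by simp [hj] at h)
  simp only [Fin.val_succ] at h hn
  have hb : b.val = a.val + 1 := by omega
  have ha' : a.val + 1 < n := by omega
  have hb' : ¬ b.val + 1 < n := by omega
  have hab' : (⟨a.val + 1, ha'⟩ : Fin n) = b := Fin.ext hb.symm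
  have hab : a ≠ b := fun h => by rw [h] at hb; omega
  refine mero_ext fun f => ?_
  have : toMero n (koornRep qh κ u0 un a.succ (koornRep qh κ u0 un b.succ
      (koornRep qh κ u0 un a.succ (koornRep qh κ u0 un b.succ f)))) =
      toMero n (koornRep qh κ u0 un b.succ (koornRep qh κ u0 un a.succ
      (koornRep qh κ u0 un b.succ (koornRep qh κ u0 un a.succ f)))) := by
    refine mk_eq_of_generic
      (((generic_sq a 1).and ((generic_sq b 1).and ((generic_ne hab).and
        (generic_mul hab 1)))).mono fun t ht => ?_)
    simp only [koornRep_val]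
    have hU : t = Function.update (Function.update t a (t a)) b (t b) := by simp
    rw [hU]
    refine koornFun_braid4 qh κ u0 un a.succ b.succ un
      (fun x y => Function.update (Function.update t a x) b y)
      (cFun_mid qh κ u0 un a ha') (cFun_last qh κ u0 un b hb') ?_ ?_ ?_ ?_ _ _ _
      ht.1 ht.2.1 (fun h => ht.2.2.1 (Units.ext h)) ht.2.2.2
    · intro x y
      funext k
      rw [torusRefl_mid qh a ha', hab']
      by_cases h1 : k = a
      · subst h1
        simp [hab]
      by_cases h2 : k = b
      · subst h2
        simp [hab]
      rw [Equiv.swap_apply_of_ne_of_ne h1 h2]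
      simp [h1, h2]
    · intro x y
      rw [torusRefl_last qh b hb']
      simp
    · intro x y
      rw [spectral_mid qh a ha', hab']
      simp [hab]
    · intro x y
      rw [spectral_last qh b hb']
      simp
  exact this

theorem koornOp_braid_left (i j : Fin (n + 1)) (h0 : i.val = 0) (h : j.val = 1) (hn : j.val < n) :
    koornOp qh κ u0 un i * koornOp qh κ u0 un j * koornOp qh κ u0 un i * koornOp qh κ u0 un j =
      koornOp qh κ u0 un j * koornOp qh κ u0 un i * koornOp qh κ u0 un j *
        koornOp qh κ u0 un i := by
  obtain rfl : i = 0 := Fin.ext h0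
  obtain ⟨a, rfl⟩ := Fin.exists_succ_eq.2 (show j ≠ 0 from fun hj => by simp [hj] at h)
  simp only [Fin.val_succ] at h hn
  obtain rfl : a = 0 := Fin.ext (by rw [Fin.val_zero]; omega)
  have ha' : (0 : Fin n).val + 1 < n := hn
  set b : Fin n := ⟨(0 : Fin n).val + 1, ha'⟩ with hb
  have hab : (0 : Fin n) ≠ b := fun h => by rw [hb, Fin.ext_iff] at h; simp at h
  refine mero_ext fun f => ?_
  have : toMero n (koornRep qh κ u0 un 0 (koornRep qh κ u0 un (Fin.succ 0)
      (koornRep qh κ u0 un 0 (koornRep qh κ u0 un (Fin.succ 0) f)))) =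
      toMero n (koornRep qh κ u0 un (Fin.succ 0) (koornRep qh κ u0 un 0
      (koornRep qh κ u0 un (Fin.succ 0) (koornRep qh κ u0 un 0 f)))) := by
    refine mk_eq_of_generic
      (((generic_sq 0 ((qh : ℂ) ^ 2)).and ((generic_sq b ((qh : ℂ) ^ 2)).and
        ((generic_ne hab).and (generic_mul hab ((qh : ℂ) ^ 2))))).mono fun t ht => ?_)
    simp only [koornRep_val]
    have hU : t = Function.update (Function.update t 0 (qh / (qh / t 0))) b (qh / (qh / t b)) := by
      simp
    rw [hU]
    have hq := qh.ne_zero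
    have ht0 := (t 0).ne_zero
    have htb := (t b).ne_zero
    refine (koornFun_braid4 qh κ u0 un (Fin.succ 0) 0 u0
      (fun x y => Function.update (Function.update t 0 (qh / y)) b (qh / x))
      (cFun_mid qh κ u0 un 0 ha') (cFun_zero qh κ u0 un) ?_ ?_ ?_ ?_ _ _ _
      ?_ ?_ ?_ ?_).symm
    · intro x y
      funext k
      rw [torusRefl_mid qh 0 ha', ← hb]
      by_cases h1 : k = 0
      · subst h1
        simp [hab]
      by_cases h2 : k = b
      · subst h2
        simp [hab]
      rw [Equiv.swap_apply_of_ne_of_ne h1 h2]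
      simp [h1, h2]
    · intro x y
      rw [torusRefl_zero]
      have e : qh ^ 2 * (y / qh) = qh * y := by
        rw [pow_two, mul_assoc, mul_div_cancel]
      funext k
      by_cases h2 : k = b
      · subst h2
        simp [hab.symm]
      by_cases h1 : k = 0
      · subst h1
        simp [hab, e]
      simp [Function.update_apply, h1, h2]
    · intro x y
      rw [spectral_mid qh 0 ha', ← hb]
      simp [hab]
    · intro x y
      rw [spectral_zero]
      simp [hab]
    · intro h
      apply ht.2.1
      rw [Units.val_div_eq_div_val, div_pow, div_eq_one_iff_eq (pow_ne_zero 2 htb)] at h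
      exact h.symm
    · intro h
      apply ht.1
      rw [Units.val_div_eq_div_val, div_pow, div_eq_one_iff_eq (pow_ne_zero 2 ht0)] at h
      exact h.symm
    · intro h
      apply ht.2.2.1
      have h' : qh / t b = qh / t 0 := Units.ext h
      exact (div_right_injective h').symm
    · intro h
      apply ht.2.2.2
      rw [Units.val_div_eq_div_val, Units.val_div_eq_div_val, div_mul_div_comm,
        div_eq_one_iff_eq (mul_ne_zero htb ht0)] at h
      rw [pow_two, h, mul_comm]
  exact this

end Relations

/-- The algebra homomorphism `ϖ_{κ;υ_0,υ_n} : H(κ) → End(M(T))` defined by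
`ϖ(T_j) f = κ_j f + c_j (s_j f - f)`. -/
def varpi {n : ℕ} [NeZero n] (qh : ℂˣ) (κ : Kappa) (u0 un : ℂˣ) :
    Hecke n κ →ₐ[ℂ] Module.End ℂ (Mero n) :=
  RingQuot.liftAlgHom ℂ ⟨FreeAlgebra.lift ℂ (koornOp qh κ u0 un), by
    intro x y h
    cases h with
    | quadratic j =>
      simp only [map_mul, map_sub, map_add, map_zero, AlgHom.commutes, FreeAlgebra.lift_ι_apply]
      exact koornOp_quadratic qh κ u0 un j
    | commute i j h =>
      simp only [map_mul, FreeAlgebra.lift_ι_apply]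
      exact koornOp_commute qh κ u0 un i j h
    | braid_mid i j h0 h hn =>
      simp only [map_mul, FreeAlgebra.lift_ι_apply]
      exact koornOp_braid_mid qh κ u0 un i j h0 h hn
    | braid_left i j h0 h hn =>
      simp only [map_mul, FreeAlgebra.lift_ι_apply]
      exact koornOp_braid_left qh κ u0 un i j h0 h hn
    | braid_right i j h0 h hn =>
      simp only [map_mul, FreeAlgebra.lift_ι_apply]
      exact koornOp_braid_right qh κ u0 un i j h0 h hn⟩

theorem varpi_heckeT {n : ℕ} [NeZero n] (qh : ℂˣ) (κ : Kappa) (u0 un : ℂˣ) (j : Fin (n + 1)) :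
    varpi qh κ u0 un (heckeT κ j) = koornOp qh κ u0 un j := by
  rw [varpi, heckeT, RingQuot.liftAlgHom_mkAlgHom_apply, FreeAlgebra.lift_ι_apply]

/-! ### The reflection quantum KZ equations -/

/-- The denominators of `K_0(x)`, `R_i(x)` and `K_n(x)`. -/
def baxDen {n : ℕ} (κ : Kappa) (u0 un : ℂˣ) (j : Fin (n + 1)) (x : ℂ) : ℂ :=
  if j.val = 0 then
    (κ.zero : ℂ)⁻¹ * ((1 - κ.zero * u0 * x) * (1 + κ.zero * (u0 : ℂ)⁻¹ * x))
  else if j.val < n then (κ.mid : ℂ)⁻¹ * (1 - (κ.mid : ℂ) ^ 2 * x)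
  else (κ.last : ℂ)⁻¹ * ((1 - κ.last * un * x) * (1 + κ.last * (un : ℂ)⁻¹ * x))

/-- The coefficient of the identity in the numerators of `K_0(x)`, `R_i(x)` and `K_n(x)`. -/
def baxId {n : ℕ} (u0 un : ℂˣ) (j : Fin (n + 1)) (x : ℂ) : ℂ :=
  if j.val = 0 then ((u0 : ℂ)⁻¹ - u0) * x else if j.val < n then 0 else ((un : ℂ)⁻¹ - un) * x

/-- The coefficient of `-π(T_j)` in the numerators of `K_0(x)`, `R_i(x)` and `K_n(x)`. -/
def baxT {n : ℕ} (j : Fin (n + 1)) (x : ℂ) : ℂ :=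
  if j.val = 0 then x ^ 2 else if j.val < n then x else x ^ 2

open Polynomial in
theorem exists_baxDen {n : ℕ} (κ : Kappa) (u0 un : ℂˣ) (j : Fin (n + 1)) :
    ∃ D : ℂ[X], D ≠ 0 ∧ ∀ x, D.eval x = baxDen κ u0 un j x := by
  have key : ∀ D : ℂ[X], (∀ x, D.eval x = baxDen κ u0 un j x) → D ≠ 0 := by
    rintro D hD rfl
    have h := hD 0
    unfold baxDen at h
    split_ifs at h <;> simp at h <;> exact absurd h.symm (Units.ne_zero _)
  suffices h : ∃ D : ℂ[X], ∀ x, D.eval x = baxDen κ u0 un j x by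
    obtain ⟨D, hD⟩ := h
    exact ⟨D, key D hD, hD⟩
  unfold baxDen
  split_ifs
  · exact ⟨C (κ.zero : ℂ)⁻¹ *
      ((1 - C (κ.zero * u0 : ℂ) * X) * (1 + C (κ.zero * (u0 : ℂ)⁻¹) * X)), fun x => by simp⟩
  · exact ⟨C (κ.mid : ℂ)⁻¹ * (1 - C ((κ.mid : ℂ) ^ 2) * X), fun x => by simp⟩
  · exact ⟨C (κ.last : ℂ)⁻¹ *
      ((1 - C (κ.last * un : ℂ) * X) * (1 + C (κ.last * (un : ℂ)⁻¹) * X)), fun x => by simp⟩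

open Polynomial in
theorem isMero_bax {n : ℕ} [NeZero n] (qh : ℂˣ) (κ : Kappa) (u0 un : ℂˣ) (j : Fin (n + 1))
    {N : ℂ → ℂ} (hN : ∃ P : ℂ[X], ∀ x, P.eval x = N x) :
    IsMero fun t : Torus n =>
      N (spectral qh j t) / baxDen κ u0 un j (spectral qh j t) := by
  obtain ⟨P, hP⟩ := hN
  obtain ⟨D, hD0, hD⟩ := exists_baxDen κ u0 un j
  simpa only [hP, hD] using isMero_rat (n := n) qh j P D hD0

open Polynomial in
theorem exists_baxId {n : ℕ} (u0 un : ℂˣ) (j : Fin (n + 1)) :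
    ∃ P : ℂ[X], ∀ x, P.eval x = baxId u0 un j x := by
  unfold baxId
  split_ifs
  · exact ⟨C ((u0 : ℂ)⁻¹ - u0) * X, fun x => by simp⟩
  · exact ⟨0, fun x => by simp⟩
  · exact ⟨C ((un : ℂ)⁻¹ - un) * X, fun x => by simp⟩

open Polynomial in
theorem exists_baxT {n : ℕ} (j : Fin (n + 1)) : ∃ P : ℂ[X], ∀ x, P.eval x = baxT j x := by
  unfold baxT
  split_ifs
  · exact ⟨X ^ 2, fun x => by simp⟩
  · exact ⟨X, fun x => by simp⟩
  · exact ⟨X ^ 2, fun x => by simp⟩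

section KZ

variable (n : ℕ) [NeZero n] (qh : ℂˣ) (κ : Kappa) (u0 un : ℂˣ)
  (V : Type*) [AddCommGroup V] [Module ℂ V] [Module (Hecke n κ) V] [IsScalarTower ℂ (Hecke n κ) V]

/-- The operator `C_{s_j}(t)` on `M(T) ⊗ V`, that is `K_0(q^{1/2} / t_1)` for `j = 0`,
`R_j(t_j / t_{j+1})` for `1 ≤ j < n` and `K_n(t_n)` for `j = n`, where
`K_j(x) = (π(T_j⁻¹) + (υ_j⁻¹ - υ_j) x - x² π(T_j)) / (κ_j⁻¹ (1 - κ_j υ_j x) (1 + κ_j υ_j⁻¹ x))` and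
`R_j(x) = (π(T_j⁻¹) - x π(T_j)) / (κ⁻¹ (1 - κ² x))`. -/
def baxOp (j : Fin (n + 1)) : Module.End ℂ (Mero n ⊗[ℂ] V) :=
  TensorProduct.map
      (LinearMap.mulLeft ℂ (toMero n ⟨_, isMero_bax qh κ u0 un j (N := fun _ => 1)
        ⟨1, fun _ => Polynomial.eval_one⟩⟩))
      (Algebra.lsmul ℂ ℂ V (heckeTinv κ j)) +
    TensorProduct.map
      (LinearMap.mulLeft ℂ (toMero n ⟨_, isMero_bax qh κ u0 un j (exists_baxId u0 un j)⟩))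
      LinearMap.id -
    TensorProduct.map
      (LinearMap.mulLeft ℂ (toMero n ⟨_, isMero_bax qh κ u0 un j (exists_baxT j)⟩))
      (Algebra.lsmul ℂ ℂ V (heckeT κ j))

/-- The operator `∇(s_j)`, `(∇(s_j) f)(t) = C_{s_j}(t) f(s_j t)`. -/
def nablaSimple (j : Fin (n + 1)) : Module.End ℂ (Mero n ⊗[ℂ] V) :=
  baxOp n qh κ u0 un V j ∘ₗ TensorProduct.map (meroRefl qh j).toLinearMap LinearMap.id

/-- The operator `∇(s_{j_1}) ⋯ ∇(s_{j_r})`; it is `∇(w)` for `w = s_{j_1} ⋯ s_{j_r}`. -/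
def nablaWord (l : List (Fin (n + 1))) : Module.End ℂ (Mero n ⊗[ℂ] V) :=
  (l.map (nablaSimple n qh κ u0 un V)).prod

/-- The vectors fixed by `∇(w)`, for `w ∈ W`. Since `∇` is a representation of `W`, the operator
`∇(w)` may be computed from any expression of `w` as a product of simple reflections. -/
def nablaFixed (w : AffW n) : Submodule ℂ (Mero n ⊗[ℂ] V) where
  carrier := {f | ∀ l, affWord l = w → nablaWord n qh κ u0 un V l f = f}
  zero_mem' := fun l _ => map_zero _
  add_mem' := fun ha hb l hl => by rw [map_add, ha l hl, hb l hl]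
  smul_mem' := fun c f hf l hl => by rw [map_smul, hf l hl]

/-- The solutions of the reflection quantum KZ equations `∇(τ(l)) f = f`, for all `l ∈ ℤ^n`. -/
def solKZ : Submodule ℂ (Mero n ⊗[ℂ] V) :=
  ⨅ l : Fin n → ℤ, nablaFixed n qh κ u0 un V (transl l)

/-- The `W₀`-invariant solutions of the reflection quantum KZ equations. -/
def solKZInv : Submodule ℂ (Mero n ⊗[ℂ] V) :=
  solKZ n qh κ u0 un V ⊓ ⨅ w : W0 n, nablaFixed n qh κ u0 un V (SemidirectProduct.inr w)

end KZ

/-! ### The Cherednik–Matsuo map -/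

section CM

variable {n : ℕ} [NeZero n] (qh : ℂˣ) (κ : Kappa) (u0 un : ℂˣ)

/-- The common eigenspace `Sp_K(γ; κ; υ_0, υ_n)` of the nonsymmetric Koornwinder operators. -/
def spK (γ : Torus n) : Submodule ℂ (Mero n) :=
  ⨅ i : Fin n, LinearMap.ker
    (varpi qh κ⁻¹ u0⁻¹ un⁻¹ (heckeY κ⁻¹ i) - (γ i : ℂ) • LinearMap.id)

/-- The subspace `Sp_K^I(γ; κ; υ_0, υ_n)` of `Sp_K(γ; κ; υ_0, υ_n)` given by the equations
`ϖ(T_i) f = κ_i⁻¹ f` for `i ∈ I`. -/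
def spKI (I : Set (Fin n)) (γ : Torus n) : Submodule ℂ (Mero n) :=
  spK qh κ u0 un γ ⊓ ⨅ i ∈ I, LinearMap.ker
    (varpi qh κ⁻¹ u0⁻¹ un⁻¹ (heckeT κ⁻¹ i.succ) - (κ.at i.succ : ℂ)⁻¹ • LinearMap.id)

/-- The linear map
`φ ↦ ∑_{w ∈ W_0^I} ϖ_{κ⁻¹;υ_0⁻¹,υ_n⁻¹}(T_{w (w_0^I)⁻¹}) φ ⊗ v_w^I(γ; κ)`. -/
def cmMap (I : Set (Fin n)) (γ : Torus n) :
    Mero n →ₗ[ℂ] Mero n ⊗[ℂ] PrincipalSeries κ I γ :=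
  ∑ w ∈ (Set.toFinite (minReps I)).toFinset,
    (TensorProduct.mk ℂ (Mero n) (PrincipalSeries κ I γ)).flip (vvec κ I γ w) ∘ₗ
      varpi qh κ⁻¹ u0⁻¹ un⁻¹ (heckeTW κ⁻¹ (w * (w0I I)⁻¹))

end CM

end CherednikMatsuo

end

/-! The correspondence is Frobenius reciprocity for the Hecke algebra $H(\underline\kappa^{-1})$.
Write $M=M_I^{\underline\kappa}(\gamma)$.

On the side of the difference equations, the translations and $W_0$ generate $W$, so the invariant
solutions are the vectors fixed by every $\nabla(s_j)$, $0\le j\le n$ (`mem_solKZInv_iff`). An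
identity between the Baxterised element $C_{s_j}$ and the coefficient $c_j$ turns $\nabla(s_j)f=f$
into $(\varpi(T_j)\otimes 1)f=(1\otimes\pi(T_j^{-1}))f$ (`nablaSimple_fixed_iff`). Contracting with
functionals makes $f$ a linear map $M^*\to\mathcal M(T)$. The dual $M^*$ is an
$H(\underline\kappa^{-1})$-module through the anti-homomorphism $T_j\mapsto T_j^{-1}$
(`exists_sharp`, `exists_dualRep`), and the equations say exactly that this map is equivariant
(`mem_solKZInv_iff_contract`).

On the side of the module, let $\xi_0$ be the coordinate functional of $v_{w_0^I}$, where $w_0^I$ is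
the longest element of $W_0^I$. Triangularity of the $Y_j$ on the basis $v_w$ makes $\xi_0$ a joint
eigenvector of the $Y_j$ with weight $w_0^I\gamma^{-1}$ (`coord_w0I_heckeYs`). It is also an
eigenvector of $T_i$ with value $\kappa_i^{-1}$ for $i\in I^*$ (`coord_w0I_heckeTinv`), where
$I^*=I$ because $-1$ is central in $W_0$ (`starSet_eq`). The remaining coordinate functionals are
$T_{w(w_0^I)^{-1}}\xi_0$ (`coord_eq_heckeTW`). Thus $M^*$ is the principal series module of weight
$w_0^I\gamma^{-1}$ for $\underline\kappa^{-1}$. An equivariant map out of it is the choice of an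
image $\phi$ of $\xi_0$ in $\mathrm{Sp}_K^{I^*}(w_0^I\gamma^{-1})$, and reading off the coordinates
of $f$ gives the stated formula.

What needs real work is that the $v_w$, $w\in W_0^I$, form a basis of $M$ for every $\gamma\in
T_I^{\underline\kappa}$ (`exists_basis`). Spanning follows from the Bernstein relations.
Independence uses a representation in which the $Y_i$ multiply by $t_i^{-1}$ and the $T_i$ act by
reflection operators (`exists_polyRep`). There the $T_w$ are independent over functions, because
distinct elements of $W_0$ are independent as automorphisms. Evaluating coefficients at a point
gives the case $I=\emptyset$. General $I$ is reached because $(T_i-\kappa_i)\otimes 1$ is again a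
$Y$-eigenvector when $\gamma\in T_I^{\underline\kappa}$ (`heckeT_sub_eigen`).

All Coxeter combinatorics is done with signed permutations: the length counts the positive roots
that are negative on $w\rho$ (`len_eq_invNum`). -/

open scoped TensorProduct Topology

noncomputable section

namespace CherednikMatsuo

/-! ### Inversions and the length function of `W₀` -/

section Length

variable {n : ℕ}

/-- The linear action of `W₀` on `ℤ^n`. -/
def vact (w : W0 n) (x : Fin n → ℤ) : Fin n → ℤ :=
  fun k => ((w.left k : ℤˣ) : ℤ) * x (w.right⁻¹ k)

theorem vact_one (x : Fin n → ℤ) : vact 1 x = x := by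
  funext k
  simp [vact]

theorem vact_mul (w v : W0 n) (x : Fin n → ℤ) : vact (w * v) x = vact w (vact v x) := by
  funext k
  simp only [vact, SemidirectProduct.mul_left, SemidirectProduct.mul_right, mul_inv_rev,
    Equiv.Perm.mul_apply, Pi.mul_apply, Units.val_mul, mul_assoc]
  rfl

theorem vact_simple_mid (i : Fin n) (h : i.val + 1 < n) (x : Fin n → ℤ) (k : Fin n) :
    vact (simple i) x k = x (Equiv.swap i ⟨i.val + 1, h⟩ k) := by
  simp [vact, simple, h]

theorem vact_simple_last (i : Fin n) (h : ¬ i.val + 1 < n) (x : Fin n → ℤ) (k : Fin n) :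
    vact (simple i) x k = if k = i then -x k else x k := by
  simp only [vact, simple, h, dif_neg, not_false_eq_true, SemidirectProduct.left_inl,
    SemidirectProduct.right_inl, inv_one, Equiv.Perm.one_apply]
  by_cases hk : k = i
  · subst hk
    simp
  · simp [hk]

/-- The dominant regular vector `(n, n - 1, …, 1)`. -/
def rho (n : ℕ) : Fin n → ℤ := fun k => n - k.val

theorem rho_pos (k : Fin n) : 0 < rho n k := by
  have := k.isLt
  simp only [rho]
  omega

/-- A vector on which no root of `W₀` vanishes. -/
def RegVec (x : Fin n → ℤ) : Prop := ∀ j, x j ≠ 0 ∧ ∀ k, j ≠ k → x j ≠ x k ∧ x j + x k ≠ 0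

/-- The entries of $\rho$ are distinct positive integers, so after signs and permutations no entry,
sum or difference of entries vanishes. -/
theorem regVec_vact_rho (w : W0 n) : RegVec (vact w (rho n)) := by
  intro j
  have hp := rho_pos (w.right⁻¹ j)
  rcases Int.units_eq_one_or (w.left j) with h | h
  all_goals
    refine ⟨by simp only [vact, h, Units.val_one, Units.val_neg]; omega, fun k hk => ?_⟩
    have hk' : (w.right⁻¹ j) ≠ (w.right⁻¹ k) := fun h => hk (w.right⁻¹.injective h)
    have hne : (w.right⁻¹ j).val ≠ (w.right⁻¹ k).val := fun h => hk' (Fin.ext h)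
    have h1 := (w.right⁻¹ j).isLt
    have h2 := (w.right⁻¹ k).isLt
    rcases Int.units_eq_one_or (w.left k) with h' | h' <;>
      simp only [vact, h, h', Units.val_one, Units.val_neg, rho] <;> omega

/-- The condition that `x` is on the negative side of the hyperplane of the `i`-th simple
reflection. -/
def Desc (i : Fin n) (x : Fin n → ℤ) : Prop :=
  if h : i.val + 1 < n then x i < x ⟨i.val + 1, h⟩ else x i < 0

theorem desc_mid {i : Fin n} (h : i.val + 1 < n) (x : Fin n → ℤ) :
    Desc i x ↔ x i < x ⟨i.val + 1, h⟩ := by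
  simp [Desc, h]

theorem desc_last {i : Fin n} (h : ¬ i.val + 1 < n) (x : Fin n → ℤ) :
    Desc i x ↔ x i < 0 := by
  simp [Desc, h]

/-- The contribution of a pair of coordinates to the number of inversions. -/
def invPair (a b : ℤ) : ℤ := (if a < b then 1 else 0) + (if a + b < 0 then 1 else 0)

/-- The number of positive roots that are negative on `x`. -/
def invNum (x : Fin n → ℤ) : ℤ :=
  (∑ j, ∑ k, if j < k then invPair (x j) (x k) else 0) + ∑ j, if x j < 0 then 1 else 0

/-- An adjacent transposition preserves the order of every pair of indices other than the pair it
swaps, so only two terms change. -/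
theorem sum_swap_adjacent {i j : Fin n} (hij : j.val = i.val + 1) (g : Fin n → Fin n → ℤ) :
    (∑ a, ∑ b, if Equiv.swap i j a < Equiv.swap i j b then g a b else 0) =
      (∑ a, ∑ b, if a < b then g a b else 0) + g j i - g i j := by
  have e : ∀ a b : Fin n, (if Equiv.swap i j a < Equiv.swap i j b then g a b else 0) =
      (if a < b then g a b else 0) + (if a = j then if b = i then g a b else 0 else 0) -
        (if a = i then if b = j then g a b else 0 else 0) := by
    intro a b
    have ha : (Equiv.swap i j a).val = if a.val = i.val then j.val else
        if a.val = j.val then i.val else a.val := by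
      rw [Equiv.swap_apply_def]
      simp only [Fin.ext_iff]
      split_ifs <;> rfl
    have hb : (Equiv.swap i j b).val = if b.val = i.val then j.val else
        if b.val = j.val then i.val else b.val := by
      rw [Equiv.swap_apply_def]
      simp only [Fin.ext_iff]
      split_ifs <;> rfl
    simp only [Fin.lt_def, Fin.ext_iff, ha, hb]
    split_ifs <;> omega
  simp only [e, Finset.sum_add_distrib, Finset.sum_sub_distrib]
  simp

open Classical in
-- A simple reflection permutes the positive roots other than its own and negates that one. For the
-- last reflection, the roots $x_a-x_i$ and $x_a+x_i$ are exchanged, which is why `invPair` counts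
-- both together.
theorem invNum_simple (i : Fin n) (x : Fin n → ℤ) (hx : RegVec x) :
    invNum (vact (simple i) x) = invNum x + if Desc i x then -1 else 1 := by
  by_cases h : i.val + 1 < n
  · set j : Fin n := ⟨i.val + 1, h⟩ with hj
    have hne : i ≠ j := fun h => by
      have := congrArg Fin.val h
      simp [hj] at this
    have e : vact (simple i) x = x ∘ Equiv.swap i j := by
      funext k
      rw [vact_simple_mid i h]
      rfl
    have h1 : (∑ a, ∑ b, if a < b then invPair (x (Equiv.swap i j a)) (x (Equiv.swap i j b))
        else 0) = ∑ a, ∑ b, if Equiv.swap i j a < Equiv.swap i j b then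
          invPair (x a) (x b) else 0 := by
      rw [← Equiv.sum_comp (Equiv.swap i j)]
      refine Finset.sum_congr rfl fun a _ => ?_
      rw [← Equiv.sum_comp (Equiv.swap i j)]
      simp
    have h2 : (∑ a, if x (Equiv.swap i j a) < 0 then (1 : ℤ) else 0) =
        ∑ a, if x a < 0 then 1 else 0 :=
      Equiv.sum_comp (Equiv.swap i j) fun a => if x a < 0 then (1 : ℤ) else 0
    rw [e]
    simp only [invNum, Function.comp_apply]
    rw [h1, h2, sum_swap_adjacent (i := i) (j := j) rfl fun a b => invPair (x a) (x b)]
    have hd : Desc i x ↔ x i < x j := desc_mid h x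
    simp only [hd, invPair]
    have hr := ((hx i).2 j hne).1
    split_ifs <;> omega
  · have e : vact (simple i) x = fun k => if k = i then -x k else x k := by
      funext k
      rw [vact_simple_last i h]
    have h1 : ∀ a b : Fin n, (if a < b then invPair (if a = i then -x a else x a)
        (if b = i then -x b else x b) else 0) = if a < b then invPair (x a) (x b) else 0 := by
      intro a b
      by_cases hab : a < b
      · have ha : a ≠ i := fun ha => by
          have := b.isLt
          rw [ha, Fin.lt_def] at hab
          omega
        simp only [hab, ha, if_true, if_false, invPair]
        have hr := (hx a).2 b hab.ne
        have := hr.1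
        have := hr.2
        split_ifs <;> omega
      · simp [hab]
    have h2 : ∀ a : Fin n, (if (if a = i then -x a else x a) < 0 then (1 : ℤ) else 0) =
        (if x a < 0 then 1 else 0) + if a = i then (if x a < 0 then -1 else 1) else 0 := by
      intro a
      have := (hx a).1
      split_ifs <;> omega
    rw [e]
    simp only [invNum, h1, h2, Finset.sum_add_distrib, desc_last h]
    simp [add_assoc]

theorem invNum_rho : invNum (rho n) = 0 := by
  unfold invNum
  rw [Finset.sum_eq_zero, Finset.sum_eq_zero, add_zero]
  · intro j _
    have := rho_pos j
    rw [if_neg (by omega)]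
  · intro j _
    refine Finset.sum_eq_zero fun k _ => ?_
    have h1 := rho_pos j
    have h2 := rho_pos k
    split_ifs with h
    · have h3 : rho n k ≤ rho n j := by
        simp only [rho]
        rw [Fin.lt_def] at h
        omega
      rw [invPair, if_neg (by omega), if_neg (by omega), add_zero]
    · rfl

theorem invNum_nonneg (x : Fin n → ℤ) : 0 ≤ invNum x := by
  unfold invNum invPair
  refine add_nonneg (Finset.sum_nonneg fun j _ => Finset.sum_nonneg fun k _ => ?_)
    (Finset.sum_nonneg fun j _ => ?_) <;> split_ifs <;> norm_num

/-- Without descents $w\rho$ is strictly decreasing and positive. Positivity makes all signs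
trivial, and a monotone permutation of a finite chain is the identity. -/
theorem eq_one_of_not_desc (w : W0 n) (h : ∀ i, ¬ Desc i (vact w (rho n))) : w = 1 := by
  obtain _ | m := n
  · exact SemidirectProduct.ext (funext fun k => k.elim0) (Equiv.ext fun k => k.elim0)
  set x := vact w (rho (m + 1)) with hx
  have hr := regVec_vact_rho w
  have hanti : StrictAnti x := by
    refine Fin.strictAnti_iff_succ_lt.2 fun i => ?_
    have h1 := h i.castSucc
    have hi : (i.castSucc : Fin (m + 1)).val + 1 < m + 1 := by
      have := i.isLt
      simp only [Fin.val_castSucc]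
      omega
    rw [desc_mid hi] at h1
    have h2 := ((hr i.castSucc).2 i.succ (Fin.castSucc_lt_succ).ne).1
    have h3 : (⟨(i.castSucc : Fin (m + 1)).val + 1, hi⟩ : Fin (m + 1)) = i.succ := Fin.ext rfl
    rw [h3] at h1
    exact lt_of_le_of_ne (not_lt.1 h1) h2.symm
  have hpos : ∀ k, 0 < x k := by
    have hl : 0 < x (Fin.last m) := by
      have h1 := h (Fin.last m)
      rw [desc_last (by simp)] at h1
      exact lt_of_le_of_ne (not_lt.1 h1) (hr (Fin.last m)).1.symm
    exact fun k => hl.trans_le (hanti.antitone (Fin.le_last k))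
  have hε : w.left = 1 := by
    funext k
    rcases Int.units_eq_one_or (w.left k) with h | h
    · exact h
    · have h1 := hpos k
      have h2 := rho_pos (w.right⁻¹ k)
      simp only [hx, vact, h, Units.val_neg, Units.val_one] at h1
      omega
  have hσ : StrictMono (w.right⁻¹ : Equiv.Perm (Fin (m + 1))) := by
    intro a b hab
    have h1 := hanti hab
    simp only [hx, vact, hε, Pi.one_apply, Units.val_one, one_mul, rho] at h1
    rw [Fin.lt_def]
    omega
  have hσ' : (w.right⁻¹ : Equiv.Perm (Fin (m + 1))) = 1 := by
    let e : Fin (m + 1) ≃o Fin (m + 1) :=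
      hσ.orderIsoOfSurjective _ (w.right⁻¹).surjective
    have he : e = OrderIso.refl _ := Subsingleton.elim _ _
    ext k
    exact congrArg Fin.val (DFunLike.congr_fun he k)
  exact SemidirectProduct.ext hε (inv_eq_one.1 hσ')

/-- The vector $\rho$ has trivial stabiliser. Identities in $W_0$ can therefore be checked on the
coordinates of this one vector. -/
theorem vact_rho_injective {w v : W0 n} (h : vact w (rho n) = vact v (rho n)) : w = v := by
  have h1 : vact (v⁻¹ * w) (rho n) = rho n := by
    rw [vact_mul, h, ← vact_mul, inv_mul_cancel, vact_one]
  refine (inv_mul_eq_one.1 (eq_one_of_not_desc _ fun i => ?_)).symm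
  rw [h1]
  by_cases hi : i.val + 1 < n
  · rw [desc_mid hi]
    simp only [rho]
    omega
  · rw [desc_last hi]
    have := rho_pos i
    omega

theorem word_nil : word ([] : List (Fin n)) = 1 := rfl

theorem word_cons (i : Fin n) (l : List (Fin n)) : word (i :: l) = simple i * word l := by
  simp [word]

theorem word_append (l l' : List (Fin n)) : word (l ++ l') = word l * word l' := by
  simp [word]

open Classical in
theorem invNum_mul (i : Fin n) (w : W0 n) :
    invNum (vact (simple i * w) (rho n)) =
      invNum (vact w (rho n)) + if Desc i (vact w (rho n)) then -1 else 1 := by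
  rw [vact_mul, invNum_simple i _ (regVec_vact_rho w)]

theorem invNum_word_le (l : List (Fin n)) : invNum (vact (word l) (rho n)) ≤ l.length := by
  induction l with
  | nil => simp [word_nil, vact_one, invNum_rho]
  | cons i l ih =>
    rw [word_cons, invNum_mul]
    push_cast [List.length_cons]
    split_ifs <;> omega

/-- Stripping a descent from the left lowers the inversion number by exactly one, and a nontrivial
element always has a descent. -/
theorem exists_word (k : ℕ) : ∀ w : W0 n, invNum (vact w (rho n)) = k →
    ∃ l : List (Fin n), word l = w ∧ l.length = k := by
  induction k with
  | zero =>
    intro w hw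
    refine ⟨[], (eq_one_of_not_desc w fun i hi => ?_).symm, rfl⟩
    have h1 := invNum_mul i w
    rw [if_pos hi, hw] at h1
    have := invNum_nonneg (vact (simple i * w) (rho n))
    simp only [Nat.cast_zero] at h1
    omega
  | succ k ih =>
    intro w hw
    obtain ⟨i, hi⟩ : ∃ i, Desc i (vact w (rho n)) := by
      by_contra hcon
      push Not at hcon
      rw [eq_one_of_not_desc w hcon, vact_one, invNum_rho] at hw
      push_cast at hw
      omega
    obtain ⟨l, hl, hlen⟩ := ih (simple i * w) (by
      rw [invNum_mul, if_pos hi, hw]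
      push_cast
      ring)
    exact ⟨i :: l, by rw [word_cons, hl, ← mul_assoc, simple_mul_self, one_mul], by
      rw [List.length_cons, hlen]⟩

/-- A letter changes the inversion number by at most one, which bounds the length below; the greedy
word of `exists_word` attains the bound. Every later question about lengths becomes one about
inequalities between coordinates of $w\rho$. -/
theorem len_eq_invNum (w : W0 n) : (len w : ℤ) = invNum (vact w (rho n)) := by
  obtain ⟨k, hk⟩ := Int.eq_ofNat_of_zero_le (invNum_nonneg (vact w (rho n)))
  obtain ⟨l, hl, hlen⟩ := exists_word k w hk
  have h1 : len w ≤ k := Nat.sInf_le ⟨l, hlen, hl⟩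
  obtain ⟨l', hl', hw⟩ : len w ∈ {r | ∃ l : List (Fin n), l.length = r ∧ word l = w} :=
    Nat.sInf_mem ⟨k, l, hlen, hl⟩
  have h2 := invNum_word_le l'
  rw [hw, hl', hk] at h2
  omega

open Classical in
theorem len_simple_mul (i : Fin n) (w : W0 n) :
    (len (simple i * w) : ℤ) = len w + if Desc i (vact w (rho n)) then -1 else 1 := by
  rw [len_eq_invNum, len_eq_invNum, invNum_mul]

theorem len_desc {i : Fin n} {w : W0 n} (h : Desc i (vact w (rho n))) :
    len w = len (simple i * w) + 1 := by
  have := len_simple_mul i w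
  rw [if_pos h] at this
  omega

theorem len_not_desc {i : Fin n} {w : W0 n} (h : ¬ Desc i (vact w (rho n))) :
    len (simple i * w) = len w + 1 := by
  have := len_simple_mul i w
  rw [if_neg h] at this
  omega

theorem desc_iff {i : Fin n} {w : W0 n} :
    Desc i (vact w (rho n)) ↔ len (simple i * w) < len w := by
  refine ⟨fun h => ?_, fun h => ?_⟩
  · have := len_desc h
    omega
  · by_contra hc
    rw [len_not_desc hc] at h
    omega

theorem len_left_or (i : Fin n) (w : W0 n) :
    len (simple i * w) = len w + 1 ∨ len w = len (simple i * w) + 1 := by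
  by_cases h : Desc i (vact w (rho n))
  · exact Or.inr (len_desc h)
  · exact Or.inl (len_not_desc h)

theorem simple_inv (i : Fin n) : (simple i)⁻¹ = simple i :=
  inv_eq_of_mul_eq_one_left (simple_mul_self i)

theorem exists_reduced (w : W0 n) : ∃ l : List (Fin n), word l = w ∧ l.length = len w := by
  obtain ⟨l, hl⟩ := exists_word (len w) w (len_eq_invNum w).symm
  exact ⟨l, hl⟩

theorem word_reverse (l : List (Fin n)) : word l.reverse = (word l)⁻¹ := by
  induction l with
  | nil => simp [word_nil]
  | cons i l ih => rw [List.reverse_cons, word_append, ih, word_cons, word_cons, word_nil, mul_one,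
      mul_inv_rev, simple_inv]

theorem len_word_le (l : List (Fin n)) : len (word l) ≤ l.length := Nat.sInf_le ⟨l, rfl, rfl⟩

theorem len_inv (w : W0 n) : len w⁻¹ = len w := by
  have key : ∀ w : W0 n, len w⁻¹ ≤ len w := fun w => by
    obtain ⟨l, rfl, hl⟩ := exists_reduced w
    rw [← word_reverse, ← hl, ← List.length_reverse]
    exact len_word_le _
  refine le_antisymm (key w) ?_
  simpa using key w⁻¹

theorem len_one : len (1 : W0 n) = 0 := Nat.le_zero.1 (len_word_le [])

theorem eq_one_of_len {w : W0 n} (h : len w = 0) : w = 1 := by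
  obtain ⟨l, rfl, hl⟩ := exists_reduced w
  rw [h, List.length_eq_zero_iff] at hl
  rw [hl, word_nil]

theorem len_mul_simple (w : W0 n) (i : Fin n) : len (w * simple i) = len (simple i * w⁻¹) := by
  rw [← len_inv, mul_inv_rev, simple_inv]

theorem len_right_or (w : W0 n) (i : Fin n) :
    len (w * simple i) = len w + 1 ∨ len w = len (w * simple i) + 1 := by
  rw [len_mul_simple, ← len_inv w]
  exact len_left_or i w⁻¹

theorem len_simple (i : Fin n) : len (simple i) = 1 := by
  rcases len_left_or i 1 with h | h
  · rwa [mul_one, len_one] at h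
  · rw [len_one] at h
    omega

/-- The folding condition for `W₀`. -/
theorem folding {d : W0 n} {i j : Fin n} (h1 : len (simple j * d) = len d + 1)
    (h2 : len (simple j * (d * simple i)) < len (d * simple i)) :
    simple j * d = d * simple i := by
  have hd : ¬ Desc j (vact d (rho n)) := fun h => by
    have := len_desc h
    omega
  have hd' := desc_iff.2 h2
  have hr := regVec_vact_rho d
  rw [vact_mul] at hd'
  refine vact_rho_injective ?_
  rw [vact_mul, vact_mul]
  funext k
  by_cases hi : i.val + 1 < n
  · have hv : ∀ k, vact d (vact (simple i) (rho n)) k =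
        ((d.left k : ℤˣ) : ℤ) * rho n (Equiv.swap i ⟨i.val + 1, hi⟩ (d.right⁻¹ k)) := fun k => by
      conv_lhs => rw [vact]
      rw [vact_simple_mid i hi]
    by_cases hj : j.val + 1 < n
    · rw [desc_mid hj] at hd hd'
      rw [vact_simple_mid j hj, hv]
      rw [hv, hv] at hd'
      simp only [vact] at hd ⊢
      generalize hj' : (⟨j.val + 1, hj⟩ : Fin n) = j' at *
      generalize hi' : (⟨i.val + 1, hi⟩ : Fin n) = i' at *
      have hiv : i'.val = i.val + 1 := by rw [← hi']
      have hjv : j'.val = j.val + 1 := by rw [← hj']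
      have hjj : j ≠ j' := fun h => by rw [h] at hjv; omega
      obtain ⟨p, hp⟩ : ∃ p, p = d.right⁻¹ j := ⟨_, rfl⟩
      obtain ⟨q, hq⟩ : ∃ q, q = d.right⁻¹ j' := ⟨_, rfl⟩
      have hpq : p.val ≠ q.val := fun h => hjj (d.right⁻¹.injective (by
        rw [← hp, ← hq]; exact Fin.ext h))
      rw [← hp, ← hq] at hd hd'
      -- Exchanging the neighbouring entries of $\rho$ at $i$ and $i+1$ can reverse the comparison
      -- of the entries at $j$ and $j+1$ only if these two are the exchanged entries and carry equal
      -- signs.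
      have key : d.left j = d.left j' ∧ ((p = i ∧ q = i') ∨ (p = i' ∧ q = i)) := by
        have e : ∀ x : Fin n, rho n x = n - x.val := fun x => rfl
        have hp0 := p.isLt
        have hq0 := q.isLt
        have hi0 := i'.isLt
        have hs : ∀ x : Fin n, (Equiv.swap i i' x).val = if x.val = i.val then i'.val else
            if x.val = i'.val then i.val else x.val := by
          intro x
          rw [Equiv.swap_apply_def]
          simp only [Fin.ext_iff]
          split_ifs <;> rfl
        simp only [e, hs] at hd hd'
        simp only [Fin.ext_iff]
        rcases Int.units_eq_one_or (d.left j) with a | a <;>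
          rcases Int.units_eq_one_or (d.left j') with b | b <;>
          simp only [a, b, Units.val_one, Units.val_neg] at hd hd' ⊢
        · refine ⟨trivial, ?_⟩
          split_ifs at hd' <;> omega
        · split_ifs at hd' <;> omega
        · split_ifs at hd' <;> omega
        · refine ⟨trivial, ?_⟩
          split_ifs at hd' <;> omega
      obtain ⟨hε, hc⟩ := key
      by_cases hkj : k = j
      · subst hkj
        rw [Equiv.swap_apply_left, ← hp, ← hq, hε]
        rcases hc with ⟨rfl, rfl⟩ | ⟨rfl, rfl⟩ <;> simp
      by_cases hkj' : k = j'
      · subst hkj'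
        rw [Equiv.swap_apply_right, ← hp, ← hq, hε]
        rcases hc with ⟨rfl, rfl⟩ | ⟨rfl, rfl⟩ <;> simp
      rw [Equiv.swap_apply_of_ne_of_ne hkj hkj']
      have hkp : d.right⁻¹ k ≠ p := fun h => hkj (d.right⁻¹.injective (h.trans hp))
      have hkq : d.right⁻¹ k ≠ q := fun h => hkj' (d.right⁻¹.injective (h.trans hq))
      rcases hc with ⟨rfl, rfl⟩ | ⟨rfl, rfl⟩
      · rw [Equiv.swap_apply_of_ne_of_ne hkp hkq]
      · rw [Equiv.swap_apply_of_ne_of_ne hkq hkp]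
    -- Here $s_i$ permutes the positive entries of $\rho$, so the sign of the last entry of $d\rho$
    -- cannot change.
    · exfalso
      rw [desc_last hj] at hd hd'
      rw [hv] at hd'
      simp only [vact] at hd
      have a1 := rho_pos (d.right⁻¹ j)
      have a2 := rho_pos (Equiv.swap i ⟨i.val + 1, hi⟩ (d.right⁻¹ j))
      rcases Int.units_eq_one_or (d.left j) with a | a <;>
        simp only [a, Units.val_one, Units.val_neg] at hd hd' <;> omega
  · have hv : ∀ k, vact d (vact (simple i) (rho n)) k = ((d.left k : ℤˣ) : ℤ) *
        (if d.right⁻¹ k = i then - rho n (d.right⁻¹ k) else rho n (d.right⁻¹ k)) := fun k => by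
      conv_lhs => rw [vact]
      rw [vact_simple_last i hi]
    have e : ∀ x : Fin n, rho n x = n - x.val := fun x => rfl
    by_cases hj : j.val + 1 < n
    -- Here $s_i$ negates the entry of $\rho$ equal to $1$, the one of least absolute value. This
    -- cannot reverse the comparison of two entries of different absolute value.
    · exfalso
      rw [desc_mid hj] at hd hd'
      rw [hv, hv] at hd'
      simp only [vact] at hd
      generalize hj' : (⟨j.val + 1, hj⟩ : Fin n) = j' at *
      have hjv : j'.val = j.val + 1 := by rw [← hj']
      have hjj : j ≠ j' := fun h => by rw [h] at hjv; omega
      obtain ⟨p, hp⟩ : ∃ p, p = d.right⁻¹ j := ⟨_, rfl⟩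
      obtain ⟨q, hq⟩ : ∃ q, q = d.right⁻¹ j' := ⟨_, rfl⟩
      have hpq : p.val ≠ q.val := fun h => hjj (d.right⁻¹.injective (by
        rw [← hp, ← hq]; exact Fin.ext h))
      rw [← hp, ← hq] at hd hd'
      have hp0 := p.isLt
      have hq0 := q.isLt
      have hi0 := i.isLt
      simp only [Fin.ext_iff] at hd'
      rcases Int.units_eq_one_or (d.left j) with a | a <;>
        rcases Int.units_eq_one_or (d.left j') with b | b <;>
        simp only [a, b, Units.val_one, Units.val_neg, e] at hd hd' <;>
        split_ifs at hd' <;> omega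
    · rw [desc_last hj] at hd hd'
      rw [hv] at hd'
      rw [hv, vact_simple_last j hj]
      have a1 := rho_pos (d.right⁻¹ j)
      have key : d.right⁻¹ j = i := by
        simp only [vact] at hd
        rcases Int.units_eq_one_or (d.left j) with a | a <;>
          simp only [a, Units.val_one, Units.val_neg] at hd hd' <;> split_ifs at hd' with hc <;>
          first | exact hc | omega
      have hk : (d.right⁻¹ k = i) ↔ k = j := by
        rw [← key]
        exact d.right⁻¹.injective.eq_iff
      simp only [hk, vact]
      split_ifs <;> ring

end Length

/-! ### Matsumoto's theorem for `W₀` -/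

section Matsumoto

variable {n : ℕ}

/-- The braid relations of type `B_n`. -/
structure BraidFamily {M : Type*} [Monoid M] (x : Fin n → M) : Prop where
  comm : ∀ i j : Fin n, i.val + 1 < j.val → x i * x j = x j * x i
  mid : ∀ i j : Fin n, j.val = i.val + 1 → j.val + 1 < n → x i * x j * x i = x j * x i * x j
  last : ∀ i j : Fin n, j.val = i.val + 1 → ¬ j.val + 1 < n →
    x i * x j * x i * x j = x j * x i * x j * x i

theorem vact_mid_left (i : Fin n) (h : i.val + 1 < n) (x : Fin n → ℤ) :
    vact (simple i) x i = x ⟨i.val + 1, h⟩ := by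
  rw [vact_simple_mid i h, Equiv.swap_apply_left]

theorem vact_mid_right (i j : Fin n) (h : j.val = i.val + 1) (x : Fin n → ℤ) :
    vact (simple i) x j = x i := by
  have h' : i.val + 1 < n := h ▸ j.isLt
  obtain rfl : j = ⟨i.val + 1, h'⟩ := Fin.ext h
  rw [vact_simple_mid i h', Equiv.swap_apply_right]

theorem vact_simple_of_ne (i k : Fin n) (h : k ≠ i) (h' : k.val ≠ i.val + 1) (x : Fin n → ℤ) :
    vact (simple i) x k = x k := by
  by_cases hi : i.val + 1 < n
  · rw [vact_simple_mid i hi, Equiv.swap_apply_of_ne_of_ne h fun h => h' (by rw [h])]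
  · rw [vact_simple_last i hi, if_neg h]

theorem vact_mid_left' (i j : Fin n) (h : j.val = i.val + 1) (x : Fin n → ℤ) :
    vact (simple i) x i = x j := by
  have h' : i.val + 1 < n := h ▸ j.isLt
  obtain rfl : j = ⟨i.val + 1, h'⟩ := Fin.ext h
  exact vact_mid_left i h' x

theorem vact_last_self (i : Fin n) (h : ¬ i.val + 1 < n) (x : Fin n → ℤ) :
    vact (simple i) x i = - x i := by
  rw [vact_simple_last i h, if_pos rfl]

theorem swap_succ_val (i : Fin n) (hi : i.val + 1 < n) (x : Fin n) :
    (Equiv.swap i ⟨i.val + 1, hi⟩ x).val =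
      if x.val = i.val then i.val + 1 else if x.val = i.val + 1 then i.val else x.val := by
  rw [Equiv.swap_apply_def]
  simp only [Fin.ext_iff]
  split_ifs <;> rfl

/-- Each relation is compared coordinate by coordinate on $\rho$, using `vact_rho_injective`. -/
theorem braidFamily_simple : BraidFamily (simple (n := n)) where
  comm := by
    intro i j h
    refine vact_rho_injective ?_
    simp only [vact_mul]
    funext k
    have hi : i.val + 1 < n := by omega
    by_cases hj : j.val + 1 < n
    · rw [vact_simple_mid i hi, vact_simple_mid j hj, vact_simple_mid j hj, vact_simple_mid i hi]
      congr 1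
      refine Fin.ext ?_
      simp only [swap_succ_val]
      split_ifs <;> omega
    · rw [vact_simple_mid i hi, vact_simple_last j hj, vact_simple_last j hj,
        vact_simple_mid i hi]
      have : Equiv.swap i ⟨i.val + 1, hi⟩ k = j ↔ k = j := by
        rw [Fin.ext_iff, Fin.ext_iff, swap_succ_val]
        split_ifs <;> omega
      simp only [this]
  mid := by
    intro i j h hj
    refine vact_rho_injective ?_
    simp only [vact_mul]
    funext k
    obtain ⟨m, hm⟩ : ∃ m : Fin n, m.val = j.val + 1 := ⟨⟨j.val + 1, hj⟩, rfl⟩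
    have hij : i ≠ j := fun e => by rw [e] at h; omega
    have hmi : m ≠ i := fun e => by rw [e] at hm; omega
    have a1 := vact_mid_left' i j h
    have a2 := vact_mid_right i j h
    have a3 := vact_mid_left' j m hm
    have a4 := vact_mid_right j m hm
    have a5 := vact_simple_of_ne j i hij (by omega)
    have a6 := vact_simple_of_ne i m hmi (by omega)
    by_cases hki : k = i
    · simp only [hki, a1, a3, a5, a6]
    by_cases hkj : k = j
    · simp only [hkj, a1, a2, a3, a4, a5, a6]
    by_cases hkm : k = m
    · simp only [hkm, a2, a4, a5, a6]
    rw [Fin.ext_iff] at hkj hkm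
    have a7 := vact_simple_of_ne i k hki (by omega)
    have a8 := vact_simple_of_ne j k (fun e => hkj (congrArg Fin.val e)) (by omega)
    simp only [a7, a8]
  last := by
    intro i j h hj
    refine vact_rho_injective ?_
    simp only [vact_mul]
    funext k
    by_cases hki : k = i
    · subst hki
      have hne : k ≠ j := fun e => by rw [e] at h; omega
      simp only [vact_mid_left' k j h, vact_last_self j hj, vact_mid_right k j h,
        vact_simple_of_ne j k hne (by omega)]
    by_cases hkj : k = j
    · subst hkj
      have hne : i ≠ k := fun e => by rw [e] at h; omega
      simp only [vact_mid_left' i k h, vact_last_self k hj, vact_mid_right i k h,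
        vact_simple_of_ne k i hne (by omega)]
    have hk := k.isLt
    have hki' : k.val ≠ i.val + 1 := fun e => hkj (Fin.ext (by omega))
    simp only [vact_simple_of_ne i k hki hki', vact_simple_of_ne j k hkj (by omega)]

variable {M : Type*} [Monoid M] {x : Fin n → M}

theorem desc_mid' {i j : Fin n} (h : j.val = i.val + 1) (y : Fin n → ℤ) :
    Desc i y ↔ y i < y j := by
  have h' : i.val + 1 < n := h ▸ j.isLt
  obtain rfl : j = ⟨i.val + 1, h'⟩ := Fin.ext h
  exact desc_mid h' y

/-- If a reduced word may start with either $i$ or $j$, then $w$ begins with the longest element of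
$\langle s_i,s_j\rangle$. With a reduced word $c$ for the rest, induction rewrites both tails so
that the two words become the two sides of a braid relation followed by $c$. The cases are
$m_{ij}=3$, $4$ and $2$. -/
theorem matsumoto_step (hx : BraidFamily x) {k : ℕ}
    (ih : ∀ l l' : List (Fin n), word l = word l' → l.length = k → l'.length = k →
      len (word l) = k → (l.map x).prod = (l'.map x).prod) {i j : Fin n} (hij : i.val < j.val)
    {a b : List (Fin n)} (hw : word (i :: a) = word (j :: b)) (ha : a.length = k)
    (hb : b.length = k) (hl : len (word (i :: a)) = k + 1) :
    x i * (a.map x).prod = x j * (b.map x).prod := by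
  have hwa : word a = simple i * word (i :: a) := by
    rw [word_cons, ← mul_assoc, simple_mul_self, one_mul]
  have hwb : word b = simple j * word (i :: a) := by
    rw [hw, word_cons, ← mul_assoc, simple_mul_self, one_mul]
  generalize word (i :: a) = w at hw hl hwa hwb
  have hla : len (word a) = k := by
    rcases len_left_or i w with h | h
    · have := len_word_le a
      rw [hwa] at this
      omega
    · rw [hwa]
      omega
  have hlb : len (word b) = k := by
    rcases len_left_or j w with h | h
    · have := len_word_le b
      rw [hwb] at this
      omega
    · rw [hwb]
      omega
  have hdi : Desc i (vact w (rho n)) := desc_iff.2 (by rw [← hwa]; omega)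
  have hdj : Desc j (vact w (rho n)) := desc_iff.2 (by rw [← hwb]; omega)
  have hr := regVec_vact_rho w
  have cancel : ∀ (i : Fin n) (v : W0 n), simple i * (simple i * v) = v := fun i v => by
    rw [← mul_assoc, simple_mul_self, one_mul]
  by_cases hadj : j.val = i.val + 1
  · by_cases hj : j.val + 1 < n
    · set m : Fin n := ⟨j.val + 1, hj⟩ with hm
      have hne : m ≠ i := fun e => by
        have := congrArg Fin.val e
        simp only [hm] at this
        omega
      have hne' : i ≠ j := fun e => by rw [e] at hadj; omega
      have hmj : m.val = j.val + 1 := rfl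
      rw [desc_mid' hadj] at hdi
      rw [desc_mid' hmj] at hdj
      obtain ⟨c, hc, hcl⟩ := exists_reduced (simple j * (simple i * (simple j * w)))
      have hbr : simple i * (simple j * (simple i * w)) =
          simple j * (simple i * (simple j * w)) := by
        have := braidFamily_simple.mid i j hadj hj
        simp only [← mul_assoc, this]
      -- The alternating letters stripped from $w$ remain descents; this fixes the length of `c` and
      -- makes the new words reduced.
      have e1 : Desc i (vact (simple j * w) (rho n)) := by
        rw [vact_mul, desc_mid' hadj, vact_mid_left' j m hmj,
          vact_simple_of_ne j i hne' (by omega)]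
        exact hdi.trans hdj
      have e2 : Desc j (vact (simple i * (simple j * w)) (rho n)) := by
        rw [vact_mul, vact_mul, desc_mid' hmj, vact_mid_right i j hadj,
          vact_simple_of_ne i m hne (by omega), vact_simple_of_ne j i hne' (by omega),
          vact_mid_right j m hmj]
        exact hdi
      have l0 : len (simple j * w) = k := hwb ▸ hlb
      have l1 := len_desc e1
      have l2 := len_desc e2
      have hck : c.length + 2 = k := by omega
      have h1 : (a.map x).prod = x j * (x i * (c.map x).prod) := by
        have := ih a (j :: i :: c) (by
          rw [word_cons, word_cons, hc, ← hbr, cancel, cancel, hwa]) ha (by simp; omega) hla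
        simpa using this
      have h2 : (b.map x).prod = x i * (x j * (c.map x).prod) := by
        have := ih b (i :: j :: c) (by
          rw [word_cons, word_cons, hc, cancel, cancel, hwb]) hb (by simp; omega) hlb
        simpa using this
      rw [h1, h2]
      simp only [← mul_assoc, hx.mid i j hadj hj]
    · have hne' : i ≠ j := fun e => by rw [e] at hadj; omega
      rw [desc_mid' hadj] at hdi
      rw [desc_last hj] at hdj
      obtain ⟨c, hc, hcl⟩ := exists_reduced (simple i * (simple j * (simple i * (simple j * w))))
      have hbr : simple i * (simple j * (simple i * (simple j * w))) =
          simple j * (simple i * (simple j * (simple i * w))) := by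
        have := braidFamily_simple.last i j hadj hj
        simp only [← mul_assoc, this]
      have e1 : Desc i (vact (simple j * w) (rho n)) := by
        rw [vact_mul, desc_mid' hadj, vact_last_self j hj,
          vact_simple_of_ne j i hne' (by omega)]
        omega
      have e2 : Desc j (vact (simple i * (simple j * w)) (rho n)) := by
        rw [vact_mul, vact_mul, desc_last hj, vact_mid_right i j hadj,
          vact_simple_of_ne j i hne' (by omega)]
        omega
      have e3 : Desc i (vact (simple j * (simple i * (simple j * w))) (rho n)) := by
        rw [vact_mul, vact_mul, vact_mul, desc_mid' hadj, vact_simple_of_ne j i hne' (by omega),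
          vact_mid_left' i j hadj, vact_last_self j hj, vact_last_self j hj,
          vact_mid_right i j hadj, vact_simple_of_ne j i hne' (by omega)]
        omega
      have l0 : len (simple j * w) = k := hwb ▸ hlb
      have l1 := len_desc e1
      have l2 := len_desc e2
      have l3 := len_desc e3
      have hck : c.length + 3 = k := by omega
      have h1 : (a.map x).prod = x j * (x i * (x j * (c.map x).prod)) := by
        have := ih a (j :: i :: j :: c) (by
          rw [word_cons, word_cons, word_cons, hc, hbr, cancel, cancel, cancel]
          rw [hwa]) ha (by simp; omega) hla
        simpa using this
      have h2 : (b.map x).prod = x i * (x j * (x i * (c.map x).prod)) := by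
        have := ih b (i :: j :: i :: c) (by
          rw [word_cons, word_cons, word_cons, hc, cancel, cancel, cancel, hwb]) hb
          (by simp; omega) hlb
        simpa using this
      rw [h1, h2]
      simp only [← mul_assoc, hx.last i j hadj hj]
  · have hlt : i.val + 1 < j.val := by omega
    have hi : i.val + 1 < n := by omega
    set i' : Fin n := ⟨i.val + 1, hi⟩ with hi'
    have hii : i'.val = i.val + 1 := rfl
    obtain ⟨c, hc, hcl⟩ := exists_reduced (simple i * (simple j * w))
    have hbr : simple i * (simple j * w) = simple j * (simple i * w) := by
      have := braidFamily_simple.comm i j hlt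
      simp only [← mul_assoc, this]
    have e1 : Desc i (vact (simple j * w) (rho n)) := by
      rw [desc_mid' hii] at hdi ⊢
      rw [vact_mul, vact_simple_of_ne j i (fun e => by rw [e] at hlt; omega) (by omega),
        vact_simple_of_ne j i' (fun e => by rw [← e] at hlt; omega) (by omega)]
      exact hdi
    have l0 : len (simple j * w) = k := hwb ▸ hlb
    have l1 := len_desc e1
    have hck : c.length + 1 = k := by omega
    have h1 : (a.map x).prod = x j * (c.map x).prod := by
      have := ih a (j :: c) (by rw [word_cons, hc, hbr, cancel, hwa]) ha (by simp; omega) hla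
      simpa using this
    have h2 : (b.map x).prod = x i * (c.map x).prod := by
      have := ih b (i :: c) (by rw [word_cons, hc, cancel, hwb]) hb (by simp; omega) hlb
      simpa using this
    rw [h1, h2, ← mul_assoc, hx.comm i j hlt, mul_assoc]

/-- Equal first letters cancel, and distinct ones are handled by `matsumoto_step`. -/
theorem matsumoto (hx : BraidFamily x) (k : ℕ) : ∀ l l' : List (Fin n), word l = word l' →
    l.length = k → l'.length = k → len (word l) = k → (l.map x).prod = (l'.map x).prod := by
  induction k with
  | zero =>
    intro l l' _ hl hl' _
    rw [List.length_eq_zero_iff] at hl hl'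
    rw [hl, hl']
  | succ k ih =>
    intro l l' h hl hl' hlen
    obtain ⟨i, a, rfl⟩ := List.exists_cons_of_length_eq_add_one hl
    obtain ⟨j, b, rfl⟩ := List.exists_cons_of_length_eq_add_one hl'
    rw [List.length_cons, Nat.add_right_cancel_iff] at hl hl'
    rw [List.map_cons, List.map_cons, List.prod_cons, List.prod_cons]
    rcases lt_trichotomy i j with hij | rfl | hij
    · exact matsumoto_step hx ih hij h hl hl' hlen
    · rw [word_cons, word_cons] at h
      have hab := mul_left_cancel h
      rw [ih a b hab hl hl' ?_]
      have h1 := len_word_le a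
      rw [word_cons] at hlen
      rcases len_left_or i (word a) with h2 | h2 <;> omega
    · exact (matsumoto_step hx ih hij h.symm hl' hl (h ▸ hlen)).symm

variable (x) in
/-- The product of the family `x` over a reduced expression of `w`. -/
def braidProd (w : W0 n) : M := ((reducedWord w).map x).prod

theorem reducedWord_spec (w : W0 n) :
    word (reducedWord w) = w ∧ (reducedWord w).length = len w :=
  Classical.epsilon_spec (exists_reduced w)

/-- This removes the dependence on the arbitrary choice made in `reducedWord`; it is how products
such as `heckeTW` become computable. -/
theorem braidProd_word (hx : BraidFamily x) {l : List (Fin n)} (h : l.length = len (word l)) :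
    braidProd x (word l) = (l.map x).prod := by
  have h1 := reducedWord_spec (word l)
  exact matsumoto hx (len (word l)) _ _ h1.1 h1.2 h (by rw [h1.1])

theorem braidProd_one (hx : BraidFamily x) : braidProd x 1 = 1 := by
  have := braidProd_word hx (l := []) (by rw [word_nil, len_one]; rfl)
  simpa [word_nil] using this

theorem braidProd_mul (hx : BraidFamily x) {w v : W0 n} (h : len (w * v) = len w + len v) :
    braidProd x (w * v) = braidProd x w * braidProd x v := by
  obtain ⟨l, rfl, hl⟩ := exists_reduced w
  obtain ⟨l', rfl, hl'⟩ := exists_reduced v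
  rw [braidProd_word hx hl, braidProd_word hx hl', ← word_append, braidProd_word hx]
  · simp
  · rw [word_append, h, List.length_append, hl, hl']

theorem braidProd_simple (hx : BraidFamily x) (i : Fin n) : braidProd x (simple i) = x i := by
  have e : word [i] = simple i := by simp [word_cons, word_nil]
  have := braidProd_word hx (l := [i]) (by rw [e, len_simple]; rfl)
  simpa [e] using this

theorem braidProd_simple_mul (hx : BraidFamily x) {i : Fin n} {w : W0 n}
    (h : len (simple i * w) = len w + 1) :
    braidProd x (simple i * w) = x i * braidProd x w := by
  rw [braidProd_mul hx (by rw [h, len_simple, add_comm]), braidProd_simple hx]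

theorem braidProd_mul_simple (hx : BraidFamily x) {i : Fin n} {w : W0 n}
    (h : len (w * simple i) = len w + 1) :
    braidProd x (w * simple i) = braidProd x w * x i := by
  rw [braidProd_mul hx (by rw [h, len_simple]), braidProd_simple hx]

end Matsumoto

/-! ### Parabolic subgroups -/

section Parabolic

variable {n : ℕ} {I : Set (Fin n)}

theorem simple_mem_parabolic {i : Fin n} (hi : i ∈ I) : simple i ∈ parabolic I :=
  Subgroup.subset_closure ⟨i, hi, rfl⟩

theorem parabolic_induction {P : W0 n → Prop} (one : P 1)
    (mul : ∀ v ∈ parabolic I, ∀ i ∈ I, P v → P (v * simple i)) {v : W0 n}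
    (hv : v ∈ parabolic I) : P v := by
  refine Subgroup.closure_induction_right (p := fun v _ => P v) one ?_ ?_ hv
  · rintro v hv _ ⟨i, hi, rfl⟩ h
    exact mul v hv i hi h
  · rintro v hv _ ⟨i, hi, rfl⟩ h
    rw [simple_inv]
    exact mul v hv i hi h

theorem simple_mem_parabolic_iff {i : Fin n} : simple i ∈ parabolic I ↔ i ∈ I := by
  refine ⟨fun h => ?_, simple_mem_parabolic⟩
  by_contra hi
  -- A multiple of the fundamental weight of $s_i$: every other simple reflection fixes it, while
  -- $s_i$ does not.
  let ω : Fin n → ℤ := fun k => if k ≤ i then 1 else 0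
  have key : ∀ v ∈ parabolic I, vact v ω = ω := by
    intro v hv
    refine parabolic_induction (P := fun v => vact v ω = ω) (vact_one _) ?_ hv
    intro v _ j hj h
    have hji : j ≠ i := fun e => hi (e ▸ hj)
    have hji' : j.val ≠ i.val := fun e => hji (Fin.ext e)
    have : vact (simple j) ω = ω := by
      funext k
      by_cases hj' : j.val + 1 < n
      · rw [vact_simple_mid j hj']
        simp only [ω, Equiv.swap_apply_def, Fin.ext_iff]
        split_ifs with h1 h2 h3 h4 h5 h6 h7 <;> simp only [Fin.le_def] at * <;> omega
      · rw [vact_simple_last j hj']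
        have := i.isLt
        split_ifs with hk
        · subst hk
          simp only [ω]
          rw [if_neg (by rw [Fin.le_def]; omega), neg_zero]
        · rfl
    rw [vact_mul, this, h]
  have h1 := congrFun (key _ h) i
  by_cases hi' : i.val + 1 < n
  · rw [vact_mid_left i hi'] at h1
    simp only [ω] at h1
    rw [if_neg (by rw [Fin.le_def]; simp), if_pos le_rfl] at h1
    exact zero_ne_one h1
  · rw [vact_last_self i hi'] at h1
    simp [ω] at h1

/-- Right ascents along `I` give additivity of the length on `W_{0,I}`. -/
theorem len_mul_of_ascents (k : ℕ) : ∀ d : W0 n, len d = k →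
    (∀ i ∈ I, len (d * simple i) = len d + 1) →
    ∀ v ∈ parabolic I, len (d * v) = len d + len v := by
  induction k with
  | zero =>
    intro d hd _ v _
    rw [eq_one_of_len hd, one_mul, len_one, zero_add]
  | succ k ih =>
    intro d hd hasc
    obtain ⟨j, hj⟩ : ∃ j, len d = len (simple j * d) + 1 := by
      by_contra hcon
      push Not at hcon
      obtain rfl : d = 1 := eq_one_of_not_desc d fun i hi => hcon i (len_desc hi)
      rw [len_one] at hd
      omega
    have hasc' : ∀ i ∈ I, len (simple j * d * simple i) = len (simple j * d) + 1 := by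
      intro i hi
      rcases len_right_or (simple j * d) i with h | h
      · exact h
      · have h1 := hasc i hi
        have h2 := len_left_or j (d * simple i)
        rw [mul_assoc] at h
        omega
    have ih' := ih (simple j * d) (by omega) hasc'
    have hsd : simple j * (simple j * d) = d := by rw [← mul_assoc, simple_mul_self, one_mul]
    generalize simple j * d = d' at *
    suffices h : ∀ v ∈ parabolic I, len (d * v) = len (d' * v) + 1 by
      intro v hv
      rw [h v hv, ih' v hv, hj]
      ring
    intro v hv
    refine parabolic_induction (P := fun v => len (d * v) = len (d' * v) + 1) (by simpa using hj)
      ?_ hv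
    intro v hv i hi h
    rw [← hsd, mul_assoc] at h ⊢
    rcases len_left_or j (d' * (v * simple i)) with h1 | h1
    · exact h1
    -- If $s_j$ shortened $d'vs_i$, then `folding` would give $s_jd'v=d'vs_i$, hence $d=d'r$ with
    -- $r=vs_iv^{-1}\in W_{0,I}$. Additivity for $d'$ forces $r$ to have length one, so $r=s_b$ with
    -- $b\in I$. Then $ds_b=d'$ is shorter than $d$, against the ascent at $b$.
    · exfalso
      have h2 := folding h (i := i) (by rw [mul_assoc]; omega)
      have h3 : d' * (v * simple i * v⁻¹) = d := by
        rw [← mul_assoc, ← mul_assoc, ← h2, ← mul_assoc, mul_inv_cancel_right, hsd]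
      have h4 : v * simple i * v⁻¹ ∈ parabolic I :=
        mul_mem (mul_mem hv (simple_mem_parabolic hi)) (inv_mem hv)
      have h5 := ih' _ h4
      rw [h3, hj] at h5
      generalize v * simple i * v⁻¹ = r at *
      obtain ⟨l, hl, hlen⟩ := exists_reduced r
      obtain ⟨b, rfl⟩ := List.length_eq_one_iff.1 (show l.length = 1 by omega)
      have hrb : r = simple b := by rw [← hl]; simp [word_cons, word_nil]
      rw [hrb] at h4
      have h6 := hasc b (simple_mem_parabolic_iff.1 h4)
      rw [← h3, hrb, mul_assoc, simple_mul_self, mul_one] at h6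
      rw [← hrb, h3] at h6
      omega

theorem mem_minReps_iff {d : W0 n} :
    d ∈ minReps I ↔ ∀ i ∈ I, len (d * simple i) = len d + 1 := by
  refine ⟨fun h i hi => ?_, fun h => len_mul_of_ascents _ d rfl h⟩
  rw [h _ (simple_mem_parabolic hi), len_simple]

/-- An element of least length in the coset $wW_{0,I}$ has only right ascents along $I$. -/
theorem exists_minReps_mul (w : W0 n) : ∃ d ∈ minReps I, ∃ v ∈ parabolic I, w = d * v := by
  let S : Set ℕ := {k | ∃ v ∈ parabolic I, len (w * v) = k}
  have hS : S.Nonempty := ⟨len w, 1, one_mem _, by rw [mul_one]⟩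
  obtain ⟨v, hv, hk⟩ := Nat.sInf_mem hS
  refine ⟨w * v, mem_minReps_iff.2 fun i hi => ?_, v⁻¹, inv_mem hv, by group⟩
  rcases len_right_or (w * v) i with h | h
  · exact h
  · have : sInf S ≤ len (w * v * simple i) :=
      Nat.sInf_le ⟨v * simple i, mul_mem hv (simple_mem_parabolic hi), by rw [mul_assoc]⟩
    omega

/-- By additivity in both directions, the quotient has length zero. -/
theorem minReps_unique {d d' : W0 n} (hd : d ∈ minReps I) (hd' : d' ∈ minReps I)
    (h : d⁻¹ * d' ∈ parabolic I) : d = d' := by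
  have h1 := hd _ h
  have h2 := hd' _ ((parabolic I).inv_mem h)
  rw [mul_inv_cancel_left] at h1
  rw [mul_inv_rev, inv_inv, mul_inv_cancel_left] at h2
  exact inv_mul_eq_one.1 (eq_one_of_len (by omega))

/-- Deodhar's lemma. -/
theorem deodhar {d : W0 n} (hd : d ∈ minReps I) (j : Fin n) :
    simple j * d ∈ minReps I ∨
      (len (simple j * d) = len d + 1 ∧ ∃ i ∈ I, simple j * d = d * simple i) := by
  by_cases h : simple j * d ∈ minReps I
  · exact Or.inl h
  refine Or.inr ?_
  rw [mem_minReps_iff] at h hd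
  push Not at h
  obtain ⟨i, hi, hne⟩ := h
  -- The failed ascent of $s_jd$ at $i$, together with the ascent of $d$ at $i$, leaves only one
  -- pattern of lengths, which is the hypothesis of `folding`.
  have h1 := (len_right_or (simple j * d) i).resolve_left hne
  have h2 := hd i hi
  have h3 := len_left_or j (d * simple i)
  have h4 := len_left_or j d
  rw [mul_assoc] at h1
  have h5 : len (simple j * d) = len d + 1 := by omega
  exact ⟨h5, i, hi, folding h5 (by omega)⟩

/-! ### The longest elements -/

/-- The element `-1` of `W₀`. -/
def negOne (n : ℕ) : W0 n := SemidirectProduct.inl fun _ => -1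

theorem vact_negOne (x : Fin n → ℤ) : vact (negOne n) x = -x := by
  funext k
  simp [vact, negOne]

theorem negOne_mul_self : negOne n * negOne n = 1 := by
  refine vact_rho_injective ?_
  rw [vact_mul, vact_negOne, vact_negOne, neg_neg, vact_one]

theorem negOne_comm (w : W0 n) : negOne n * w = w * negOne n := by
  refine vact_rho_injective ?_
  rw [vact_mul, vact_mul, vact_negOne, vact_negOne]
  funext k
  simp [vact]

theorem desc_neg {i : Fin n} {x : Fin n → ℤ} (hx : RegVec x) : Desc i (-x) ↔ ¬ Desc i x := by
  by_cases h : i.val + 1 < n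
  · rw [desc_mid h, desc_mid h]
    have := ((hx i).2 ⟨i.val + 1, h⟩ fun e => by
      have := congrArg Fin.val e
      simp at this).1
    simp only [Pi.neg_apply]
    omega
  · rw [desc_last h, desc_last h]
    have := (hx i).1
    simp only [Pi.neg_apply]
    omega

/-- Negating a regular vector exchanges descents and ascents, so each letter of a word for $w$ moves
the two lengths in opposite directions. -/
theorem len_negOne_mul (w : W0 n) : len (negOne n * w) + len w = len (negOne n) := by
  obtain ⟨l, rfl⟩ : ∃ l, word l = w := (exists_reduced w).imp fun _ h => h.1
  induction l with
  | nil => rw [word_nil, mul_one, len_one, add_zero]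
  | cons i l ih =>
    rw [word_cons]
    have e : negOne n * (simple i * word l) = simple i * (negOne n * word l) := by
      rw [← mul_assoc, negOne_comm, mul_assoc]
    have h2 : Desc i (vact (negOne n * word l) (rho n)) ↔ ¬ Desc i (vact (word l) (rho n)) := by
      rw [vact_mul, vact_negOne, desc_neg (regVec_vact_rho _)]
    rw [e]
    by_cases h : Desc i (vact (word l) (rho n))
    · have a1 := len_desc h
      have a2 := len_not_desc fun h' => h2.1 h' h
      omega
    · have a1 := len_not_desc h
      have a2 := len_desc (h2.2 h)
      omega

theorem len_negOne_mul' (w : W0 n) : len (w * negOne n) + len w = len (negOne n) := by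
  rw [← negOne_comm, len_negOne_mul]

theorem longest_spec (I : Set (Fin n)) :
    longest I ∈ parabolic I ∧ ∀ v ∈ parabolic I, len v ≤ len (longest I) := by
  refine Classical.epsilon_spec (p := fun w => w ∈ parabolic I ∧ ∀ v ∈ parabolic I, len v ≤ len w)
    ?_
  obtain ⟨w, hw, hmax⟩ := Set.exists_max_image (parabolic I : Set (W0 n)) len (Set.toFinite _)
    ⟨1, one_mem _⟩
  exact ⟨w, hw, hmax⟩

theorem parabolic_univ (w : W0 n) : w ∈ parabolic (Set.univ : Set (Fin n)) := by
  obtain ⟨l, rfl⟩ : ∃ l, word l = w := (exists_reduced w).imp fun _ h => h.1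
  induction l with
  | nil => exact one_mem _
  | cons i l ih => exact mul_mem (simple_mem_parabolic trivial) ih

/-- By `len_negOne_mul`, the length of $-1$ bounds all lengths, with equality only at $-1$ itself.
The centrality of this element is what makes $w_0^I$ tractable. -/
theorem longest_univ : longest (Set.univ : Set (Fin n)) = negOne n := by
  have h1 := (longest_spec (Set.univ : Set (Fin n))).2 _ (parabolic_univ (negOne n))
  have h2 := len_negOne_mul (longest (Set.univ : Set (Fin n)))
  have h3 := eq_one_of_len (show len (negOne n * longest (Set.univ : Set (Fin n))) = 0 by omega)
  rw [← mul_right_inj (negOne n), h3, negOne_mul_self]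

theorem w0I_eq (I : Set (Fin n)) : w0I I = negOne n * (longest I)⁻¹ := by
  rw [w0I, longest_univ]

/-- Right descents along `I` give subtractivity of the length on `W_{0,I}`. -/
theorem len_mul_of_descents {d : W0 n} (h : ∀ i ∈ I, len d = len (d * simple i) + 1)
    {v : W0 n} (hv : v ∈ parabolic I) : len (d * v) + len v = len d := by
  have h1 : negOne n * d ∈ minReps I := mem_minReps_iff.2 fun i hi => by
    have a1 := h i hi
    have a2 := len_negOne_mul d
    have a3 := len_negOne_mul (d * simple i)
    rw [mul_assoc]
    omega
  have a1 := h1 v hv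
  have a2 := len_negOne_mul d
  have a3 := len_negOne_mul (d * v)
  rw [mul_assoc] at a1
  omega

theorem longest_descent {i : Fin n} (hi : i ∈ I) :
    len (longest I) = len (longest I * simple i) + 1 := by
  have h := (longest_spec I).2 _ (mul_mem (longest_spec I).1 (simple_mem_parabolic hi))
  rcases len_right_or (longest I) i with h1 | h1 <;> omega

theorem len_longest_mul {v : W0 n} (hv : v ∈ parabolic I) :
    len (longest I * v) + len v = len (longest I) :=
  len_mul_of_descents (fun _ hi => longest_descent hi) hv

theorem longest_unique {v : W0 n} (hv : v ∈ parabolic I) (h : len v = len (longest I)) :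
    v = longest I := by
  have h1 := len_longest_mul (mul_mem (inv_mem (longest_spec I).1) hv)
  rw [mul_inv_cancel_left] at h1
  exact (inv_mul_eq_one.1 (eq_one_of_len (by omega))).symm

theorem longest_inv (I : Set (Fin n)) : (longest I)⁻¹ = longest I :=
  longest_unique (inv_mem (longest_spec I).1) (len_inv _)

theorem longest_mul_self (I : Set (Fin n)) : longest I * longest I = 1 := by
  nth_rw 1 [← longest_inv]
  exact inv_mul_cancel _

theorem len_mul_longest {v : W0 n} (hv : v ∈ parabolic I) :
    len (v * longest I) + len v = len (longest I) := by
  rw [← len_inv (v * longest I), mul_inv_rev, longest_inv, ← len_inv v]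
  exact len_longest_mul (inv_mem hv)

/-- The element $w_{0,I}s_i$ is one step below the top. Some $s_j$ with $j\in I$ lifts it back on
the left, and by uniqueness the lift is $w_{0,I}$. -/
theorem longest_conj {i : Fin n} (hi : i ∈ I) :
    ∃ j ∈ I, longest I * simple i = simple j * longest I := by
  have hd : longest I * simple i ∈ parabolic I :=
    mul_mem (longest_spec I).1 (simple_mem_parabolic hi)
  obtain ⟨j, hj, hlen⟩ : ∃ j ∈ I, len (simple j * (longest I * simple i)) =
      len (longest I * simple i) + 1 := by
    -- If every $s_j$ with $j\in I$ shortened it, multiplying its inverse by $w_{0,I}$ would remove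
    -- more length than it has.
    by_contra hcon
    push Not at hcon
    have h1 : ∀ j ∈ I, len ((longest I * simple i)⁻¹) =
        len ((longest I * simple i)⁻¹ * simple j) + 1 := fun j hj => by
      rw [len_mul_simple, inv_inv, len_inv]
      exact (len_left_or j (longest I * simple i)).resolve_left (hcon j hj)
    have h2 := len_mul_of_descents h1 (longest_spec I).1
    rw [len_inv] at h2
    have h3 := longest_descent hi
    omega
  refine ⟨j, hj, ?_⟩
  have h1 := longest_unique (mul_mem (simple_mem_parabolic hj) hd) (by
    rw [hlen, ← longest_descent hi])
  rw [← mul_right_inj (simple j), h1, ← mul_assoc, simple_mul_self, one_mul]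

theorem w0I_eq' (I : Set (Fin n)) : w0I I = negOne n * longest I := by
  rw [w0I_eq, longest_inv]

theorem w0I_inv (I : Set (Fin n)) : (w0I I)⁻¹ = longest I * negOne n := by
  rw [w0I_eq, mul_inv_rev, inv_inv]
  rw [inv_eq_of_mul_eq_one_left negOne_mul_self]

theorem w0I_conj {i : Fin n} (hi : i ∈ I) :
    ∃ j ∈ I, w0I I * simple i = simple j * w0I I := by
  obtain ⟨j, hj, h⟩ := longest_conj hi
  exact ⟨j, hj, by rw [w0I_eq', mul_assoc, h, ← mul_assoc, negOne_comm, mul_assoc]⟩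

theorem simple_injective : Function.Injective (simple (n := n)) := by
  intro i j h
  have h1 : simple i ∈ parabolic ({j} : Set (Fin n)) := h ▸ simple_mem_parabolic rfl
  simpa using simple_mem_parabolic_iff.1 h1

theorem w0I_conj_inv {j : Fin n} (hj : j ∈ I) :
    ∃ i ∈ I, w0I I * simple i = simple j * w0I I := by
  obtain ⟨i, hi, h⟩ := longest_conj hj
  refine ⟨i, hi, ?_⟩
  have h1 : longest I * simple i = simple j * longest I := by
    have := congrArg (fun x => longest I * x * longest I) h
    simp only [← mul_assoc, longest_mul_self, one_mul] at this
    rw [this, mul_assoc, longest_mul_self, mul_one]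
  rw [w0I_eq', mul_assoc, h1, ← mul_assoc, negOne_comm, mul_assoc]

/-- Since $-1$ is central, conjugation by $w_0^I$ restricts to conjugation by $w_{0,I}$ on
$W_{0,I}$, which permutes the simple reflections of $W_{0,I}$. -/
theorem starSet_eq (I : Set (Fin n)) : starSet I = I := by
  ext j
  refine ⟨?_, fun hj => w0I_conj_inv hj⟩
  rintro ⟨i, hi, h⟩
  obtain ⟨j', hj', h'⟩ := w0I_conj hi
  rw [h] at h'
  rwa [simple_injective (mul_right_cancel h')]

theorem len_w0I (I : Set (Fin n)) : len (w0I I) + len (longest I) = len (negOne n) := by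
  rw [w0I_eq', len_negOne_mul]

/-- Write $dv(w_0^I)^{-1}=(dvw_{0,I})(-1)$; then complement the length and use additivity for $d$.
The case $v=1$ shows that $w_0^I$ is longest in $W_0^I$. -/
theorem len_mul_mul_w0I_inv {d v : W0 n} (hd : d ∈ minReps I) (hv : v ∈ parabolic I) :
    len (d * v * (w0I I)⁻¹) + len d = len (w0I I) + len v := by
  have h1 := len_negOne_mul' (d * v * longest I)
  have h2 := hd (v * longest I) (mul_mem hv (longest_spec I).1)
  have h3 := len_mul_longest hv
  have h4 := len_w0I I
  rw [w0I_inv, ← mul_assoc]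
  rw [← mul_assoc] at h2
  omega

theorem len_mul_w0I_inv {d : W0 n} (hd : d ∈ minReps I) :
    len (d * (w0I I)⁻¹) + len d = len (w0I I) := by
  have := len_mul_mul_w0I_inv hd (one_mem (parabolic I))
  rwa [mul_one, len_one, add_zero] at this

theorem w0I_mem_minReps (I : Set (Fin n)) : w0I I ∈ minReps I := by
  refine mem_minReps_iff.2 fun i hi => ?_
  have h1 := len_negOne_mul (longest I)
  have h2 := len_negOne_mul (longest I * simple i)
  have h3 := longest_descent hi
  rw [w0I_eq', mul_assoc]
  omega

/-- Multiplication by $-w_{0,I}$ reverses descents twice along $I$. As $w_0^I$ is an involution, the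
indices $w(w_0^I)^{-1}$ of the correspondence run through $W_0^I$ again. -/
theorem mul_w0I_mem_minReps {d : W0 n} (hd : d ∈ minReps I) : d * w0I I ∈ minReps I := by
  refine mem_minReps_iff.2 fun i hi => ?_
  have h1 := len_negOne_mul (d * longest I)
  have h2 := len_negOne_mul (d * (longest I * simple i))
  have h3 := longest_descent hi
  have h4 := hd _ (longest_spec I).1
  have h5 := hd _ (mul_mem (longest_spec I).1 (simple_mem_parabolic hi))
  rw [w0I_eq', ← mul_assoc, ← negOne_comm, mul_assoc, mul_assoc, mul_assoc]
  omega

end Parabolic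

/-! ### Palindromic products in type `B_n` -/

section Palindrome

variable {n : ℕ} {M : Type*} [Monoid M] {x E : Fin n → M}

/-- The relations between the elements `E_i = x_i ⋯ x_{n-1} x_n x_{n-1} ⋯ x_i`. -/
structure PalFamily (x E : Fin n → M) : Prop where
  last : ∀ i : Fin n, ¬ i.val + 1 < n → E i = x i
  step : ∀ i j : Fin n, j.val = i.val + 1 → E i = x i * E j * x i

theorem fin_downward_induction {P : Fin n → Prop}
    (last : ∀ i : Fin n, ¬ i.val + 1 < n → P i)
    (step : ∀ i j : Fin n, j.val = i.val + 1 → P j → P i) (i : Fin n) : P i := by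
  obtain ⟨r, hr⟩ : ∃ r, r = n - i.val := ⟨_, rfl⟩
  induction r generalizing i with
  | zero =>
    have := i.isLt
    omega
  | succ r ih =>
    by_cases h : i.val + 1 < n
    · exact step i ⟨i.val + 1, h⟩ rfl (ih _ (by simp only; omega))
    · exact last i h

theorem fin_upward_induction [NeZero n] {P : Fin n → Prop} (zero : P 0)
    (step : ∀ i j : Fin n, j.val = i.val + 1 → P i → P j) (i : Fin n) : P i := by
  obtain ⟨r, hr⟩ : ∃ r, r = i.val := ⟨_, rfl⟩
  induction r generalizing i with
  | zero =>
    have : i = 0 := Fin.ext (by rw [Fin.val_zero]; omega)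
    rwa [this]
  | succ r ih => exact step ⟨r, by omega⟩ i (by simp only; omega) (ih _ rfl)

theorem PalFamily.commute_of_commute (hE : PalFamily x E) (a : M) (k : Fin n) :
    (∀ i, k ≤ i → Commute a (x i)) → Commute a (E k) := by
  refine fin_downward_induction (P := fun k => (∀ i, k ≤ i → Commute a (x i)) → Commute a (E k))
    ?_ ?_ k
  · intro k hk h
    rw [hE.last k hk]
    exact h k le_rfl
  · intro i j hij ih h
    rw [hE.step i j hij]
    have hj := ih fun k hk => h k (by rw [Fin.le_def] at hk ⊢; omega)
    exact ((h i le_rfl).mul_right hj).mul_right (h i le_rfl)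

/-- In $W_0$ the palindrome $E_k$ is the sign change of coordinate $k$, which commutes with the
reflections in later coordinates. In a braid monoid the only delicate case is $i=k+1$. There the
three-term relation moves $x_i$ through both ends of $E_k$, or the four-term relation applies at the
end of the diagram. -/
theorem PalFamily.commute (hx : BraidFamily x) (hE : PalFamily x E) (k : Fin n) :
    ∀ i, k < i → Commute (x i) (E k) := by
  refine fin_downward_induction (P := fun k => ∀ i, k < i → Commute (x i) (E k)) ?_ ?_ k
  · intro k hk i hi
    have := i.isLt
    rw [Fin.lt_def] at hi
    omega
  · intro k j hj ih i hi
    rw [Fin.lt_def] at hi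
    by_cases hij : i = j
    · subst hij
      rw [hE.step k i hj]
      by_cases hin : i.val + 1 < n
      · set m : Fin n := ⟨i.val + 1, hin⟩ with hm
        have hmi : m.val = i.val + 1 := rfl
        rw [hE.step i m hmi]
        have h1 : Commute (x k) (E m) := hE.commute_of_commute _ _ fun a ha => by
          rw [Fin.le_def] at ha
          exact hx.comm k a (by omega)
        have b := hx.mid k i hj hin
        change x i * (x k * (x i * E m * x i) * x k) = x k * (x i * E m * x i) * x k * x i
        calc x i * (x k * (x i * E m * x i) * x k)
            = (x i * x k * x i) * (E m * x i * x k) := by simp only [mul_assoc]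
          _ = x k * x i * (x k * E m) * x i * x k := by rw [← b]; simp only [mul_assoc]
          _ = x k * x i * E m * (x k * x i * x k) := by rw [h1.eq]; simp only [mul_assoc]
          _ = x k * (x i * E m * x i) * x k * x i := by rw [b]; simp only [mul_assoc]
      · rw [hE.last i hin]
        change x i * (x k * x i * x k) = x k * x i * x k * x i
        rw [hx.last k i hj hin]
        simp only [mul_assoc]
    · have hij' : i.val ≠ j.val := fun e => hij (Fin.ext e)
      rw [hE.step k j hj]
      have h1 : Commute (x i) (x k) := (hx.comm k i (by omega)).symm
      exact (h1.mul_right (ih i (by rw [Fin.lt_def]; omega))).mul_right h1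

theorem PalFamily.commute_pal (hx : BraidFamily x) (hE : PalFamily x E) {k l : Fin n}
    (h : k < l) : Commute (E k) (E l) :=
  hE.commute_of_commute _ _ fun i hi => (hE.commute hx k i (h.trans_le hi)).symm

end Palindrome

/-! ### Commutation and conjugation of the $Y$-elements in a group. -/

section YFamily

variable {n : ℕ} [NeZero n] {G : Type*} [Group G] {x y E : Fin n → G}

/-- The relations `y_i = x_i y_{i+1} x_i` and `x_i y_1 = y_1 x_i` for `i > 1`. -/
structure YFamily (x y : Fin n → G) : Prop where
  step : ∀ i j : Fin n, j.val = i.val + 1 → y i = x i * y j * x i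
  zero : ∀ i : Fin n, i ≠ 0 → Commute (x i) (y 0)

theorem YFamily.eq_right (hy : YFamily x y) {i j : Fin n} (h : j.val = i.val + 1) :
    y j = (x i)⁻¹ * y i * (x i)⁻¹ := by
  rw [hy.step i j h]
  group

theorem YFamily.commute_lt (hx : BraidFamily x) (hy : YFamily x y) (j : Fin n) :
    ∀ i, j < i → Commute (x i) (y j) := by
  refine fin_upward_induction (P := fun j => ∀ i, j < i → Commute (x i) (y j)) ?_ ?_ j
  · intro i hi
    exact hy.zero i hi.ne'
  · intro k j hkj ih i hi
    rw [hy.eq_right hkj]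
    rw [Fin.lt_def] at hi
    have h1 : Commute (x i) (x k)⁻¹ := Commute.inv_right (hx.comm k i (by omega)).symm
    exact (h1.mul_right (ih i (by rw [Fin.lt_def]; omega))).mul_right h1

/-- For $j<i$ this is `YFamily.commute_lt`. For $j=i+2$, the braid relation carries $x_i$ through
the conjugating factors as $x_{i+1}$, which commutes with $y_i$. Larger $j$ follow because the added
factors commute with $x_i$. -/
theorem YFamily.commute (hx : BraidFamily x) (hy : YFamily x y) {i j : Fin n} (h : i ≠ j)
    (h' : j.val ≠ i.val + 1) : Commute (x i) (y j) := by
  have hne : i.val ≠ j.val := fun e => h (Fin.ext e)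
  rcases Nat.lt_or_ge j.val i.val with hl | hl
  · exact hy.commute_lt hx j i hl
  obtain ⟨r, hr⟩ : ∃ r, j.val = i.val + 2 + r := ⟨j.val - (i.val + 2), by omega⟩
  clear h h' hne hl
  induction r generalizing j with
  | zero =>
    have hjn := j.isLt
    have hi1 : i.val + 1 < n := by omega
    set k : Fin n := ⟨i.val + 1, hi1⟩ with hk
    have hik : k.val = i.val + 1 := rfl
    have hkj : j.val = k.val + 1 := by omega
    have b := hx.mid i k hik (by omega)
    have hc := (hy.commute_lt hx i k (by rw [Fin.lt_def]; omega)).eq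
    rw [hy.eq_right hkj, hy.eq_right hik]
    change _ * _ = _ * _
    have e1 : x i * (x k)⁻¹ * (x i)⁻¹ = (x k)⁻¹ * (x i)⁻¹ * x k := by
      rw [mul_inv_eq_iff_eq_mul, mul_assoc, mul_assoc, eq_inv_mul_iff_mul_eq,
        eq_inv_mul_iff_mul_eq, ← mul_assoc, ← mul_assoc, mul_inv_eq_iff_eq_mul, b]
    have e2 : x k * (x i)⁻¹ * (x k)⁻¹ = (x i)⁻¹ * (x k)⁻¹ * x i := by
      rw [mul_inv_eq_iff_eq_mul, mul_assoc, mul_assoc, eq_inv_mul_iff_mul_eq,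
        eq_inv_mul_iff_mul_eq, ← mul_assoc, ← mul_assoc, mul_inv_eq_iff_eq_mul, b]
    calc x i * ((x k)⁻¹ * ((x i)⁻¹ * y i * (x i)⁻¹) * (x k)⁻¹)
        = (x i * (x k)⁻¹ * (x i)⁻¹) * y i * (x i)⁻¹ * (x k)⁻¹ := by simp only [mul_assoc]
      _ = (x k)⁻¹ * (x i)⁻¹ * (x k * y i) * (x i)⁻¹ * (x k)⁻¹ := by
        rw [e1]; simp only [mul_assoc]
      _ = (x k)⁻¹ * (x i)⁻¹ * y i * (x k * (x i)⁻¹ * (x k)⁻¹) := by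
        rw [hc]; simp only [mul_assoc]
      _ = _ := by rw [e2]; simp only [mul_assoc]
  | succ r ih =>
    have hjn := j.isLt
    set k : Fin n := ⟨i.val + 2 + r, by omega⟩ with hk
    have hkj : j.val = k.val + 1 := by rw [hr, hk]; ring
    have h1 := ih (j := k) rfl
    rw [hy.eq_right hkj]
    have h2 : Commute (x i) (x k)⁻¹ := Commute.inv_right (hx.comm i k (by simp only [hk]; omega))
    exact (h2.mul_right h1).mul_right h2

/-- All elements $y_iE_i^{-1}$ are conjugate. In the Hecke algebra the first is $T_0$ and the last
is $Y_nT_n^{-1}$, so the quadratic relation of $T_0$ can be read at the other end of the diagram. -/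
theorem YFamily.conj (hE : PalFamily x E) (hy : YFamily x y) (i j : Fin n)
    (h : j.val = i.val + 1) : y i * (E i)⁻¹ = x i * (y j * (E j)⁻¹) * (x i)⁻¹ := by
  rw [hy.step i j h, hE.step i j h]
  group

end YFamily

/-! ### Quadratic relations for units -/

section Quadratic

variable {B : Type*} [Ring B] [Algebra ℂ B]

/-- The relation `z - z⁻¹ = k - k⁻¹`. -/
def QuadRel (k : ℂ) (z : Bˣ) : Prop := (z : B) = ((z⁻¹ : Bˣ) : B) + (k - k⁻¹) • 1

theorem QuadRel.conj {k : ℂ} {z : Bˣ} (h : QuadRel k z) (a : Bˣ) : QuadRel k (a * z * a⁻¹) := by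
  unfold QuadRel at *
  rw [mul_inv_rev, mul_inv_rev, inv_inv, Units.val_mul, Units.val_mul, h]
  simp only [Units.val_mul, mul_add, add_mul, mul_smul_comm, smul_mul_assoc, mul_one,
    Units.mul_inv, mul_assoc]

theorem QuadRel.conj_iff {k : ℂ} {z : Bˣ} (a : Bˣ) : QuadRel k (a * z * a⁻¹) ↔ QuadRel k z := by
  refine ⟨fun h => ?_, fun h => h.conj a⟩
  have := h.conj a⁻¹
  have e : a⁻¹ * (a * z * a⁻¹) * a⁻¹⁻¹ = z := by group
  rwa [e] at this

theorem QuadRel.mul_self {k : ℂ} {z : Bˣ} (h : QuadRel k z) :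
    (z : B) * z = (k - k⁻¹) • (z : B) + 1 := by
  conv_lhs => enter [1]; rw [h]
  rw [add_mul, Units.inv_mul, smul_mul_assoc, one_mul, add_comm]

theorem QuadRel.inv_eq {k : ℂ} {z : Bˣ} (h : QuadRel k z) :
    ((z⁻¹ : Bˣ) : B) = z - (k - k⁻¹) • 1 := by
  rw [h, add_sub_cancel_right]

theorem quadRel_of_mul_self {k : ℂ} {z : Bˣ} (h : (z : B) * z = (k - k⁻¹) • (z : B) + 1) :
    QuadRel k z := by
  unfold QuadRel
  have := congrArg (fun a => a * ((z⁻¹ : Bˣ) : B)) h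
  simp only [add_mul, smul_mul_assoc, Units.mul_inv, one_mul, Units.mul_inv_cancel_right] at this
  rw [this, add_comm]

theorem QuadRel.quadratic {k : ℂ} (hk : k ≠ 0) {z : Bˣ} (h : QuadRel k z) :
    ((z : B) - algebraMap ℂ B k) * ((z : B) + algebraMap ℂ B k⁻¹) = 0 :=
  quadratic_aux hk h.mul_self

/-- Substituting $a=zbz$ leaves a factor $z^2$ to reduce. With $z=T_i$, the pair $(a,b)$ will be
$(Y_i,Y_{i+1})$ or $(Y_{i+1}^{-1},Y_i^{-1})$; this and its companion are the Bernstein–Lusztig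
relations. -/
theorem bernstein_fst {k : ℂ} {z a b : Bˣ} (h : QuadRel k z) (hab : a = z * b * z) :
    (a : B) * z = z * b + (k - k⁻¹) • (a : B) := by
  rw [hab, Units.val_mul, Units.val_mul, mul_assoc, h.mul_self, mul_add, mul_one, mul_smul_comm,
    add_comm]

theorem bernstein_snd {k : ℂ} {z a b : Bˣ} (h : QuadRel k z) (hab : a = z * b * z) :
    (b : B) * z = z * a - (k - k⁻¹) • (a : B) := by
  have hb : b * z = z⁻¹ * a := by rw [hab]; group
  rw [← Units.val_mul, hb, Units.val_mul, h.inv_eq, sub_mul, smul_mul_assoc, one_mul]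

/-- The relation is the quadratic relation of $az^{-1}$ with inverses expanded. With $z=T_n$ and
$a=Y_n$, the element $az^{-1}$ is a conjugate of $T_0$, which is where $\kappa_0$ enters. -/
theorem bernstein_last {k k0 : ℂ} {z a : Bˣ} (h : QuadRel k z) (h0 : QuadRel k0 (a * z⁻¹)) :
    (a : B) * z = z * ((a⁻¹ : Bˣ) : B) + (k - k⁻¹) • (a : B) + (k0 - k0⁻¹) • 1 := by
  unfold QuadRel at h0
  rw [mul_inv_rev, inv_inv, Units.val_mul, Units.val_mul, h.inv_eq, mul_sub, mul_smul_comm,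
    mul_one, sub_eq_iff_eq_add] at h0
  rw [h0]
  abel

theorem bernstein_last_inv {k k0 : ℂ} {z a : Bˣ} (h : QuadRel k z) (h0 : QuadRel k0 (a * z⁻¹)) :
    ((a⁻¹ : Bˣ) : B) * z = z * a - ((k - k⁻¹) • (a : B) + (k0 - k0⁻¹) • 1) := by
  have e : a⁻¹ * z = z⁻¹ * (a * z⁻¹)⁻¹ * z := by group
  rw [← Units.val_mul, e, Units.val_mul, Units.val_mul, h0.inv_eq, mul_sub, sub_mul,
    mul_smul_comm, smul_mul_assoc, mul_one, Units.inv_mul, ← Units.val_mul, ← Units.val_mul]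
  have e' : z⁻¹ * (a * z⁻¹) * z = z⁻¹ * a := by group
  rw [e', Units.val_mul, h.inv_eq, sub_mul, smul_mul_assoc, one_mul, sub_sub]

end Quadratic

/-! ### The elements `Y_i` -/

section HeckeY

variable {n : ℕ} (κ : Kappa)

theorem heckeTinv_mul_heckeT (j : Fin (n + 1)) : heckeTinv κ j * heckeT κ j = 1 := by
  rw [← heckeT_mul_heckeTinv κ j, heckeTinv, add_mul, sub_mul, mul_add, mul_sub,
    Algebra.commutes, Algebra.commutes]

/-- The generator `T_j` as a unit. -/
def heckeUnit (j : Fin (n + 1)) : (Hecke n κ)ˣ :=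
  ⟨heckeT κ j, heckeTinv κ j, heckeT_mul_heckeTinv κ j, heckeTinv_mul_heckeT κ j⟩

theorem quadRel_heckeUnit (j : Fin (n + 1)) : QuadRel (κ.at j : ℂ) (heckeUnit κ j) := by
  change heckeT κ j = heckeTinv κ j + _
  rw [heckeTinv, ← Algebra.algebraMap_eq_smul_one, map_sub]
  abel

theorem heckeT_rel {x y : FreeAlgebra ℂ (Fin (n + 1))} (h : HeckeRel n κ x y) :
    RingQuot.mkAlgHom ℂ (HeckeRel n κ) x = RingQuot.mkAlgHom ℂ (HeckeRel n κ) y :=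
  RingQuot.mkAlgHom_rel ℂ h

theorem heckeUnit_commute (i j : Fin (n + 1)) (h : i.val + 1 < j.val) :
    Commute (heckeUnit κ i) (heckeUnit κ j) := by
  have := heckeT_rel κ (HeckeRel.commute i j h)
  rw [map_mul, map_mul] at this
  exact Units.ext this

theorem heckeUnit_braid_left (i j : Fin (n + 1)) (h0 : i.val = 0) (h : j.val = 1) (hn : j.val < n) :
    heckeUnit κ i * heckeUnit κ j * heckeUnit κ i * heckeUnit κ j =
      heckeUnit κ j * heckeUnit κ i * heckeUnit κ j * heckeUnit κ i := by
  have := heckeT_rel κ (HeckeRel.braid_left i j h0 h hn)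
  simp only [map_mul] at this
  exact Units.ext this

theorem braidFamily_heckeUnit : BraidFamily fun i : Fin n => heckeUnit κ i.succ where
  comm i j h := heckeUnit_commute κ _ _ (by simp only [Fin.val_succ]; omega)
  mid i j h hj := by
    have := heckeT_rel κ (HeckeRel.braid_mid i.succ j.succ (by simp) (by simp [h])
      (by simpa using hj))
    simp only [map_mul] at this
    exact Units.ext this
  last i j h hj := by
    have := heckeT_rel κ (HeckeRel.braid_right i.succ j.succ (by simp) (by simp [h]) (by
      have := j.isLt
      simp only [Fin.val_succ]
      omega))
    simp only [map_mul] at this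
    exact Units.ext this

/-- A strictly increasing list is determined by its members; the products defining $Y_i$ are split
by means of this. -/
theorem finRange_filter_eq {p : Fin (n + 1) → Bool} {l : List (Fin (n + 1))}
    (hl : l.Pairwise (· < ·)) (h : ∀ a, a ∈ l ↔ p a = true) :
    (List.finRange (n + 1)).filter p = l := by
  refine List.Pairwise.eq_of_mem_iff (r := (· < ·))
    ((List.sortedLT_finRange _).pairwise.filter _) hl fun a => ?_
  rw [h]
  simp

/-- The palindromic product `T_i ⋯ T_{n-1} T_n T_{n-1} ⋯ T_i` in `H(κ)`. -/
def heckeE (i : Fin n) : (Hecke n κ)ˣ :=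
  (((List.finRange (n + 1)).filter fun j => i.val < j.val).map (heckeUnit κ)).prod *
    ((((List.finRange (n + 1)).filter fun j => i.val < j.val ∧ j.val < n).reverse).map
      (heckeUnit κ)).prod

theorem filter_gt_cons (i : Fin n) :
    ((List.finRange (n + 1)).filter fun j => i.val < j.val) =
      i.succ :: (List.finRange (n + 1)).filter fun j => i.val + 1 < j.val := by
  refine finRange_filter_eq ?_ fun a => ?_
  · refine List.pairwise_cons.2 ⟨fun a ha => ?_, (List.sortedLT_finRange _).pairwise.filter _⟩
    rw [List.mem_filter, decide_eq_true_eq] at ha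
    rw [Fin.lt_def, Fin.val_succ]
    exact ha.2
  · simp only [List.mem_cons, List.mem_filter, List.mem_finRange, true_and, decide_eq_true_eq,
      Fin.ext_iff, Fin.val_succ]
    omega

theorem filter_between_cons (i : Fin n) (h : i.val + 1 < n) :
    ((List.finRange (n + 1)).filter fun j => i.val < j.val ∧ j.val < n) =
      i.succ :: (List.finRange (n + 1)).filter fun j => i.val + 1 < j.val ∧ j.val < n := by
  refine finRange_filter_eq ?_ fun a => ?_
  · refine List.pairwise_cons.2 ⟨fun a ha => ?_, (List.sortedLT_finRange _).pairwise.filter _⟩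
    rw [List.mem_filter, decide_eq_true_eq] at ha
    rw [Fin.lt_def, Fin.val_succ]
    exact ha.2.1
  · simp only [List.mem_cons, List.mem_filter, List.mem_finRange, true_and, decide_eq_true_eq,
      Fin.ext_iff, Fin.val_succ]
    omega

theorem filter_le_succ (i : Fin n) :
    ((List.finRange (n + 1)).filter fun j => 0 < j.val ∧ j.val ≤ i.val + 1) =
      ((List.finRange (n + 1)).filter fun j => 0 < j.val ∧ j.val ≤ i.val) ++ [i.succ] := by
  refine finRange_filter_eq ?_ fun a => ?_
  · refine List.pairwise_append.2 ⟨(List.sortedLT_finRange _).pairwise.filter _,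
      List.pairwise_singleton _ _, fun a ha b hb => ?_⟩
    rw [List.mem_filter, decide_eq_true_eq] at ha
    rw [List.mem_singleton] at hb
    rw [hb, Fin.lt_def, Fin.val_succ]
    omega
  · simp only [List.mem_append, List.mem_singleton, List.mem_filter, List.mem_finRange, true_and,
      decide_eq_true_eq, Fin.ext_iff, Fin.val_succ]
    omega

theorem palFamily_heckeE : PalFamily (fun i : Fin n => heckeUnit κ i.succ) (heckeE κ) where
  last i h := by
    have h1 : ((List.finRange (n + 1)).filter fun j => i.val + 1 < j.val) = [] :=
      finRange_filter_eq List.Pairwise.nil fun a => by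
        have := a.isLt
        simp only [List.not_mem_nil, false_iff, decide_eq_true_eq]
        omega
    have h2 : ((List.finRange (n + 1)).filter fun j => i.val < j.val ∧ j.val < n) = [] :=
      finRange_filter_eq List.Pairwise.nil fun a => by
        simp only [List.not_mem_nil, false_iff, decide_eq_true_eq]
        omega
    rw [heckeE, filter_gt_cons, h1, h2]
    simp
  step i j h := by
    have hj := j.isLt
    rw [heckeE, filter_gt_cons, filter_between_cons i (by omega), heckeE, h]
    simp [mul_assoc]

/-- The element `Y_i` as a unit. -/
def heckeYUnit (i : Fin n) : (Hecke n κ)ˣ :=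
  ((((List.finRange (n + 1)).filter fun j => 0 < j.val ∧ j.val ≤ i.val).reverse).map
      fun j => (heckeUnit κ j)⁻¹).prod *
    ((List.finRange (n + 1)).map (heckeUnit κ)).prod *
    ((((List.finRange (n + 1)).filter fun j => i.val < j.val ∧ j.val < n).reverse).map
      (heckeUnit κ)).prod

theorem heckeYUnit_val (i : Fin n) : (heckeYUnit κ i : Hecke n κ) = heckeY κ i := by
  have e : ∀ (f : Fin (n + 1) → (Hecke n κ)ˣ) (l : List (Fin (n + 1))),
      ((l.map f).prod : Hecke n κ) = (l.map fun j => (f j : Hecke n κ)).prod := fun f l => by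
    rw [← Units.coeHom_apply, map_list_prod, List.map_map]
    rfl
  rw [heckeYUnit, heckeY, Units.val_mul, Units.val_mul, e, e, e]
  rfl

variable [NeZero n]

theorem heckeYUnit_zero : heckeYUnit κ (0 : Fin n) = heckeUnit κ 0 * heckeE κ 0 := by
  have h1 : ((List.finRange (n + 1)).filter fun j => 0 < j.val ∧ j.val ≤ (0 : Fin n).val) = [] :=
    finRange_filter_eq List.Pairwise.nil fun a => by
      rw [decide_eq_true_eq, Fin.val_zero]
      simp only [List.not_mem_nil, false_iff]
      omega
  have h2 : ((List.finRange (n + 1)).filter fun j => (0 : Fin n).val < j.val) =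
      (List.finRange n).map Fin.succ := by
    refine finRange_filter_eq ?_ fun a => ?_
    · exact (List.sortedLT_finRange _).pairwise.map _ fun a b h => Fin.succ_lt_succ_iff.2 h
    · rw [decide_eq_true_eq, Fin.val_zero]
      simp only [List.mem_map, List.mem_finRange, true_and]
      rw [Fin.exists_succ_eq, Ne, Fin.ext_iff, Fin.val_zero]
      omega
  rw [heckeYUnit, h1, heckeE, h2, List.finRange_succ]
  simp [mul_assoc]

omit [NeZero n] in
theorem heckeYUnit_step (i j : Fin n) (h : j.val = i.val + 1) :
    heckeYUnit κ i = heckeUnit κ i.succ * heckeYUnit κ j * heckeUnit κ i.succ := by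
  have hj := j.isLt
  rw [heckeYUnit, heckeYUnit, h, filter_le_succ, filter_between_cons i (by omega)]
  simp [mul_assoc]

theorem yFamily_heckeYUnit :
    YFamily (fun i : Fin n => heckeUnit κ i.succ) (heckeYUnit κ) where
  step i j h := heckeYUnit_step κ i j h
  zero i hi := by
    have hi' : i.val ≠ 0 := fun e => hi (Fin.ext e)
    rw [heckeYUnit_zero]
    refine Commute.mul_right ?_ ?_
    · exact (heckeUnit_commute κ 0 i.succ (by simp only [Fin.val_succ, Fin.val_zero]; omega)).symm
    · exact (palFamily_heckeE κ).commute (braidFamily_heckeUnit κ) 0 i (Fin.pos_iff_ne_zero.2 hi)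

theorem quadRel_last {B : Type*} [Ring B] [Algebra ℂ B] {x y E : Fin n → Bˣ}
    (hE : PalFamily x E) (hy : YFamily x y) (k : ℂ) (i : Fin n) :
    QuadRel k (y 0 * (E 0)⁻¹) ↔ QuadRel k (y i * (E i)⁻¹) := by
  refine fin_upward_induction
    (P := fun i => QuadRel k (y 0 * (E 0)⁻¹) ↔ QuadRel k (y i * (E i)⁻¹)) Iff.rfl ?_ i
  intro i j hij h
  rw [h, hy.conj hE i j hij, QuadRel.conj_iff]

theorem quadRel_heckeY_last (i : Fin n) (hi : ¬ i.val + 1 < n) :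
    QuadRel (κ.zero : ℂ) (heckeYUnit κ i * (heckeUnit κ i.succ)⁻¹) := by
  rw [← (palFamily_heckeE κ).last i hi,
    ← quadRel_last (palFamily_heckeE κ) (yFamily_heckeYUnit κ), heckeYUnit_zero,
    mul_inv_cancel_right]
  exact quadRel_heckeUnit κ 0

/-- The elements `Y_i^{±1}`. -/
def heckeYs (p : Fin n × ℤˣ) : Hecke n κ := ((heckeYUnit κ p.1 ^ ((p.2 : ℤˣ) : ℤ) : (Hecke n κ)ˣ))

/-- The action of `W₀` on the index set of the elements `Y_i^{±1}`. -/
def pairAct (w : W0 n) (p : Fin n × ℤˣ) : Fin n × ℤˣ := (w.right⁻¹ p.1, w.left p.1 * p.2)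

omit [NeZero n] in
theorem pairAct_mid (i j : Fin n) (h : j.val = i.val + 1) (p : Fin n × ℤˣ) :
    pairAct (simple i) p = (Equiv.swap i j p.1, p.2) := by
  have h' : i.val + 1 < n := h ▸ j.isLt
  obtain rfl : j = ⟨i.val + 1, h'⟩ := Fin.ext h
  simp [pairAct, simple, h']

omit [NeZero n] in
theorem pairAct_last (i : Fin n) (h : ¬ i.val + 1 < n) (p : Fin n × ℤˣ) :
    pairAct (simple i) p = (p.1, if p.1 = i then -p.2 else p.2) := by
  have e : pairAct (simple i) p = (p.1, (Pi.mulSingle i (-1) : Fin n → ℤˣ) p.1 * p.2) := by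
    rw [pairAct, simple, dif_neg h]
    rfl
  rw [e]
  split_ifs with hp
  · simp [hp]
  · simp [hp]

/-- The Bernstein relations. -/
theorem bernstein (i : Fin n) (p : Fin n × ℤˣ) :
    heckeYs κ p * heckeT κ i.succ - heckeT κ i.succ * heckeYs κ (pairAct (simple i) p) ∈
      Submodule.span ℂ (insert 1 (Set.range (heckeYs κ))) := by
  set S := Submodule.span ℂ (insert (1 : Hecke n κ) (Set.range (heckeYs κ))) with hS
  have h1 : (1 : Hecke n κ) ∈ S := Submodule.subset_span (Set.mem_insert _ _)
  have hYp : ∀ q, heckeYs κ q ∈ S := fun q =>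
    Submodule.subset_span (Set.mem_insert_of_mem _ ⟨q, rfl⟩)
  have ePos : ∀ j : Fin n, heckeYs κ (j, 1) = heckeYUnit κ j := fun j => by simp [heckeYs]
  have eNeg : ∀ j : Fin n, heckeYs κ (j, -1) = ((heckeYUnit κ j)⁻¹ : (Hecke n κ)ˣ) := fun j => by
    simp [heckeYs]
  have hq := quadRel_heckeUnit κ i.succ
  have hY := yFamily_heckeYUnit (n := n) κ
  have hx := braidFamily_heckeUnit (n := n) κ
  have hcomm : ∀ k : Fin n, i ≠ k → k.val ≠ i.val + 1 → ∀ e : ℤˣ,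
      heckeYs κ (k, e) * heckeT κ i.succ - heckeT κ i.succ * heckeYs κ (k, e) ∈ S := by
    intro k hik hk e
    have h1 := (hY.commute hx hik hk).zpow_right (e : ℤ)
    have h2 : heckeT κ i.succ * heckeYs κ (k, e) = heckeYs κ (k, e) * heckeT κ i.succ :=
      congrArg Units.val h1.eq
    rw [h2, sub_self]
    exact zero_mem _
  obtain ⟨k, e⟩ := p
  change heckeYs κ (k, e) * (heckeUnit κ i.succ : Hecke n κ) -
    (heckeUnit κ i.succ : Hecke n κ) * _ ∈ S
  by_cases hi : i.val + 1 < n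
  · set j : Fin n := ⟨i.val + 1, hi⟩ with hj
    have hij : j.val = i.val + 1 := rfl
    rw [pairAct_mid i j hij]
    have hst := hY.step i j hij
    -- Inverting $Y_i=T_iY_{i+1}T_i$ exchanges the roles of $i$ and $i+1$, so the relations for
    -- $Y^{-1}$ need no new computation.
    have hst' : (heckeYUnit κ j)⁻¹ =
        heckeUnit κ i.succ * (heckeYUnit κ i)⁻¹ * heckeUnit κ i.succ := by
      rw [hst]
      group
    by_cases hki : k = i
    · subst hki
      rw [Equiv.swap_apply_left]
      rcases Int.units_eq_one_or e with rfl | rfl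
      · rw [ePos, ePos, bernstein_fst hq hst, add_sub_cancel_left, ← ePos]
        exact S.smul_mem _ (hYp _)
      · rw [eNeg, eNeg, bernstein_snd hq hst', sub_sub_cancel_left, ← eNeg]
        exact S.neg_mem (S.smul_mem _ (hYp _))
    by_cases hkj : k = j
    · rw [hkj]
      rw [Equiv.swap_apply_right]
      rcases Int.units_eq_one_or e with rfl | rfl
      · rw [ePos, ePos, bernstein_snd hq hst, sub_sub_cancel_left, ← ePos]
        exact S.neg_mem (S.smul_mem _ (hYp _))
      · rw [eNeg, eNeg, bernstein_fst hq hst', add_sub_cancel_left, ← eNeg]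
        exact S.smul_mem _ (hYp _)
    · rw [Equiv.swap_apply_of_ne_of_ne hki hkj]
      exact hcomm k (Ne.symm hki) (fun e => hkj (Fin.ext e)) e
  · rw [pairAct_last i hi]
    have hq0 := quadRel_heckeY_last κ i hi
    by_cases hki : k = i
    · subst hki
      rw [if_pos rfl]
      rcases Int.units_eq_one_or e with rfl | rfl
      · rw [ePos, eNeg, bernstein_last hq hq0, add_assoc, add_sub_cancel_left, ← ePos]
        exact S.add_mem (S.smul_mem _ (hYp _)) (S.smul_mem _ h1)
      · rw [neg_neg, ePos, eNeg, bernstein_last_inv hq hq0, sub_sub_cancel_left, ← ePos]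
        exact S.neg_mem (S.add_mem (S.smul_mem _ (hYp _)) (S.smul_mem _ h1))
    · rw [if_neg hki]
      have := k.isLt
      exact hcomm k (Ne.symm hki) (by omega) e

end HeckeY

/-! ### Homomorphisms out of `H(κ)` -/

section Lift

variable {n : ℕ} (κ : Kappa) {B : Type*} [Ring B] [Algebra ℂ B]

/-- The relations are imposed on units, so that all braid identities can be verified inside a group.
-/
theorem exists_heckeLift {g : Fin (n + 1) → Bˣ} (hq : ∀ j, QuadRel (κ.at j : ℂ) (g j))
    (hx : BraidFamily fun i : Fin n => g i.succ)
    (hc : ∀ i : Fin n, 0 < i.val → Commute (g 0) (g i.succ))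
    (hl : ∀ j : Fin n, j.val = 0 → 1 < n → g 0 * g j.succ * g 0 * g j.succ =
      g j.succ * g 0 * g j.succ * g 0) :
    ∃ φ : Hecke n κ →ₐ[ℂ] B, ∀ j, φ (heckeT κ j) = g j := by
  refine ⟨RingQuot.liftAlgHom ℂ ⟨FreeAlgebra.lift ℂ fun j => (g j : B), ?_⟩, fun j => by
    rw [heckeT, RingQuot.liftAlgHom_mkAlgHom_apply, FreeAlgebra.lift_ι_apply]⟩
  intro x y h
  cases h with
  | quadratic j =>
    simp only [map_mul, map_sub, map_add, map_zero, AlgHom.commutes, FreeAlgebra.lift_ι_apply]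
    exact (hq j).quadratic (Units.ne_zero _)
  | commute i j h =>
    simp only [map_mul, FreeAlgebra.lift_ι_apply]
    obtain ⟨b, rfl⟩ := Fin.exists_succ_eq.2 (show j ≠ 0 from fun hj => by simp [hj] at h)
    revert h
    refine Fin.cases (fun h => ?_) (fun a h => ?_) i
    · exact congrArg Units.val (hc b (by simpa using h))
    · exact congrArg Units.val (hx.comm a b (by simpa using h))
  | braid_mid i j h0 h hn =>
    simp only [map_mul, FreeAlgebra.lift_ι_apply]
    obtain ⟨a, rfl⟩ := Fin.exists_succ_eq.2 (show i ≠ 0 from fun hi => by simp [hi] at h0)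
    obtain ⟨b, rfl⟩ := Fin.exists_succ_eq.2 (show j ≠ 0 from fun hj => by simp [hj] at h)
    exact congrArg Units.val (hx.mid a b (by simpa using h) (by simpa using hn))
  | braid_left i j h0 h hn =>
    simp only [map_mul, FreeAlgebra.lift_ι_apply]
    obtain rfl : i = 0 := Fin.ext h0
    obtain ⟨b, rfl⟩ := Fin.exists_succ_eq.2 (show j ≠ 0 from fun hj => by simp [hj] at h)
    exact congrArg Units.val (hl b (by simpa using h) (by omega))
  | braid_right i j h0 h hn =>
    simp only [map_mul, FreeAlgebra.lift_ι_apply]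
    obtain ⟨a, rfl⟩ := Fin.exists_succ_eq.2 (show i ≠ 0 from fun hi => by simp [hi] at h0)
    obtain ⟨b, rfl⟩ := Fin.exists_succ_eq.2 (show j ≠ 0 from fun hj => by simp [hj] at h)
    rw [Fin.val_succ] at hn
    exact congrArg Units.val (hx.last a b (by simpa using h) (by omega))

variable [NeZero n]

/-- The palindromes are determined by $T_1,\dots,T_n$, then $Y_1=T_0E_1$, and each further $Y_i$
follows from its predecessor. -/
theorem map_heckeYUnit {φ : Hecke n κ →ₐ[ℂ] B} {x y E : Fin n → Bˣ} (hE : PalFamily x E)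
    (hy : YFamily x y) (h0 : φ (heckeT κ 0) = (y 0 * (E 0)⁻¹ : Bˣ))
    (hφ : ∀ i, φ (heckeT κ i.succ) = x i) (i : Fin n) :
    Units.map φ.toMonoidHom (heckeYUnit κ i) = y i := by
  have hT : ∀ i, Units.map φ.toMonoidHom (heckeUnit κ i.succ) = x i := fun i => Units.ext (hφ i)
  have hT0 : Units.map φ.toMonoidHom (heckeUnit κ 0) = y 0 * (E 0)⁻¹ := Units.ext h0
  have hEE : ∀ i, Units.map φ.toMonoidHom (heckeE κ i) = E i := by
    refine fin_downward_induction (fun i hi => ?_) fun i j hij h => ?_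
    · rw [(palFamily_heckeE κ).last i hi, hE.last i hi, hT]
    · rw [(palFamily_heckeE κ).step i j hij, hE.step i j hij, map_mul, map_mul, hT, h]
  refine fin_upward_induction (P := fun i => Units.map φ.toMonoidHom (heckeYUnit κ i) = y i) ?_ ?_ i
  · rw [heckeYUnit_zero, map_mul, hEE, hT0, inv_mul_cancel_right]
  · intro i j hij h
    rw [(yFamily_heckeYUnit κ).eq_right hij, hy.eq_right hij, map_mul, map_mul, map_inv, hT, h]

/-- The Bernstein presentation of `H(κ)`. -/
theorem exists_bernsteinLift {x y E : Fin n → Bˣ} (hx : BraidFamily x) (hE : PalFamily x E)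
    (hy : YFamily x y) (hq : ∀ i : Fin n, QuadRel (κ.at i.succ : ℂ) (x i))
    (h0 : ∀ i : Fin n, ¬ i.val + 1 < n → QuadRel (κ.zero : ℂ) (y i * (x i)⁻¹))
    (h01 : ∀ j : Fin n, j.val = 1 → Commute (y 0) (y j)) :
    ∃ φ : Hecke n κ →ₐ[ℂ] B, (∀ i, φ (heckeT κ i.succ) = x i) ∧
      ∀ i, Units.map φ.toMonoidHom (heckeYUnit κ i) = y i := by
  have hcomm : ∀ i : Fin n, 0 < i.val → Commute (y 0 * (E 0)⁻¹) (x i) := by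
    intro i hi
    have hi' : (0 : Fin n) < i := hi
    exact ((hy.zero i hi'.ne').symm).mul_left (hE.commute hx 0 i hi').symm.inv_left
  -- The image of $T_0$ is forced to be $y_1E_1^{-1}$. Its quadratic relation is transported from
  -- the last index.
  obtain ⟨φ, hφ⟩ := exists_heckeLift κ (g := Fin.cases (y 0 * (E 0)⁻¹) x) (fun j => by
      refine Fin.cases ?_ (fun i => hq i) j
      obtain ⟨l, hl⟩ : ∃ l : Fin n, ¬ l.val + 1 < n :=
        ⟨⟨n - 1, Nat.sub_one_lt (NeZero.ne n)⟩, by simp only; omega⟩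
      refine (quadRel_last hE hy _ l).2 ?_
      rw [hE.last l hl]
      exact h0 l hl) hx hcomm (by
    intro i hi hn
    obtain rfl : i = 0 := Fin.ext hi
    simp only [Fin.cases_zero, Fin.cases_succ]
    set j : Fin n := ⟨1, hn⟩ with hj
    have h0j : j.val = (0 : Fin n).val + 1 := by simp [hj]
    set z := y 0 * (E 0)⁻¹ with hz
    have hzE : Commute z (E j) := hE.commute_of_commute z j fun i hi => hcomm i (by
      rw [Fin.le_def, hj] at hi
      simp only at hi
      omega)
    have hEE : Commute (E 0) (E j) := hE.commute_pal hx (by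
      rw [Fin.lt_def, h0j]
      omega)
    have hyy := (h01 j rfl).eq
    have hy0 : y 0 = z * x 0 * E j * x 0 := by
      rw [hz, hE.step 0 j h0j]
      group
    have hyj : y j = (x 0)⁻¹ * z * x 0 * E j := by
      rw [hy.eq_right h0j, hy0]
      group
    rw [hE.step 0 j h0j] at hEE
    have hEE' : E j * x 0 * E j * x 0 = x 0 * E j * x 0 * E j := by
      have := hEE.eq
      simp only [mul_assoc] at this ⊢
      exact this.symm
    -- With $z=y_1E_1^{-1}$, both products of the first two $y$'s are written in $z$, $x_1$ and
    -- $E_2$. After $E_2$ is moved past $z$ and $E_1$, their equality is the four-term relation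
    -- between $z$ and $x_1$.
    have e1 : y 0 * y j = z * x 0 * z * (E j * x 0 * E j) := by
      calc y 0 * y j = z * x 0 * (E j * z) * x 0 * E j := by rw [hyj, hy0]; group
        _ = _ := by rw [← hzE.eq]; group
    have e2 : y j * y 0 = (x 0)⁻¹ * z * x 0 * z * x 0 * (E j * x 0 * E j) := by
      calc y j * y 0 = (x 0)⁻¹ * z * x 0 * (E j * z) * x 0 * E j * x 0 := by rw [hyj, hy0]; group
        _ = (x 0)⁻¹ * z * x 0 * z * (E j * x 0 * E j * x 0) := by rw [← hzE.eq]; group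
        _ = _ := by rw [hEE']; group
    rw [e1, e2] at hyy
    have e3 := congrArg (x 0 * ·) (mul_right_cancel hyy)
    simp only [← mul_assoc, mul_inv_cancel, one_mul] at e3
    exact e3.symm)
  exact ⟨φ, fun i => hφ i.succ, map_heckeYUnit κ hE hy (hφ 0) fun i => hφ i.succ⟩

/-- The palindromic products of a family. -/
theorem exists_palFamily {M : Type*} [Monoid M] (x : Fin n → M) : ∃ E, PalFamily x E := by
  let f : ℕ → M := fun r => x ⟨n - 1 - r, by have := NeZero.pos n; omega⟩
  let E : ℕ → M := fun r => r.rec (f 0) fun r a => f (r + 1) * a * f (r + 1)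
  refine ⟨fun i => E (n - 1 - i.val), fun i hi => ?_, fun i j hij => ?_⟩
  · have h0 : n - 1 - i.val = 0 := by omega
    have hi' := i.isLt
    simp only [h0]
    change x _ = x i
    congr 1
    refine Fin.ext ?_
    simp only
    omega
  · have hj := j.isLt
    have h0 : n - 1 - i.val = (n - 1 - j.val) + 1 := by omega
    have hf : f (n - 1 - j.val + 1) = x i := by
      change x _ = x i
      congr 1
      refine Fin.ext ?_
      simp only
      omega
    simp only [h0]
    change f (n - 1 - j.val + 1) * _ * f (n - 1 - j.val + 1) = _
    rw [hf]

end Lift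

/-! ### The anti-homomorphism that inverts the generators. -/

section Sharp

variable {n : ℕ} (κ : Kappa)

theorem inv_at (j : Fin (n + 1)) : (κ⁻¹).at j = (κ.at j)⁻¹ := by
  refine Fin.cases rfl (fun i => ?_) j
  simp only [Kappa.at, Fin.cases_succ]
  split_ifs <;> rfl

/-- The inverse of a unit, as a unit of the opposite ring. -/
def opInv {B : Type*} [Ring B] (z : Bˣ) : Bᵐᵒᵖˣ :=
  ⟨MulOpposite.op ↑z⁻¹, MulOpposite.op ↑z, by rw [← MulOpposite.op_mul]; simp, by
    rw [← MulOpposite.op_mul]; simp⟩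

theorem opInv_mul {B : Type*} [Ring B] (z w : Bˣ) : opInv z * opInv w = opInv (z * w) := by
  refine Units.ext ?_
  rw [Units.val_mul]
  change MulOpposite.op _ * MulOpposite.op _ = MulOpposite.op _
  rw [← MulOpposite.op_mul, ← Units.val_mul, mul_inv_rev]

theorem opInv_inv {B : Type*} [Ring B] (z : Bˣ) : opInv z⁻¹ = (opInv z)⁻¹ := by
  refine Units.ext ?_
  change MulOpposite.op _ = MulOpposite.op _
  rw [inv_inv]

/-- The anti-homomorphism `H(κ⁻¹) → H(κ)` with `T_j ↦ T_j⁻¹`. -/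
theorem exists_sharp [NeZero n] : ∃ φ : Hecke n κ⁻¹ →ₐ[ℂ] (Hecke n κ)ᵐᵒᵖ,
    (∀ j, φ (heckeT κ⁻¹ j) = MulOpposite.op (heckeTinv κ j)) ∧
    ∀ i, φ (heckeY κ⁻¹ i) = MulOpposite.op ↑(heckeYUnit κ i)⁻¹ := by
  have hb := braidFamily_heckeUnit (n := n) κ
  have hx : BraidFamily fun i : Fin n => opInv (heckeUnit κ i.succ) := by
    refine ⟨fun i j h => ?_, fun i j h hj => ?_, fun i j h hj => ?_⟩
    · simp only [opInv_mul, hb.comm i j h]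
    · simp only [opInv_mul, hb.mid i j h hj]
    · simp only [opInv_mul, hb.last i j h hj]
  obtain ⟨φ, hφ⟩ := exists_heckeLift κ⁻¹ (B := (Hecke n κ)ᵐᵒᵖ)
    (g := fun j => opInv (heckeUnit κ j)) (fun j => by
      -- Passing to the inverse changes the sign of $\kappa-\kappa^{-1}$, that is, replaces $\kappa$
      -- by $\kappa^{-1}$.
      have h := quadRel_heckeUnit κ j
      rw [inv_at]
      change MulOpposite.op _ = MulOpposite.op _ + _
      rw [h.inv_eq, MulOpposite.op_sub, MulOpposite.op_smul, MulOpposite.op_one,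
        Units.val_inv_eq_inv_val, inv_inv, sub_eq_add_neg, ← neg_sub (κ.at j : ℂ)]
      exact congrArg _ (neg_smul _ _).symm) hx
    (fun i hi => by
      have := heckeUnit_commute κ 0 i.succ (by simp only [Fin.val_succ, Fin.val_zero]; omega)
      change _ * _ = _ * _
      rw [opInv_mul, opInv_mul, this.eq])
    (fun j hj hn => by
      have := heckeUnit_braid_left κ 0 j.succ rfl (by simp [hj]) (by simp [hj]; omega)
      simp only [opInv_mul, this])
  refine ⟨φ, hφ, fun i => ?_⟩
  -- Inversion is multiplicative into the opposite ring, so the inverted palindromes and $Y$'s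
  -- satisfy the same recursions; hence $Y_i\mapsto Y_i^{-1}$.
  have hE : PalFamily (fun i : Fin n => opInv (heckeUnit κ i.succ))
      fun i => opInv (heckeE κ i) := by
    refine ⟨fun i hi => ?_, fun i j hij => ?_⟩
    · rw [(palFamily_heckeE κ).last i hi]
    · rw [opInv_mul, opInv_mul, (palFamily_heckeE κ).step i j hij]
  have hy : YFamily (fun i : Fin n => opInv (heckeUnit κ i.succ))
      fun i => opInv (heckeYUnit κ i) := by
    refine ⟨fun i j hij => ?_, fun i hi => ?_⟩
    · rw [opInv_mul, opInv_mul, (yFamily_heckeYUnit κ).step i j hij]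
    · change _ * _ = _ * _
      rw [opInv_mul, opInv_mul, ((yFamily_heckeYUnit κ).zero i hi).eq]
  have := map_heckeYUnit κ⁻¹ (φ := φ) hE hy (by
    rw [hφ, heckeYUnit_zero, ← opInv_inv, opInv_mul, mul_inv_cancel_right]) (fun i => hφ i.succ) i
  rw [← heckeYUnit_val]
  exact congrArg Units.val this

end Sharp

/-! ### Modules generated by an eigenvector of the `Y_i` -/

section Eigen

variable {n : ℕ} (κ : Kappa)

theorem hecke_induction {P : Hecke n κ → Prop} (scalar : ∀ c : ℂ, P (algebraMap ℂ _ c))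
    (gen : ∀ j, P (heckeT κ j)) (add : ∀ a b, P a → P b → P (a + b))
    (mul : ∀ a b, P a → P b → P (a * b)) (h : Hecke n κ) : P h := by
  obtain ⟨a, rfl⟩ := RingQuot.mkAlgHom_surjective ℂ (HeckeRel n κ) h
  induction a using FreeAlgebra.induction with
  | grade0 c =>
    rw [AlgHom.commutes]
    exact scalar c
  | grade1 j => exact gen j
  | mul a b ha hb =>
    rw [map_mul]
    exact mul _ _ ha hb
  | add a b ha hb =>
    rw [map_add]
    exact add _ _ ha hb

theorem braidFamily_heckeT : BraidFamily fun i : Fin n => heckeT κ i.succ where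
  comm i j h := congrArg Units.val ((braidFamily_heckeUnit κ).comm i j h)
  mid i j h hj := congrArg Units.val ((braidFamily_heckeUnit κ).mid i j h hj)
  last i j h hj := congrArg Units.val ((braidFamily_heckeUnit κ).last i j h hj)

theorem heckeTW_one : heckeTW κ (1 : W0 n) = 1 := braidProd_one (braidFamily_heckeT κ)

theorem heckeTW_simple_mul {i : Fin n} {w : W0 n} (h : len (simple i * w) = len w + 1) :
    heckeTW κ (simple i * w) = heckeT κ i.succ * heckeTW κ w :=
  braidProd_simple_mul (braidFamily_heckeT κ) h

theorem heckeTW_mul_simple {i : Fin n} {w : W0 n} (h : len (w * simple i) = len w + 1) :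
    heckeTW κ (w * simple i) = heckeTW κ w * heckeT κ i.succ :=
  braidProd_mul_simple (braidFamily_heckeT κ) h

theorem heckeTW_mul {w v : W0 n} (h : len (w * v) = len w + len v) :
    heckeTW κ (w * v) = heckeTW κ w * heckeTW κ v :=
  braidProd_mul (braidFamily_heckeT κ) h

theorem heckeT_mul_self (j : Fin (n + 1)) : heckeT κ j * heckeT κ j =
    ((κ.at j : ℂ) - (κ.at j : ℂ)⁻¹) • heckeT κ j + 1 :=
  (quadRel_heckeUnit κ j).mul_self

theorem heckeT_mul_heckeTW_of_lt {i : Fin n} {w : W0 n} (h : len w = len (simple i * w) + 1) :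
    heckeT κ i.succ * heckeTW κ w = ((κ.at i.succ : ℂ) - (κ.at i.succ : ℂ)⁻¹) • heckeTW κ w +
      heckeTW κ (simple i * w) := by
  have e : simple i * (simple i * w) = w := by rw [← mul_assoc, simple_mul_self, one_mul]
  have h1 := heckeTW_simple_mul κ (i := i) (w := simple i * w) (by rw [e, h])
  rw [e] at h1
  rw [h1, ← mul_assoc, heckeT_mul_self, add_mul, one_mul, smul_mul_assoc]

theorem heckeTinv_eq (j : Fin (n + 1)) :
    heckeTinv κ j = heckeT κ j - ((κ.at j : ℂ) - (κ.at j : ℂ)⁻¹) • 1 :=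
  (quadRel_heckeUnit κ j).inv_eq

theorem exists_left_descent {w : W0 n} {k : ℕ} (h : len w = k + 1) :
    ∃ i : Fin n, ∃ w' : W0 n, w = simple i * w' ∧ len w' = k ∧
      len (simple i * w') = len w' + 1 := by
  obtain ⟨i, hi⟩ : ∃ i, Desc i (vact w (rho n)) := by
    by_contra hcon
    push Not at hcon
    rw [eq_one_of_not_desc w hcon, len_one] at h
    omega
  have h1 := len_desc hi
  have e : simple i * (simple i * w) = w := by rw [← mul_assoc, simple_mul_self, one_mul]
  exact ⟨i, simple i * w, e.symm, by omega, by rw [e, h1]⟩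

/-- The order is reversed because this is a right action. It matches the peeling of letters from the
left of $w$ when $Y$ is moved through $T_w$, and the evaluation of weights at $w\gamma$ in
`weight_pairAct`. -/
theorem pairAct_mul (w v : W0 n) (p : Fin n × ℤˣ) :
    pairAct (w * v) p = pairAct v (pairAct w p) := by
  refine Prod.ext ?_ ?_
  · simp [pairAct]
  · simp only [pairAct, SemidirectProduct.mul_left, Pi.mul_apply]
    rw [mul_comm (w.left p.1), mul_assoc]
    rfl

theorem pairAct_one (p : Fin n × ℤˣ) : pairAct 1 p = p := by
  simp [pairAct]

variable [NeZero n] {O M : Type*} [CommRing O] [Algebra ℂ O] [AddCommGroup M] [Module ℂ M]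
  [Module O M] [IsScalarTower ℂ O M] {ρ : Hecke n κ →ₐ[ℂ] Module.End ℂ M}

variable (O ρ) in
/-- The span of the vectors `T_x v` with `len x < k`. -/
def lenSpan (v : M) (k : ℕ) : Submodule O M :=
  Submodule.span O {m | ∃ x : W0 n, len x < k ∧ m = ρ (heckeTW κ x) v}

omit [NeZero n] [Algebra ℂ O] [IsScalarTower ℂ O M] in
theorem lenSpan_mono (v : M) {k l : ℕ} (h : k ≤ l) : lenSpan κ O ρ v k ≤ lenSpan κ O ρ v l :=
  Submodule.span_mono fun _ ⟨x, hx, e⟩ => ⟨x, hx.trans_le h, e⟩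

omit [NeZero n] [Algebra ℂ O] [IsScalarTower ℂ O M] in
theorem mem_lenSpan (v : M) {k : ℕ} {x : W0 n} (h : len x < k) :
    ρ (heckeTW κ x) v ∈ lenSpan κ O ρ v k :=
  Submodule.subset_span ⟨x, h, rfl⟩

theorem span_smul_mem {N : Submodule O M} (c : ℂ) {m : M} (hm : m ∈ N) : c • m ∈ N := by
  rw [← algebraMap_smul O c m]
  exact N.smul_mem _ hm

omit [NeZero n] in
-- A product $T_iT_x$ involves only $T_x$ and $T_{s_ix}$. The scalars `O` are kept general for two
-- uses: complex numbers on a principal series module, and functions acting by right multiplication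
-- on operators.
theorem heckeT_lenSpan (hρ : ∀ h (p : O) m, ρ h (p • m) = p • ρ h m) (v : M) {k : ℕ} {m : M}
    (hm : m ∈ lenSpan κ O ρ v k) (i : Fin n) :
    ρ (heckeT κ i.succ) m ∈ lenSpan κ O ρ v (k + 1) := by
  refine Submodule.span_induction (p := fun m _ => ρ (heckeT κ i.succ) m ∈ lenSpan κ O ρ v (k + 1))
    ?_ ?_ ?_ ?_ hm
  · rintro _ ⟨x, hx, rfl⟩
    rw [← Module.End.mul_apply, ← map_mul]
    rcases len_left_or i x with h | h
    · rw [← heckeTW_simple_mul κ h]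
      exact mem_lenSpan κ v (by omega)
    · rw [heckeT_mul_heckeTW_of_lt κ h, map_add, map_smul, LinearMap.add_apply,
        LinearMap.smul_apply]
      exact add_mem (span_smul_mem _ (mem_lenSpan κ v (by omega))) (mem_lenSpan κ v (by omega))
  · rw [map_zero]
    exact zero_mem _
  · intro a b _ _ ha hb
    rw [map_add]
    exact add_mem ha hb
  · intro c a _ ha
    rw [hρ]
    exact Submodule.smul_mem _ _ ha

/-- The triangularity of the action of the `Y_i^{±1}` on the vectors `T_w v`. -/
theorem heckeYs_triangular (hρ : ∀ h (p : O) m, ρ h (p • m) = p • ρ h m) {v : M}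
    {g : Fin n × ℤˣ → O} (hv : ∀ p, ρ (heckeYs κ p) v = g p • v) (k : ℕ) :
    ∀ (w : W0 n), len w = k → ∀ p,
      ρ (heckeYs κ p) (ρ (heckeTW κ w) v) - g (pairAct w p) • ρ (heckeTW κ w) v ∈
        lenSpan κ O ρ v k := by
  induction k with
  | zero =>
    intro w hw p
    rw [eq_one_of_len hw, heckeTW_one, map_one, Module.End.one_apply, hv, pairAct_one, sub_self]
    exact zero_mem _
  | succ k ih =>
    intro w hw p
    obtain ⟨i, w', rfl, hk, hlen⟩ := exists_left_descent hw
    have ih' := ih w' hk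
    rw [heckeTW_simple_mul κ hlen, map_mul, Module.End.mul_apply, pairAct_mul]
    set u := ρ (heckeTW κ w') v with hu
    have humem : u ∈ lenSpan κ O ρ v (k + 1) := mem_lenSpan κ v (by omega)
    have hYmem : ∀ q, ρ (heckeYs κ q) u ∈ lenSpan κ O ρ v (k + 1) := fun q => by
      have := add_mem (lenSpan_mono κ v (Nat.le_succ k) (ih' q)) (Submodule.smul_mem _
        (g (pairAct w' q)) humem)
      rwa [sub_add_cancel] at this
    -- The error term of the Bernstein relation is a combination of $1$ and the $Y^{\pm1}$, and by
    -- induction these keep $T_{w'}v$ within shorter lengths than that of $s_iw'$.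
    have hr : ∀ r ∈ Submodule.span ℂ (insert (1 : Hecke n κ) (Set.range (heckeYs κ))),
        ρ r u ∈ lenSpan κ O ρ v (k + 1) := by
      intro r hr
      refine Submodule.span_induction (p := fun r _ => ρ r u ∈ lenSpan κ O ρ v (k + 1))
        ?_ ?_ ?_ ?_ hr
      · rintro _ (rfl | ⟨q, rfl⟩)
        · rwa [map_one, Module.End.one_apply]
        · exact hYmem q
      · rw [map_zero, LinearMap.zero_apply]
        exact zero_mem _
      · intro a b _ _ ha hb
        rw [map_add, LinearMap.add_apply]
        exact add_mem ha hb
      · intro c a _ ha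
        rw [map_smul, LinearMap.smul_apply]
        exact span_smul_mem _ ha
    have h1 := hr _ (bernstein κ i p)
    rw [map_sub, map_mul, map_mul, LinearMap.sub_apply, Module.End.mul_apply,
      Module.End.mul_apply] at h1
    have h2 := heckeT_lenSpan κ hρ v (ih' (pairAct (simple i) p)) i
    rw [map_sub, hρ] at h2
    have := add_mem h1 h2
    rwa [sub_add_sub_cancel] at this

/-- A module generated by an eigenvector `v` of the `Y_i` is spanned by the vectors `T_w v`. -/
theorem mem_span_heckeTW (hρ : ∀ h (p : O) m, ρ h (p • m) = p • ρ h m) {v : M}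
    {g : Fin n × ℤˣ → O} (hv : ∀ p, ρ (heckeYs κ p) v = g p • v) (h : Hecke n κ) :
    ρ h v ∈ Submodule.span O (Set.range fun w : W0 n => ρ (heckeTW κ w) v) := by
  set N := Submodule.span O (Set.range fun w : W0 n => ρ (heckeTW κ w) v) with hN
  have hle : ∀ k, lenSpan κ O ρ v k ≤ N := fun k =>
    Submodule.span_mono fun _ ⟨x, _, e⟩ => ⟨x, e.symm⟩
  have hext : ∀ a : Hecke n κ, (∀ w, ρ a (ρ (heckeTW κ w) v) ∈ N) → ∀ m ∈ N, ρ a m ∈ N := by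
    intro a ha m hm
    refine Submodule.span_induction (p := fun m _ => ρ a m ∈ N) ?_ ?_ ?_ ?_ hm
    · rintro _ ⟨w, rfl⟩
      exact ha w
    · rw [map_zero]
      exact zero_mem _
    · intro a b _ _ ha hb
      rw [map_add]
      exact add_mem ha hb
    · intro c a _ ha
      rw [hρ]
      exact Submodule.smul_mem _ _ ha
  have hT : ∀ i : Fin n, ∀ m ∈ N, ρ (heckeT κ i.succ) m ∈ N := fun i =>
    hext _ fun w => hle _ (heckeT_lenSpan κ hρ v (mem_lenSpan κ v (Nat.lt_succ_self (len w))) i)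
  have hY : ∀ p, ∀ m ∈ N, ρ (heckeYs κ p) m ∈ N := fun p => hext _ fun w => by
    have := add_mem (hle _ (heckeYs_triangular κ hρ hv _ w rfl p))
      (Submodule.smul_mem N (g (pairAct w p)) (Submodule.subset_span ⟨w, rfl⟩))
    rwa [sub_add_cancel] at this
  have hTinv : ∀ i : Fin n, ∀ m ∈ N, ρ ((heckeUnit κ i.succ)⁻¹ : (Hecke n κ)ˣ) m ∈ N := by
    intro i m hm
    rw [(quadRel_heckeUnit κ i.succ).inv_eq, map_sub, map_smul, map_one, LinearMap.sub_apply,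
      LinearMap.smul_apply, Module.End.one_apply]
    exact sub_mem (hT i m hm) (span_smul_mem _ hm)
  have hE : ∀ i : Fin n, ∀ m ∈ N, ρ ((heckeE κ i)⁻¹ : (Hecke n κ)ˣ) m ∈ N := by
    refine fin_downward_induction (fun i hi => ?_) fun i j hij h => ?_
    · rw [(palFamily_heckeE κ).last i hi]
      exact hTinv i
    · intro m hm
      rw [(palFamily_heckeE κ).step i j hij, mul_inv_rev, mul_inv_rev, Units.val_mul,
        Units.val_mul, map_mul, map_mul, Module.End.mul_apply, Module.End.mul_apply]
      exact hTinv i _ (h _ (hTinv i m hm))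
  have hvN : v ∈ N := Submodule.subset_span ⟨1, by
    simp only [heckeTW_one, map_one, Module.End.one_apply]⟩
  refine hecke_induction κ (P := fun h => ∀ m ∈ N, ρ h m ∈ N) ?_ ?_ ?_ ?_ h v hvN
  · intro c m hm
    rw [AlgHom.commutes, Module.algebraMap_end_apply]
    exact span_smul_mem _ hm
  · intro j
    refine Fin.cases ?_ hT j
    intro m hm
    -- Stability under $T_0$ is reduced to $Y_1$ and to the inverse of a product of $T_1,\dots,T_n$.
    have e : heckeT κ 0 = heckeYs κ ((0 : Fin n), 1) *
        (((heckeE κ (0 : Fin n))⁻¹ : (Hecke n κ)ˣ) : Hecke n κ) := by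
      have : heckeUnit κ 0 = heckeYUnit κ (0 : Fin n) * (heckeE κ 0)⁻¹ := by
        rw [heckeYUnit_zero, mul_inv_cancel_right]
      have h2 := congrArg Units.val this
      rw [Units.val_mul] at h2
      change heckeT κ 0 = _ at h2
      simpa [heckeYs] using h2
    rw [e, map_mul, Module.End.mul_apply]
    exact hY _ _ (hE 0 m hm)
  · intro a b ha hb m hm
    rw [map_add, LinearMap.add_apply]
    exact add_mem (ha m hm) (hb m hm)
  · intro a b ha hb m hm
    rw [map_mul, Module.End.mul_apply]
    exact ha _ (hb m hm)

end Eigen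

/-! ### Weights of the $Y_i$ and degenerate intertwiners. -/

section ComplexEigen

variable {n : ℕ} [NeZero n] (κ : Kappa) {M : Type*} [AddCommGroup M] [Module ℂ M]
  {ρ : Hecke n κ →ₐ[ℂ] Module.End ℂ M}

/-- The weight `γ_i^{±1}`. -/
def weight (γ : Torus n) (p : Fin n × ℤˣ) : ℂ := (γ p.1 ^ ((p.2 : ℤˣ) : ℤ) : ℂˣ)

omit [NeZero n] in
theorem weight_pairAct (w : W0 n) (γ : Torus n) (p : Fin n × ℤˣ) :
    weight γ (pairAct w p) = weight (signedAct n ℂˣ w γ) p := by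
  simp only [weight, pairAct, signedAct_apply, Units.val_mul, zpow_mul]

omit [NeZero n] in
theorem heckeYs_eigen {v : M} {γ : Torus n} (hv : ∀ j, ρ (heckeY κ j) v = (γ j : ℂ) • v)
    (p : Fin n × ℤˣ) : ρ (heckeYs κ p) v = weight γ p • v := by
  obtain ⟨j, e⟩ := p
  have hj := hv j
  rw [← heckeYUnit_val] at hj
  rcases Int.units_eq_one_or e with rfl | rfl
  · simpa [heckeYs, weight] using hj
  · have h1 : ρ ((heckeYUnit κ j)⁻¹ : (Hecke n κ)ˣ) (ρ (heckeYUnit κ j) v) = v := by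
      rw [← Module.End.mul_apply, ← map_mul, Units.inv_mul, map_one, Module.End.one_apply]
    rw [hj, map_smul] at h1
    have h2 : ρ ((heckeYUnit κ j)⁻¹ : (Hecke n κ)ˣ) v = (γ j : ℂ)⁻¹ • v := by
      rw [← h1, smul_smul, inv_mul_cancel₀ (γ j).ne_zero, one_smul, h1]
    simpa [heckeYs, weight] using h2

/-- The condition $\gamma_i/\gamma_{i+1}=\kappa^2$, or $\gamma_n=\kappa_0\kappa_n$, is precisely
what makes the correction term of the Bernstein relation cancel. The intertwiner from weight
$\gamma$ to $s_i\gamma$ then degenerates to $T_i-\kappa_i$. The resulting vector may be zero. -/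
theorem heckeT_sub_eigen {v : M} {γ : Torus n} (hv : ∀ j, ρ (heckeY κ j) v = (γ j : ℂ) • v)
    {I : Set (Fin n)} (hγ : γ ∈ torusI κ I) {i : Fin n} (hi : i ∈ I) (j : Fin n) :
    ρ (heckeY κ j) (ρ (heckeT κ i.succ) v - (κ.at i.succ : ℂ) • v) =
      (signedAct n ℂˣ (simple i) γ j : ℂ) • (ρ (heckeT κ i.succ) v - (κ.at i.succ : ℂ) • v) := by
  have hq := quadRel_heckeUnit κ i.succ
  have hY := yFamily_heckeYUnit (n := n) κ
  have hx := braidFamily_heckeUnit (n := n) κ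
  have key : ∀ a b : Hecke n κ, ρ (a * b) v = ρ a (ρ b v) := fun a b => by
    rw [map_mul, Module.End.mul_apply]
  have hk := (κ.at i.succ).ne_zero
  have hT : (heckeUnit κ i.succ : Hecke n κ) = heckeT κ i.succ := rfl
  rw [map_sub, map_smul, hv, ← key]
  have hcomm : i ≠ j → j.val ≠ i.val + 1 → ρ (heckeY κ j * heckeT κ i.succ) v -
      (κ.at i.succ : ℂ) • (γ j : ℂ) • v =
        (γ j : ℂ) • (ρ (heckeT κ i.succ) v - (κ.at i.succ : ℂ) • v) := by
    intro h1 h2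
    have h3 : heckeT κ i.succ * heckeY κ j = heckeY κ j * heckeT κ i.succ := by
      rw [← heckeYUnit_val]
      exact congrArg Units.val (hY.commute hx h1 h2).eq
    rw [← h3, key, hv, map_smul, smul_sub, smul_comm (γ j : ℂ)]
  by_cases hin : i.val + 1 < n
  · obtain ⟨m, hm⟩ : ∃ m : Fin n, m = ⟨i.val + 1, hin⟩ := ⟨_, rfl⟩
    have him : m.val = i.val + 1 := by rw [hm]
    have hst := hY.step i m him
    have hγi : (γ i : ℂ) = (κ.at i.succ : ℂ) ^ 2 * γ m := by
      have := (hγ i hi).1 hin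
      rw [div_eq_iff_eq_mul, ← hm] at this
      rw [at_mid κ i hin, this, Units.val_mul, Units.val_pow_eq_pow_val]
    have hs : signedAct n ℂˣ (simple i) γ j = γ (Equiv.swap i m j) := by
      rw [hm]
      exact torusRefl_mid 1 i hin γ j
    rw [hs]
    by_cases hji : j = i
    · subst hji
      rw [Equiv.swap_apply_left, ← heckeYUnit_val, ← hT, bernstein_fst hq hst, map_add, map_smul,
        LinearMap.add_apply, LinearMap.smul_apply, key, heckeYUnit_val, heckeYUnit_val, hv, hv,
        map_smul, hγi]
      match_scalars <;> field_simp
      ring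
    by_cases hjm : j = m
    · rw [hjm, Equiv.swap_apply_right, ← heckeYUnit_val, ← hT, bernstein_snd hq hst, map_sub,
        map_smul, LinearMap.sub_apply, LinearMap.smul_apply, key, heckeYUnit_val, hv,
        map_smul, hγi]
      match_scalars <;> field_simp
      ring
    · rw [Equiv.swap_apply_of_ne_of_ne hji hjm]
      exact hcomm (Ne.symm hji) fun e => hjm (Fin.ext (e.trans him.symm))
  · have hs : signedAct n ℂˣ (simple i) γ j = if j = i then (γ j)⁻¹ else γ j := by
      have := congrFun (torusRefl_last 1 i hin γ) j
      rw [Function.update_apply] at this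
      refine this.trans ?_
      split_ifs with h
      · rw [h]
      · rfl
    rw [hs]
    by_cases hji : j = i
    · subst hji
      have hlast : j.val + 1 = n := by
        have := j.isLt
        omega
      have hγj : (γ j : ℂ) = κ.zero * κ.at j.succ := by
        rw [at_last κ j hin, (hγ j hi).2 hlast, Units.val_mul]
      have hYinv : ρ ((heckeYUnit κ j)⁻¹ : (Hecke n κ)ˣ) v = (γ j : ℂ)⁻¹ • v := by
        have := heckeYs_eigen κ hv (j, -1)
        simpa [heckeYs, weight] using this
      have hk0 := κ.zero.ne_zero
      rw [if_pos rfl, ← heckeYUnit_val, ← hT, bernstein_last hq (quadRel_heckeY_last κ j hin),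
        map_add, map_add, map_smul, map_smul, map_one, LinearMap.add_apply, LinearMap.add_apply,
        LinearMap.smul_apply, LinearMap.smul_apply, key, Module.End.one_apply, heckeYUnit_val, hv,
        hYinv, map_smul, Units.val_inv_eq_inv_val, hγj]
      match_scalars <;> field_simp
      ring
    · rw [if_neg hji]
      have := j.isLt
      exact hcomm (Ne.symm hji) (by omega)

end ComplexEigen

/-! ### Regular elements of the algebra of meromorphic functions -/

instance (n : ℕ) : Fintype (W0 n) := Fintype.ofFinite _

section Regular

variable {n : ℕ}

theorem generic_frequently {P : Torus n → Prop} (hP : Generic P) (p : Torus n) :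
    ∃ᶠ t in 𝓝 p, P t := by
  obtain ⟨h, -, h0, he⟩ := hP p
  rw [eventually_toC] at h0
  exact (Filter.not_eventually.1 h0).mp (he.mono fun t ht hh => ht hh)

/-- Two generic conditions hold together generically, so a generically nonzero factor can be
cancelled. Cancellation replaces division throughout. -/
theorem toMero_mem_nonZeroDivisors {f : meroFun n} (h : Generic fun t => f.1 t ≠ 0) :
    toMero n f ∈ nonZeroDivisors (Mero n) := by
  rw [mem_nonZeroDivisors_iff_right]
  intro x hx
  obtain ⟨g, rfl⟩ := Ideal.Quotient.mk_surjective x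
  change toMero n g * toMero n f = 0 at hx
  change toMero n g = 0
  rw [← map_mul] at hx
  have hx' : IsNull (g * f).1 := Ideal.Quotient.eq_zero_iff_mem.1 hx
  have : Generic fun t => g.1 t * f.1 t = 0 := hx'
  refine Ideal.Quotient.eq_zero_iff_mem.2 ?_
  have hg : Generic fun t => g.1 t = 0 :=
    (this.and h).mono fun t ht => (mul_eq_zero.1 ht.1).resolve_right ht.2
  exact hg

/-- A nonzero value would persist on a neighbourhood, while generic points accumulate everywhere.
This is what permits the later evaluation of continuous coefficients at a single point. -/
theorem eq_zero_of_toMero_eq_zero {f : meroFun n} (hf : Continuous f.1) (h : toMero n f = 0) :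
    f = 0 := by
  have hn : Generic fun t => f.1 t = 0 := Ideal.Quotient.eq_zero_iff_mem.1 h
  refine Subtype.ext (funext fun t => ?_)
  by_contra hne
  exact (generic_frequently hn t) ((hf.tendsto t).eventually_ne hne)

theorem nonZeroDivisors_map {r : Mero n →ₐ[ℂ] Mero n} (hr : ∀ x, r (r x) = x) {x : Mero n}
    (hx : x ∈ nonZeroDivisors (Mero n)) : r x ∈ nonZeroDivisors (Mero n) := by
  rw [mem_nonZeroDivisors_iff_right] at hx ⊢
  intro y hy
  have h1 := congrArg r hy
  rw [map_mul, hr, map_zero] at h1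
  rw [← hr y, hx _ h1, map_zero]

variable [NeZero n]

theorem meroRefl_mk (qh : ℂˣ) (j : Fin (n + 1)) (f : meroFun n) :
    meroRefl qh j (toMero n f) = toMero n ⟨_, IsMero.comp qh j f.2⟩ := rfl

theorem meroRefl_meroRefl (qh : ℂˣ) (j : Fin (n + 1)) (x : Mero n) :
    meroRefl qh j (meroRefl qh j x) = x := by
  obtain ⟨f, rfl⟩ := Ideal.Quotient.mk_surjective x
  change meroRefl qh j (meroRefl qh j (toMero n f)) = toMero n f
  rw [meroRefl_mk, meroRefl_mk]
  exact congrArg (toMero n) (Subtype.ext (funext fun t => by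
    simp only [torusRefl_torusRefl]))

/-- The class of `c_j`. -/
def cMero (qh : ℂˣ) (κ : Kappa) (u0 un : ℂˣ) (j : Fin (n + 1)) : Mero n :=
  toMero n ⟨_, isMero_cFun qh κ u0 un j⟩

theorem koornOp_apply (qh : ℂˣ) (κ : Kappa) (u0 un : ℂˣ) (j : Fin (n + 1)) (x : Mero n) :
    koornOp qh κ u0 un j x =
      (κ.at j : ℂ) • x + cMero qh κ u0 un j * (meroRefl qh j x - x) := rfl

theorem meroRefl_cMero (qh : ℂˣ) (κ : Kappa) (u0 un : ℂˣ) (j : Fin (n + 1)) :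
    meroRefl qh j (cMero qh κ u0 un j) =
      algebraMap ℂ _ (κ.at j : ℂ) + algebraMap ℂ _ (κ.at j : ℂ)⁻¹ - cMero qh κ u0 un j := by
  rw [cMero, meroRefl_mk]
  have e : ∀ c : ℂ, algebraMap ℂ (Mero n) c = toMero n (algebraMap ℂ _ c) := fun c =>
    (AlgHom.commutes _ c).symm
  rw [e, e, ← map_add, ← map_sub]
  exact mk_eq_of_generic ((generic_spectral qh j).mono fun t ht =>
    cFun_torusRefl qh κ u0 un j t ht.1 ht.2)

open Polynomial in
-- The numerator is a nonzero constant times a polynomial with value $1$ at the origin, so it is not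
-- the zero polynomial.
theorem generic_cFun (qh : ℂˣ) (κ : Kappa) (u0 un : ℂˣ) (j : Fin (n + 1)) :
    Generic fun t : Torus n => cFun qh κ u0 un j t ≠ 0 := by
  obtain ⟨X, hX, hX'⟩ := spectral_extends (n := n) qh j
  obtain ⟨k, e, he, hk⟩ := spectral_scale (n := n) qh j
  have hp : ∀ D : ℂ[X], D.eval 0 ≠ 0 → Generic fun t : Torus n =>
      D.eval (spectral qh j t : ℂ) ≠ 0 := fun D hD =>
    generic_poly _ X hX hX' k e he hk D fun h => hD (by rw [h, eval_zero])
  have hend : ∀ k u : ℂ, k ≠ 0 → Generic fun t : Torus n => cEnd k u (spectral qh j t) ≠ 0 := by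
    intro k u hk
    refine ((hp ((1 - C (k * u) * Polynomial.X) * (1 + C (k * u⁻¹) * Polynomial.X))
      (by simp)).and (generic_spectral qh j)).mono fun t ht => ?_
    refine mul_ne_zero (inv_ne_zero hk) (div_ne_zero (by simpa using ht.1)
      (sub_ne_zero.2 ht.2.2.symm))
  have hmid : ∀ k : ℂ, k ≠ 0 → Generic fun t : Torus n => cMid k (spectral qh j t) ≠ 0 := by
    intro k hk
    refine ((hp (1 - C (k ^ 2) * Polynomial.X)
      (by simp)).and (generic_spectral qh j)).mono fun t ht => ?_
    refine mul_ne_zero (inv_ne_zero hk) (div_ne_zero (by simpa using ht.1)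
      (sub_ne_zero.2 ht.2.1.symm))
  unfold cFun
  split_ifs
  · exact hend _ _ (Units.ne_zero _)
  · exact hmid _ (Units.ne_zero _)
  · exact hend _ _ (Units.ne_zero _)

theorem cMero_mem (qh : ℂˣ) (κ : Kappa) (u0 un : ℂˣ) (j : Fin (n + 1)) :
    cMero qh κ u0 un j ∈ nonZeroDivisors (Mero n) :=
  toMero_mem_nonZeroDivisors (generic_cFun qh κ u0 un j)

end Regular

/-! ### Coordinate functions and the action of `W₀` on meromorphic functions -/

section Coordinates

variable {n : ℕ}

theorem weight_inv (t : Torus n) (p : Fin n × ℤˣ) : weight t (p.1, -p.2) = (weight t p)⁻¹ := by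
  simp [weight, zpow_neg]

theorem weight_mul (t : Torus n) (p : Fin n × ℤˣ) : weight t p * weight t (p.1, -p.2) = 1 := by
  rw [weight_inv]
  exact mul_inv_cancel₀ (Units.ne_zero _)

theorem weight_cases (t : Torus n) (k : Fin n) : weight t (k, 1) = t k ∧
    weight t (k, -1) = (t k : ℂ)⁻¹ := by
  simp [weight]

theorem isMero_weight (p : Fin n × ℤˣ) : IsMero fun t : Torus n => weight t p := by
  obtain ⟨k, e⟩ := p
  intro q
  rcases Int.units_eq_one_or e with rfl | rfl
  · exact ⟨fun z => z k, fun _ => 1, analyticAt_coord k _, analyticAt_const, germ_one _,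
      Filter.Eventually.of_forall fun t _ => by simp [(weight_cases t k).1, toC]⟩
  · exact ⟨fun z => (z k)⁻¹, fun _ => 1, (analyticAt_coord k _).inv (toC_ne_zero q k),
      analyticAt_const, germ_one _,
      Filter.Eventually.of_forall fun t _ => by simp [(weight_cases t k).2, toC]⟩

theorem continuous_weight (p : Fin n × ℤˣ) : Continuous fun t : Torus n => weight t p := by
  obtain ⟨k, e⟩ := p
  exact Units.continuous_val.comp ((continuous_apply k).zpow _)

/-- The algebra of continuous meromorphic functions. -/
def regFun (n : ℕ) : Subalgebra ℂ (meroFun n) where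
  carrier := {f | Continuous f.1}
  mul_mem' := fun ha hb => Continuous.mul ha hb
  add_mem' := fun ha hb => Continuous.add ha hb
  algebraMap_mem' := fun c => continuous_const (y := c)

/-- The coordinate functions and their inverses. -/
def wtFun (p : Fin n × ℤˣ) : regFun n := ⟨⟨_, isMero_weight p⟩, continuous_weight p⟩

/-- The coordinate functions and their inverses, as meromorphic functions. -/
def wt (p : Fin n × ℤˣ) : Mero n := toMero n (wtFun p).1

theorem wt_mul (p : Fin n × ℤˣ) : wt p * wt (p.1, -p.2) = 1 := by
  rw [wt, wt, ← map_mul, ← map_one (toMero n)]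
  exact congrArg (toMero n) (Subtype.ext (funext fun t => weight_mul t p))

/-- Two different functions among the $t_k^{\pm1}$ coincide only where $t_a^2=1$, $t_a=t_b$ or
$t_at_b=1$. These functions serve to separate the elements of $W_0$. -/
theorem wt_sub_mem {p q : Fin n × ℤˣ} (h : p ≠ q) : wt p - wt q ∈ nonZeroDivisors (Mero n) := by
  rw [wt, wt, ← map_sub]
  refine toMero_mem_nonZeroDivisors ?_
  change Generic fun t => weight t p - weight t q ≠ 0
  obtain ⟨a, e⟩ := p
  obtain ⟨b, d⟩ := q
  by_cases hab : a = b
  · subst hab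
    have hed : e ≠ d := fun hed => h (by rw [hed])
    refine (generic_sq a 1).mono fun t ht h' => ht ?_
    have ha := (t a).ne_zero
    rcases Int.units_eq_one_or e with rfl | rfl <;> rcases Int.units_eq_one_or d with rfl | rfl
    · exact absurd rfl hed
    · rw [(weight_cases t a).1, (weight_cases t a).2] at h'
      field_simp at h'
      linear_combination h'
    · rw [(weight_cases t a).1, (weight_cases t a).2] at h'
      field_simp at h'
      linear_combination -h'
    · exact absurd rfl hed
  · refine ((generic_ne hab).and (generic_mul hab 1)).mono fun t ht h' => ?_
    have ha := (t a).ne_zero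
    have hb := (t b).ne_zero
    rcases Int.units_eq_one_or e with rfl | rfl <;> rcases Int.units_eq_one_or d with rfl | rfl
    · rw [(weight_cases t a).1, (weight_cases t b).1] at h'
      exact ht.1 (Units.ext (sub_eq_zero.1 h'))
    · rw [(weight_cases t a).1, (weight_cases t b).2] at h'
      refine ht.2 ?_
      field_simp at h'
      linear_combination h'
    · rw [(weight_cases t a).2, (weight_cases t b).1] at h'
      refine ht.2 ?_
      field_simp at h'
      linear_combination -h'
    · rw [(weight_cases t a).2, (weight_cases t b).2] at h'
      exact ht.1 (Units.ext (inv_injective (sub_eq_zero.1 h')))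

variable [NeZero n]

/-- Composing simple reflections along a word produces the pullback by $w^{-1}$. The parameter $q$
does not enter, since only the reflections $s_1,\dots,s_n$ occur; it is set to $1$. -/
theorem exists_act (w : W0 n) : ∃ a : Mero n →ₐ[ℂ] Mero n, ∀ f : meroFun n,
    ∃ h : IsMero fun t => f.1 (signedAct n ℂˣ w⁻¹ t), a (toMero n f) = toMero n ⟨_, h⟩ := by
  obtain ⟨l, rfl, -⟩ := exists_reduced w
  induction l with
  | nil =>
    refine ⟨AlgHom.id ℂ _, fun f => ?_⟩
    rw [word_nil, inv_one, map_one]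
    exact ⟨f.2, rfl⟩
  | cons i l ih =>
    obtain ⟨a, ha⟩ := ih
    refine ⟨(meroRefl 1 i.succ).comp a, fun f => ?_⟩
    obtain ⟨h, hf⟩ := ha f
    have e : ∀ t : Torus n, signedAct n ℂˣ (word (i :: l))⁻¹ t =
        signedAct n ℂˣ (word l)⁻¹ (torusRefl 1 i.succ t) := fun t => by
      rw [word_cons, mul_inv_rev, simple_inv, map_mul]
      rfl
    simp only [e]
    exact ⟨IsMero.comp 1 i.succ h, by rw [AlgHom.comp_apply, hf, meroRefl_mk]⟩

/-- The action of `W₀` on meromorphic functions. -/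
def act (w : W0 n) : Mero n →ₐ[ℂ] Mero n := (exists_act w).choose

theorem act_toMero (w : W0 n) (f g : meroFun n)
    (h : ∀ t, f.1 (signedAct n ℂˣ w⁻¹ t) = g.1 t) : act w (toMero n f) = toMero n g := by
  obtain ⟨h1, h2⟩ := (exists_act w).choose_spec f
  rw [act, h2]
  exact congrArg (toMero n) (Subtype.ext (funext h))

theorem act_simple_mul (i : Fin n) (w : W0 n) (x : Mero n) :
    act (simple i * w) x = meroRefl 1 i.succ (act w x) := by
  obtain ⟨f, rfl⟩ := Ideal.Quotient.mk_surjective x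
  obtain ⟨h1, h2⟩ := (exists_act w).choose_spec f
  change act (simple i * w) (toMero n f) = meroRefl 1 i.succ (act w (toMero n f))
  rw [show act w (toMero n f) = _ from h2, meroRefl_mk]
  refine act_toMero _ _ _ fun t => ?_
  rw [mul_inv_rev, simple_inv, map_mul]
  rfl

theorem act_one (x : Mero n) : act 1 x = x := by
  obtain ⟨f, rfl⟩ := Ideal.Quotient.mk_surjective x
  exact act_toMero _ _ _ fun t => by rw [inv_one, map_one]; rfl

theorem act_wt (w : W0 n) (p : Fin n × ℤˣ) : act w (wt p) = wt (pairAct w⁻¹ p) :=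
  act_toMero _ _ _ fun t => (weight_pairAct w⁻¹ t p).symm

theorem act_inv_act (w : W0 n) (x : Mero n) : act w⁻¹ (act w x) = x := by
  obtain ⟨f, rfl⟩ := Ideal.Quotient.mk_surjective x
  obtain ⟨h1, h2⟩ := (exists_act w).choose_spec f
  change act w⁻¹ (act w (toMero n f)) = toMero n f
  rw [show act w (toMero n f) = _ from h2]
  refine act_toMero _ _ _ fun t => ?_
  change f.1 _ = f.1 _
  rw [inv_inv, ← MulAut.mul_apply, ← map_mul, inv_mul_cancel, map_one]
  rfl

omit [NeZero n] in
theorem pairAct_injective {v w : W0 n} (h : ∀ p, pairAct v p = pairAct w p) : v = w := by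
  refine SemidirectProduct.ext (funext fun k => ?_) (inv_injective (Equiv.ext fun k => ?_))
  · have := congrArg Prod.snd (h (k, 1))
    simpa [pairAct] using this
  · exact congrArg Prod.fst (h (k, 1))

/-- The automorphisms in `W₀` are linearly independent over the meromorphic functions. -/
theorem act_independent {g : W0 n → Mero n} (hg : ∀ φ, ∑ w, g w * act w φ = 0) (v : W0 n) :
    g v = 0 := by
  classical
  -- The Artin–Dedekind argument: substituting $t\phi$ for $\phi$, with $t$ a coordinate separating
  -- $u$ from $v$, and subtracting the relation times $u(t)$ removes the term of $u$. The term of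
  -- $v$ only acquires a cancellable factor.
  have key : ∀ S : Finset (W0 n), v ∉ S → ∃ r ∈ nonZeroDivisors (Mero n), ∃ g' : W0 n → Mero n,
      (∀ φ, ∑ w, g' w * act w φ = 0) ∧ (∀ w ∈ S, g' w = 0) ∧ g' v = g v * r := by
    intro S
    induction S using Finset.induction_on with
    | empty => exact fun _ => ⟨1, one_mem _, g, hg, by simp, by simp⟩
    | insert u S hu ih =>
      intro hv
      rw [Finset.mem_insert, not_or] at hv
      obtain ⟨r, hr, g', h1, h2, h3⟩ := ih hv.2
      obtain ⟨p, hp⟩ : ∃ p, pairAct v⁻¹ p ≠ pairAct u⁻¹ p := by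
        by_contra hcon
        push Not at hcon
        exact hv.1 (inv_injective (pairAct_injective hcon))
      refine ⟨r * (act v (wt p) - act u (wt p)), mul_mem hr ?_,
        fun w => g' w * (act w (wt p) - act u (wt p)), fun φ => ?_, fun w hw => ?_, ?_⟩
      · rw [act_wt, act_wt]
        exact wt_sub_mem hp
      · have e1 := h1 (wt p * φ)
        have e2 := congrArg (fun x => act u (wt p) * x) (h1 φ)
        simp only [Finset.mul_sum, mul_zero] at e2
        rw [← sub_eq_zero.2 (e1.trans e2.symm), ← Finset.sum_sub_distrib]
        refine Finset.sum_congr rfl fun w _ => ?_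
        rw [map_mul]
        ring
      · rcases Finset.mem_insert.1 hw with rfl | hw
        · simp
        · simp [h2 w hw]
      · simp only [h3, mul_assoc]
  obtain ⟨r, hr, g', h1, h2, h3⟩ := key (Finset.univ.erase v) (Finset.notMem_erase _ _)
  have h4 := h1 1
  rw [Finset.sum_eq_single v (fun w _ hw => by
    rw [h2 w (Finset.mem_erase.2 ⟨hw, Finset.mem_univ _⟩), zero_mul]) (by simp), map_one, mul_one,
    h3] at h4
  exact (mem_nonZeroDivisors_iff_right.1 hr) _ h4

end Coordinates

/-! ### The polynomial representation and the linear independence of the `T_w` -/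

section PolyRep

variable {n : ℕ} [NeZero n] (κ : Kappa)

theorem meroRefl_wt (i : Fin n) (p : Fin n × ℤˣ) :
    meroRefl 1 i.succ (wt p) = wt (pairAct (simple i) p) := by
  have := act_simple_mul i 1 (wt p)
  rw [mul_one, act_one, act_wt, simple_inv] at this
  exact this.symm

/-- The relation `(κ - c) t_{i+1}⁻¹ + (c - κ⁻¹) t_i⁻¹ = 0`. -/
theorem cMero_mid_relation (qh : ℂˣ) (u0 un : ℂˣ) {i j : Fin n} (hij : j.val = i.val + 1) :
    (algebraMap ℂ (Mero n) (κ.at i.succ : ℂ) - cMero qh κ u0 un i.succ) * wt (j, -1) +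
      (cMero qh κ u0 un i.succ - algebraMap ℂ (Mero n) (κ.at i.succ : ℂ)⁻¹) * wt (i, -1) = 0 := by
  have hin : i.val + 1 < n := hij ▸ j.isLt
  obtain rfl : j = ⟨i.val + 1, hin⟩ := Fin.ext hij
  have hne : i ≠ ⟨i.val + 1, hin⟩ := fun h => by
    have := congrArg Fin.val h
    simp at this
  have e : ∀ c : ℂ, algebraMap ℂ (Mero n) c = toMero n (algebraMap ℂ _ c) := fun c =>
    (AlgHom.commutes _ c).symm
  rw [e, e, cMero, wt, wt, ← map_sub, ← map_sub, ← map_mul, ← map_mul, ← map_add,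
    ← map_zero (toMero n)]
  refine mk_eq_of_generic ((generic_ne hne).mono fun t ht => ?_)
  change ((κ.at i.succ : ℂ) - cFun qh κ u0 un i.succ t) * weight t (_, -1) +
    (cFun qh κ u0 un i.succ t - (κ.at i.succ : ℂ)⁻¹) * weight t (i, -1) = 0
  rw [(weight_cases t _).2, (weight_cases t _).2, cFun_mid qh κ u0 un i hin, spectral_mid qh i hin,
    Units.val_div_eq_div_val]
  have hk := (κ.at i.succ).ne_zero
  have h1 := (t i).ne_zero
  have h2 := (t ⟨i.val + 1, hin⟩).ne_zero
  have h3 : (t ⟨i.val + 1, hin⟩ : ℂ) - t i ≠ 0 := sub_ne_zero.2 fun h => ht (Units.ext h.symm)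
  unfold cMid
  generalize (t ⟨i.val + 1, hin⟩ : ℂ) = b at *
  have h4 : 1 - (t i : ℂ) / b ≠ 0 := by
    rw [one_sub_div h2]
    exact div_ne_zero h3 h2
  field_simp
  ring

/-- The relation `(κ_n⁻¹ - c_n) t_n⁻¹ + (c_n - κ_n) t_n = κ_0 - κ_0⁻¹`. -/
theorem cMero_last_relation (qh : ℂˣ) {i : Fin n} (hi : ¬ i.val + 1 < n) :
    (algebraMap ℂ (Mero n) (κ.at i.succ : ℂ)⁻¹ - cMero qh κ 1 κ.zero i.succ) * wt (i, -1) +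
      (cMero qh κ 1 κ.zero i.succ - algebraMap ℂ (Mero n) (κ.at i.succ : ℂ)) * wt (i, 1) =
    algebraMap ℂ (Mero n) ((κ.zero : ℂ) - (κ.zero : ℂ)⁻¹) := by
  have e : ∀ c : ℂ, algebraMap ℂ (Mero n) c = toMero n (algebraMap ℂ _ c) := fun c =>
    (AlgHom.commutes _ c).symm
  rw [e, e, e, cMero, wt, wt, ← map_sub, ← map_sub, ← map_mul, ← map_mul, ← map_add]
  refine mk_eq_of_generic ((generic_sq i 1).mono fun t ht => ?_)
  change ((κ.at i.succ : ℂ)⁻¹ - cFun qh κ 1 κ.zero i.succ t) * weight t (_, -1) +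
    (cFun qh κ 1 κ.zero i.succ t - (κ.at i.succ : ℂ)) * weight t (i, 1) =
      (κ.zero : ℂ) - (κ.zero : ℂ)⁻¹
  rw [(weight_cases t _).2, (weight_cases t _).1, cFun_last qh κ _ _ i hi, spectral_last qh i hi]
  have hk := (κ.at i.succ).ne_zero
  have hk0 := κ.zero.ne_zero
  have h1 := (t i).ne_zero
  have h4 : 1 - (t i : ℂ) ^ 2 ≠ 0 := sub_ne_zero.2 ht.symm
  unfold cEnd
  field_simp
  ring

/-- The operator of multiplication by `t_i⁻¹`. -/
def wtUnit (i : Fin n) : (Module.End ℂ (Mero n))ˣ :=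
  ⟨LinearMap.mulLeft ℂ (wt (i, -1)), LinearMap.mulLeft ℂ (wt (i, 1)), by
    rw [Module.End.mul_eq_comp, ← LinearMap.mulLeft_mul, mul_comm, wt_mul, LinearMap.mulLeft_one]
    rfl, by
    rw [Module.End.mul_eq_comp, ← LinearMap.mulLeft_mul, wt_mul, LinearMap.mulLeft_one]
    rfl⟩

/-- By the Bernstein presentation it is enough to have $T_1,\dots,T_n$ and candidates for the $Y_i$,
here multiplication by $t_i^{-1}$. The conditions to check reduce to `cMero_mid_relation` and
`cMero_last_relation`. The choice $\upsilon_n=\kappa_0$ produces the parameter of $T_0$, whereas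
$q=1$ and $\upsilon_0=1$ play no role. The operator of $T_0$ is therefore $Y_1E_1^{-1}$, not a
Koornwinder reflection operator. -/
theorem exists_polyRep : ∃ ρ : Hecke n κ →ₐ[ℂ] Module.End ℂ (Mero n),
    (∀ i : Fin n, ρ (heckeT κ i.succ) = koornOp 1 κ 1 κ.zero i.succ) ∧
    ∀ p, ρ (heckeYs κ p) = LinearMap.mulLeft ℂ (wt (p.1, -p.2)) := by
  -- This representation is used only for the relations among $T_1,\dots,T_n$.
  set φ := varpi (n := n) 1 κ 1 κ.zero with hφ
  set X : Fin n → (Module.End ℂ (Mero n))ˣ :=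
    fun i => Units.map φ.toMonoidHom (heckeUnit κ i.succ) with hX
  have hXv : ∀ i, (X i : Module.End ℂ (Mero n)) = koornOp 1 κ 1 κ.zero i.succ := fun i =>
    varpi_heckeT 1 κ 1 κ.zero i.succ
  have hb := braidFamily_heckeUnit (n := n) κ
  have hx : BraidFamily X := by
    refine ⟨fun i j h => ?_, fun i j h hj => ?_, fun i j h hj => ?_⟩
    · simp only [hX, ← map_mul, hb.comm i j h]
    · simp only [hX, ← map_mul, hb.mid i j h hj]
    · simp only [hX, ← map_mul, hb.last i j h hj]
  obtain ⟨E, hE⟩ := exists_palFamily X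
  have hq : ∀ i : Fin n, QuadRel (κ.at i.succ : ℂ) (X i) := by
    intro i
    refine quadRel_of_mul_self ?_
    have := congrArg φ (heckeT_mul_self κ i.succ)
    rw [map_mul, map_add, map_smul, map_one] at this
    exact this
  have hC := fun i : Fin n => meroRefl_cMero (n := n) 1 κ 1 κ.zero i.succ
  have hkk : ∀ i : Fin n, algebraMap ℂ (Mero n) (κ.at i.succ : ℂ) *
      algebraMap ℂ (Mero n) (κ.at i.succ : ℂ)⁻¹ = 1 := fun i => by
    rw [← map_mul, mul_inv_cancel₀ (Units.ne_zero _), map_one]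
  have hy : YFamily X wtUnit := by
    refine ⟨fun i j hij => Units.ext (LinearMap.ext fun x => ?_), fun i hi =>
      Units.ext (LinearMap.ext fun x => ?_)⟩
    · rw [Units.val_mul, Units.val_mul, hXv, Module.End.mul_apply, Module.End.mul_apply]
      change wt (i, -1) * x = koornOp 1 κ 1 κ.zero i.succ
        (wt (j, -1) * koornOp 1 κ 1 κ.zero i.succ x)
      simp only [koornOp_apply, map_mul, map_add, map_sub, hC, meroRefl_wt, meroRefl_meroRefl,
        pairAct_mid i j hij, Equiv.swap_apply_right, Algebra.smul_def, AlgHom.commutes]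
      have h1 := cMero_mid_relation κ 1 1 κ.zero hij
      linear_combination (-wt (i, -1) * x) * hkk i + ((cMero 1 κ 1 κ.zero i.succ -
        algebraMap ℂ (Mero n) (κ.at i.succ : ℂ)) * x - cMero 1 κ 1 κ.zero i.succ * meroRefl 1 i.succ x) * h1
    · rw [Units.val_mul, Units.val_mul, hXv, Module.End.mul_apply, Module.End.mul_apply]
      change koornOp 1 κ 1 κ.zero i.succ (wt (0, -1) * x) =
        wt (0, -1) * koornOp 1 κ 1 κ.zero i.succ x
      have h0 : pairAct (simple i) ((0 : Fin n), -1) = (0, -1) := by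
        by_cases h : i.val + 1 < n
        · rw [pairAct_mid i ⟨i.val + 1, h⟩ rfl, Equiv.swap_apply_of_ne_of_ne hi.symm]
          intro h'
          have := congrArg Fin.val h'
          simp at this
        · rw [pairAct_last i h]
          simp [hi.symm]
      simp only [koornOp_apply, map_mul, meroRefl_wt, h0, Algebra.smul_def]
      ring
  have h0 : ∀ i : Fin n, ¬ i.val + 1 < n → QuadRel (κ.zero : ℂ) (wtUnit i * (X i)⁻¹) := by
    intro i hi
    refine quadRel_of_mul_self (LinearMap.ext fun x => ?_)
    rw [Units.val_mul, (hq i).inv_eq, hXv]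
    have hw : wt (i, 1) * wt (i, -1) = 1 := wt_mul (i, 1)
    have hz : ∀ x, ((wtUnit i : Module.End ℂ (Mero n)) * (koornOp 1 κ 1 κ.zero i.succ -
        ((κ.at i.succ : ℂ) - (κ.at i.succ : ℂ)⁻¹) • 1)) x = wt (i, -1) *
        ((algebraMap ℂ (Mero n) (κ.at i.succ : ℂ)⁻¹ - cMero 1 κ 1 κ.zero i.succ) * x +
          cMero 1 κ 1 κ.zero i.succ * meroRefl 1 i.succ x) := by
      intro x
      change wt (i, -1) * (koornOp 1 κ 1 κ.zero i.succ x -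
        ((κ.at i.succ : ℂ) - (κ.at i.succ : ℂ)⁻¹) • x) = _
      rw [koornOp_apply, Algebra.smul_def, Algebra.smul_def, map_sub]
      ring
    have hp : pairAct (simple i) (i, -1) = (i, 1) := by
      rw [pairAct_last i hi]
      simp
    rw [Module.End.mul_apply, LinearMap.add_apply, LinearMap.smul_apply, Module.End.one_apply, hz,
      hz, Algebra.smul_def, map_mul, map_add, map_mul, map_mul, map_sub, AlgHom.commutes, hC,
      meroRefl_wt, hp, meroRefl_meroRefl, ← cMero_last_relation κ 1 hi]
    linear_combination (algebraMap ℂ (Mero n) (κ.at i.succ : ℂ) *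
      algebraMap ℂ (Mero n) (κ.at i.succ : ℂ)⁻¹ * x) * hw + x * hkk i
  obtain ⟨ρ, h1, h2⟩ := exists_bernsteinLift (κ := κ) hx hE hy hq h0 (fun j _ => by
    refine Units.ext (LinearMap.ext fun x => ?_)
    change wt _ * (wt _ * x) = wt _ * (wt _ * x)
    ring)
  refine ⟨ρ, fun i => (h1 i).trans (hXv i), fun p => ?_⟩
  obtain ⟨j, e⟩ := p
  have h3 : ∀ k : ℤ, ρ ((heckeYUnit κ j ^ k : (Hecke n κ)ˣ) : Hecke n κ) =
      ((wtUnit j ^ k : (Module.End ℂ (Mero n))ˣ) : Module.End ℂ (Mero n)) := fun k => by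
    rw [← h2 j, ← map_zpow]
    rfl
  rw [heckeYs, h3]
  rcases Int.units_eq_one_or e with rfl | rfl
  · simp only [Units.val_one, zpow_one]
    rfl
  · simp only [Units.val_neg, Units.val_one, zpow_neg, zpow_one, neg_neg]
    rfl

variable {κ} {ρ : Hecke n κ →ₐ[ℂ] Module.End ℂ (Mero n)}

/-- The triangularity of the operators `T_w` with respect to the automorphisms in `W₀`. -/
theorem heckeTW_expansion (hρ : ∀ i : Fin n, ρ (heckeT κ i.succ) = koornOp 1 κ 1 κ.zero i.succ)
    (k : ℕ) : ∀ w : W0 n, len w = k → ∃ f : W0 n → Mero n, f w ∈ nonZeroDivisors (Mero n) ∧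
      (∀ v, len w ≤ len v → v ≠ w → f v = 0) ∧
      ∀ φ, ρ (heckeTW κ w) φ = ∑ v, f v * act v φ := by
  classical
  induction k with
  | zero =>
    intro w hw
    rw [eq_one_of_len hw]
    refine ⟨Pi.single 1 1, by simp, fun v _ hv => Pi.single_eq_of_ne hv _, fun φ => ?_⟩
    rw [heckeTW_one, map_one, Module.End.one_apply, Finset.sum_eq_single 1]
    · rw [Pi.single_eq_same, one_mul, act_one]
    · intro v _ hv
      rw [Pi.single_eq_of_ne hv, zero_mul]
    · simp
  | succ k ih =>
    intro w hw
    obtain ⟨i, w', rfl, hk, hlen⟩ := exists_left_descent hw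
    obtain ⟨f, hf1, hf2, hf3⟩ := ih w' hk
    have hss : ∀ v : W0 n, simple i * (simple i * v) = v := fun v => by
      rw [← mul_assoc, simple_mul_self, one_mul]
    -- The coefficients come from $T_i=(\kappa_i-c_i)+c_is_i$. The leading one is $c_i\cdot
    -- s_i(f_{w'})$, again not a zero divisor.
    refine ⟨fun v => (algebraMap ℂ _ (κ.at i.succ : ℂ) - cMero 1 κ 1 κ.zero i.succ) * f v +
      cMero 1 κ 1 κ.zero i.succ * meroRefl 1 i.succ (f (simple i * v)), ?_, ?_, ?_⟩
    · have : f (simple i * w') = 0 := hf2 _ (by omega) fun h => by rw [h] at hlen; omega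
      simp only [this, mul_zero, zero_add, hss]
      exact mul_mem (cMero_mem _ _ _ _ _) (nonZeroDivisors_map (meroRefl_meroRefl 1 i.succ) hf1)
    · intro v hv hne
      have h1 : f v = 0 := hf2 _ (by omega) fun h => by rw [h] at hv; omega
      have h2 : f (simple i * v) = 0 := by
        refine hf2 _ ?_ fun h => hne (by rw [← h, hss])
        rcases len_left_or i v with h | h <;> omega
      simp only [h1, h2, map_zero, mul_zero, add_zero]
    · intro φ
      have hs : ∑ v, cMero 1 κ 1 κ.zero i.succ * meroRefl 1 i.succ (f (simple i * v)) * act v φ =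
          ∑ v, cMero 1 κ 1 κ.zero i.succ * meroRefl 1 i.succ (f v) * act (simple i * v) φ := by
        rw [← Equiv.sum_comp (Equiv.mulLeft (simple i))]
        simp only [Equiv.coe_mulLeft, hss]
      rw [heckeTW_simple_mul κ hlen, map_mul, Module.End.mul_apply, hf3, hρ, koornOp_apply, map_sum]
      simp only [add_mul, Finset.sum_add_distrib]
      rw [hs, mul_sub, Algebra.smul_def, Finset.mul_sum, Finset.mul_sum, Finset.mul_sum]
      simp only [act_simple_mul, map_mul, mul_assoc, sub_mul, Finset.sum_sub_distrib]
      abel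

/-- The elements `T_w` are linearly independent over the functions of the `Y_i`. -/
theorem heckeTW_independent
    (hρ : ∀ i : Fin n, ρ (heckeT κ i.succ) = koornOp 1 κ 1 κ.zero i.succ)
    {p : W0 n → Mero n} (hp : ∀ φ, ∑ w, ρ (heckeTW κ w) (p w * φ) = 0) : p = 0 := by
  choose f hf1 hf2 hf3 using fun w => heckeTW_expansion hρ _ w rfl
  have key : ∀ v, ∑ w, f w v * act v (p w) = 0 := by
    refine fun v => act_independent (g := fun v => ∑ w, f w v * act v (p w)) (fun φ => ?_) v
    rw [← hp φ]
    simp only [hf3, map_mul, Finset.sum_mul]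
    rw [Finset.sum_comm]
    exact Finset.sum_congr rfl fun w _ => Finset.sum_congr rfl fun v _ => mul_assoc _ _ _
  classical
  by_contra hne
  obtain ⟨w0, hw0⟩ := Function.ne_iff.1 hne
  -- For $w$ of greatest length with nonzero coefficient, triangularity leaves only the summand of
  -- $T_w$ in the coefficient of the automorphism $w$.
  obtain ⟨w, hw, hmax⟩ := Finset.exists_max_image (Finset.univ.filter fun w => p w ≠ 0) len
    ⟨w0, by simpa using hw0⟩
  simp only [Finset.mem_filter, Finset.mem_univ, true_and] at hw hmax
  have h1 := key w
  rw [Finset.sum_eq_single w (fun u _ hu => by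
    by_cases h : p u = 0
    · rw [h, map_zero, mul_zero]
    · rw [hf2 u w (hmax u h) hu.symm, zero_mul]) (by simp), mul_comm] at h1
  have h2 := mem_nonZeroDivisors_iff_right.1 (hf1 w) _ h1
  apply hw
  rw [← act_inv_act w (p w), h2, map_zero]

end PolyRep

/-! ### The basis of the principal series modules -/

section Coefficients

instance (n : ℕ) : AddCommGroup (regFun n) := (Subalgebra.toCommRing (regFun n)).toAddCommGroup

variable {n : ℕ} [NeZero n] (κ : Kappa)

/-- The coefficients of an element of the affine Hecke algebra with respect to the `T_w`, with
the `Y_i`, on the right, evaluated at `γ`. -/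
theorem exists_coefficients (γ : Torus n) : ∃ L : Hecke n κ →ₗ[ℂ] (W0 n → ℂ),
    (∀ w, L (heckeTW κ w) = Pi.single w 1) ∧
    ∀ h j, L (h * heckeY κ j) = (γ j : ℂ) • L h := by
  classical
  obtain ⟨ρ, hT, hY⟩ := exists_polyRep (n := n) κ
  -- Operators of the form $\sum_wT_w\circ p_w$ with continuous $p_w$. Injectivity of this
  -- parametrisation is `heckeTW_independent`; its image contains every Hecke operator by
  -- `mem_span_heckeTW`.
  let Φ : (W0 n → regFun n) → Module.End ℂ (Mero n) := fun p =>
    ∑ w, ρ (heckeTW κ w) * LinearMap.mulLeft ℂ (toMero n (p w).1)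
  have hΦ : ∀ p φ, Φ p φ = ∑ w, ρ (heckeTW κ w) (toMero n (p w).1 * φ) := fun p φ => by
    simp only [Φ, LinearMap.sum_apply, Module.End.mul_apply, LinearMap.mulLeft_apply]
  have hinj : ∀ p q, Φ p = Φ q → p = q := by
    intro p q hpq
    have h0 : (fun w => toMero n (p w - q w).1) = 0 := by
      refine heckeTW_independent hT fun φ => ?_
      have := sub_eq_zero.2 (congrArg (fun A => A φ) hpq)
      simp only [hΦ] at this
      rw [← Finset.sum_sub_distrib] at this
      rw [← this]
      refine Finset.sum_congr rfl fun w _ => ?_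
      rw [← map_sub, ← sub_mul, ← map_sub]
      rfl
    funext w
    have h1 := eq_zero_of_toMero_eq_zero (p w - q w).2 (congrFun h0 w)
    exact sub_eq_zero.1 (Subtype.ext h1)
  have hsurj : ∀ h, ∃ p, Φ p = ρ h := by
    intro h
    -- Functions act by multiplication on the right, which commutes with left multiplication by
    -- Hecke operators. In this module the identity operator is an eigenvector of every
    -- $Y_i^{\pm1}$.
    let _ : Module (regFun n) (Module.End ℂ (Mero n)) :=
      { smul := fun p A => A * LinearMap.mulLeft ℂ (toMero n p.1)
        one_smul := fun A => by
          change A * LinearMap.mulLeft ℂ (toMero n 1) = A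
          rw [map_one, LinearMap.mulLeft_one]
          rfl
        mul_smul := fun p q A => by
          change A * LinearMap.mulLeft ℂ (toMero n (p.1 * q.1)) =
            A * LinearMap.mulLeft ℂ (toMero n q.1) * LinearMap.mulLeft ℂ (toMero n p.1)
          rw [mul_comm p.1, map_mul, LinearMap.mulLeft_mul, mul_assoc]
          rfl
        smul_zero := fun p => zero_mul _
        smul_add := fun p A B => add_mul _ _ _
        add_smul := fun p q A => by
          change A * LinearMap.mulLeft ℂ (toMero n (p.1 + q.1)) = A * LinearMap.mulLeft ℂ
            (toMero n p.1) + A * LinearMap.mulLeft ℂ (toMero n q.1)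
          rw [← mul_add]
          congr 1
          refine LinearMap.ext fun x => ?_
          change toMero n (p.1 + q.1) * x = toMero n p.1 * x + toMero n q.1 * x
          rw [map_add, add_mul]
        zero_smul := fun A => by
          change A * LinearMap.mulLeft ℂ (toMero n 0) = 0
          rw [map_zero, LinearMap.mulLeft_zero_eq_zero, mul_zero] }
    have : IsScalarTower ℂ (regFun n) (Module.End ℂ (Mero n)) := ⟨fun c p A => by
      change A * LinearMap.mulLeft ℂ (toMero n (c • p.1)) =
        c • (A * LinearMap.mulLeft ℂ (toMero n p.1))
      rw [← mul_smul_comm]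
      congr 1
      refine LinearMap.ext fun x => ?_
      change toMero n (c • p.1) * x = c • (toMero n p.1 * x)
      rw [map_smul, smul_mul_assoc]⟩
    have h1 := mem_span_heckeTW κ (O := regFun n) (ρ := (Algebra.lmul ℂ _).comp ρ)
      (fun h p A => (mul_assoc (ρ h) A _).symm) (v := 1) (g := fun p => wtFun (p.1, -p.2))
      (fun p => by
        change ρ (heckeYs κ p) * 1 = 1 * LinearMap.mulLeft ℂ (toMero n (wtFun (p.1, -p.2)).1)
        rw [hY, mul_one, one_mul]
        rfl) h
    obtain ⟨c, hc⟩ := (Submodule.mem_span_range_iff_exists_fun _).1 h1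
    refine ⟨c, ?_⟩
    change _ = ρ h * 1 at hc
    rw [mul_one] at hc
    rw [← hc]
    refine Finset.sum_congr rfl fun w _ => ?_
    change _ = ρ (heckeTW κ w) * 1 * LinearMap.mulLeft ℂ (toMero n (c w).1)
    rw [mul_one]
  choose P hP using hsurj
  -- The evaluation point is $\gamma^{-1}$ because $Y_j$ multiplies by $t_j^{-1}$, which then takes
  -- the value $\gamma_j$.
  refine ⟨{ toFun := fun h w => (P h w).1.1 γ⁻¹, map_add' := fun a b => ?_,
            map_smul' := fun c a => ?_ }, fun w => ?_, fun h j => ?_⟩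
  · have : P (a + b) = P a + P b := by
      refine hinj _ _ (LinearMap.ext fun φ => ?_)
      rw [hP, map_add, ← hP a, ← hP b, LinearMap.add_apply, hΦ, hΦ, hΦ, ← Finset.sum_add_distrib]
      refine Finset.sum_congr rfl fun w _ => ?_
      rw [← map_add, ← add_mul, ← map_add]
      rfl
    rw [this]
    rfl
  · have : P (c • a) = c • P a := by
      refine hinj _ _ (LinearMap.ext fun φ => ?_)
      rw [hP, map_smul, ← hP a, LinearMap.smul_apply, hΦ, hΦ, Finset.smul_sum]
      refine Finset.sum_congr rfl fun w _ => ?_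
      rw [← map_smul, ← smul_mul_assoc, ← map_smul]
      rfl
    rw [this]
    rfl
  · have : P (heckeTW κ w) = Pi.single w 1 := by
      refine hinj _ _ (LinearMap.ext fun φ => ?_)
      rw [hP, hΦ, Finset.sum_eq_single w]
      · rw [Pi.single_eq_same]
        change _ = ρ (heckeTW κ w) (toMero n 1 * φ)
        rw [map_one, one_mul]
      · intro v _ hv
        rw [Pi.single_eq_of_ne hv]
        change ρ (heckeTW κ v) (toMero n 0 * φ) = 0
        rw [map_zero, zero_mul, map_zero]
      · simp
    funext v
    change (P (heckeTW κ w) v).1.1 γ⁻¹ = _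
    rw [this]
    by_cases hv : v = w
    · rw [hv, Pi.single_eq_same, Pi.single_eq_same]
      rfl
    · rw [Pi.single_eq_of_ne hv, Pi.single_eq_of_ne hv]
      rfl
  · have : P (h * heckeY κ j) = fun w => P h w * wtFun (j, -1) := by
      refine hinj _ _ (LinearMap.ext fun φ => ?_)
      have e : heckeY κ j = heckeYs κ (j, 1) := by
        rw [heckeYs, ← heckeYUnit_val]
        simp
      rw [hP, map_mul, Module.End.mul_apply, e, hY, ← hP h, hΦ, hΦ]
      refine Finset.sum_congr rfl fun w _ => ?_
      rw [LinearMap.mulLeft_apply, ← mul_assoc]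
      change _ = ρ (heckeTW κ w) (toMero n ((P h w).1 * (wtFun (j, -1)).1) * φ)
      rw [map_mul (toMero n)]
      rfl
    funext w
    change (P (h * heckeY κ j) w).1.1 γ⁻¹ = (γ j : ℂ) * (P h w).1.1 γ⁻¹
    rw [this]
    change (P h w).1.1 γ⁻¹ * weight γ⁻¹ (j, -1) = _
    rw [(weight_cases _ _).2, Pi.inv_apply, Units.val_inv_eq_inv_val, inv_inv, mul_comm]

end Coefficients

/-! ### Coordinate functionals on the Hecke algebra and the vectors $v_d$. -/

section Basis

variable {n : ℕ} [NeZero n] (κ : Kappa) (I : Set (Fin n)) (γ : Torus n)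

omit [NeZero n] in
theorem braidFamily_at : BraidFamily fun i : Fin n => (κ.at i.succ : ℂ) where
  comm _ _ _ := mul_comm _ _
  mid i j h hj := by rw [at_mid κ i (by omega), at_mid κ j hj]
  last _ _ _ _ := by ring

open Classical in
/-- The coefficient of `v_d` in `v_y`. -/
def chiRep (d y : W0 n) : ℂ :=
  if d⁻¹ * y ∈ parabolic I then braidProd (fun i : Fin n => (κ.at i.succ : ℂ)) (d⁻¹ * y) else 0

variable {I}

omit [NeZero n] in
-- Right multiplication by $s_i\in W_{0,I}$ stays in the coset $dW_{0,I}$. This is the compatibility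
-- needed for a functional with these values to vanish on $T_y(T_i-\kappa_i)$.
theorem chiRep_mul_simple {d : W0 n} (hd : d ∈ minReps I) {i : Fin n} (hi : i ∈ I) {y : W0 n}
    (h : len (y * simple i) = len y + 1) :
    chiRep κ I d (y * simple i) = κ.at i.succ * chiRep κ I d y := by
  have hs := simple_mem_parabolic hi
  have e : d⁻¹ * (y * simple i) = d⁻¹ * y * simple i := (mul_assoc _ _ _).symm
  unfold chiRep
  rw [e]
  by_cases hv : d⁻¹ * y ∈ parabolic I
  · rw [if_pos hv, if_pos (mul_mem hv hs), braidProd_mul_simple (braidFamily_at κ), mul_comm]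
    have h1 := hd _ hv
    have h2 := hd _ (mul_mem hv hs)
    rw [← mul_assoc, mul_inv_cancel_left] at h2
    rw [mul_inv_cancel_left] at h1
    omega
  · rw [if_neg hv, if_neg, mul_zero]
    intro h'
    exact hv ((Subgroup.mul_mem_cancel_right _ hs).1 h')

omit [NeZero n] in
theorem chiRep_self (d : W0 n) : chiRep κ I d d = 1 := by
  unfold chiRep
  rw [inv_mul_cancel, if_pos (one_mem _), braidProd_one (braidFamily_at κ)]

omit [NeZero n] in
theorem chiRep_ne {d d' : W0 n} (hd : d ∈ minReps I) (hd' : d' ∈ minReps I) (h : d ≠ d') :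
    chiRep κ I d d' = 0 := by
  unfold chiRep
  rw [if_neg fun h' => h (minReps_unique hd hd' h')]

variable (I)

/-- The generator `1 ⊗ 1` of the principal series module. -/
def genVec : PrincipalSeries κ I γ := (charIdeal κ I γ).mkQ 1

omit [NeZero n] in
theorem smul_genVec (h : Hecke n κ) :
    h • genVec κ I γ = (show PrincipalSeries κ I γ from (charIdeal κ I γ).mkQ h) := by
  refine ((charIdeal κ I γ).mkQ.map_smul h 1).symm.trans ?_
  rw [smul_eq_mul, mul_one]

omit [NeZero n] in
theorem smul_genVec_eq_zero {h : Hecke n κ} : h • genVec κ I γ = 0 ↔ h ∈ charIdeal κ I γ := by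
  rw [smul_genVec]
  exact Submodule.Quotient.mk_eq_zero _

omit [NeZero n] in
theorem exists_smul_genVec (x : PrincipalSeries κ I γ) : ∃ h : Hecke n κ, x = h • genVec κ I γ := by
  obtain ⟨h, rfl⟩ := (charIdeal κ I γ).mkQ_surjective x
  exact ⟨h, (smul_genVec κ I γ h).symm⟩

omit [NeZero n] in
theorem vvec_eq (w : W0 n) : vvec κ I γ w = heckeTW κ w • genVec κ I γ := rfl

omit [NeZero n] in
theorem algebraMap_smul_genVec (c : ℂ) (x : PrincipalSeries κ I γ) :
    (algebraMap ℂ (Hecke n κ) c) • x = c • x := algebraMap_smul _ c x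

omit [NeZero n] in
theorem heckeY_genVec (j : Fin n) : heckeY κ j • genVec κ I γ = (γ j : ℂ) • genVec κ I γ := by
  rw [← sub_eq_zero, ← algebraMap_smul_genVec, ← sub_smul, smul_genVec_eq_zero]
  exact Submodule.subset_span (Or.inr ⟨j, rfl⟩)

omit [NeZero n] in
variable {I} in
theorem heckeT_genVec {i : Fin n} (hi : i ∈ I) :
    heckeT κ i.succ • genVec κ I γ = (κ.at i.succ : ℂ) • genVec κ I γ := by
  rw [← sub_eq_zero, ← algebraMap_smul_genVec, ← sub_smul, smul_genVec_eq_zero]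
  exact Submodule.subset_span (Or.inl ⟨i, hi, rfl⟩)

/-- The representation map of the principal series module. -/
def psRep : Hecke n κ →ₐ[ℂ] Module.End ℂ (PrincipalSeries κ I γ) :=
  Algebra.lsmul ℂ ℂ (PrincipalSeries κ I γ)

omit [NeZero n] in
theorem psRep_apply (h : Hecke n κ) (x : PrincipalSeries κ I γ) : psRep κ I γ h x = h • x := rfl

variable {I γ}

omit [NeZero n] in
theorem heckeTW_genVec {v : W0 n} (hv : v ∈ parabolic I) : heckeTW κ v • genVec κ I γ =
    braidProd (fun i : Fin n => (κ.at i.succ : ℂ)) v • genVec κ I γ := by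
  have hb := braidFamily_at (n := n) κ
  refine parabolic_induction (P := fun v => heckeTW κ v • genVec κ I γ =
    braidProd (fun i : Fin n => (κ.at i.succ : ℂ)) v • genVec κ I γ) ?_ ?_ hv
  · rw [heckeTW_one, braidProd_one hb, one_smul, one_smul]
  · intro v _ i hi h
    rcases len_right_or v i with hl | hl
    · rw [heckeTW_mul_simple κ hl, braidProd_mul_simple hb hl, mul_smul, heckeT_genVec κ γ hi,
        smul_comm, h, smul_smul, mul_comm]
    · have e : v * simple i * simple i = v := by rw [mul_assoc, simple_mul_self, mul_one]
      have h1 := heckeTW_mul_simple κ (w := v * simple i) (i := i) (by rw [e, hl])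
      have h2 := braidProd_mul_simple hb (w := v * simple i) (i := i) (by rw [e, hl])
      rw [e] at h1 h2
      rw [h1, h2, mul_smul, heckeT_genVec κ γ hi, smul_comm, mul_comm, mul_smul] at h
      have h3 := congrArg (fun x => (κ.at i.succ : ℂ)⁻¹ • x) h
      simpa only [smul_smul, inv_mul_cancel_left₀ (κ.at i.succ).ne_zero,
        inv_mul_cancel₀ (κ.at i.succ).ne_zero, one_smul] using h3

/-- The functional is the combination of the coefficient functionals of $T_y$ at $\gamma$ with
weights `chiRep`, so it kills the left ideal of the $Y_j-\gamma_j$. For $T_w(T_i-\kappa_i)$ it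
vanishes by the choice of weights. An arbitrary left factor reduces to the $T_w$, since
$(T_i-\kappa_i)\otimes 1$ is a $Y$-eigenvector in the module with $I=\emptyset$. -/
theorem exists_functional (hγ : γ ∈ torusI κ I) {d : W0 n} (hd : d ∈ minReps I) :
    ∃ e : Hecke n κ →ₗ[ℂ] ℂ, (∀ y, e (heckeTW κ y) = chiRep κ I d y) ∧
      ∀ x ∈ charIdeal κ I γ, e x = 0 := by
  classical
  obtain ⟨L, hLT, hLY⟩ := exists_coefficients κ γ
  let e : Hecke n κ →ₗ[ℂ] ℂ := ∑ y, chiRep κ I d y • (LinearMap.proj y ∘ₗ L)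
  have he : ∀ h, e h = ∑ y, chiRep κ I d y * L h y := fun h => by
    simp only [e, LinearMap.sum_apply, LinearMap.smul_apply, LinearMap.comp_apply,
      LinearMap.proj_apply, smul_eq_mul]
  have heT : ∀ y, e (heckeTW κ y) = chiRep κ I d y := by
    intro y
    rw [he, hLT, Finset.sum_eq_single y]
    · rw [Pi.single_eq_same, mul_one]
    · intro v _ hv
      rw [Pi.single_eq_of_ne hv, mul_zero]
    · simp
  have heY : ∀ a j, e (a * (heckeY κ j - algebraMap ℂ _ (γ j : ℂ))) = 0 := by
    intro a j
    rw [mul_sub, map_sub, he, he, hLY, ← Algebra.commutes, ← Algebra.smul_def, map_smul, sub_self]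
  have hspan : ∀ (J : Set (Fin n)), (∀ i ∈ J, ∀ a, e (a * (heckeT κ i.succ -
      algebraMap ℂ _ (κ.at i.succ : ℂ))) = 0) → ∀ x ∈ charIdeal κ J γ, e x = 0 := by
    intro J hJ x hx
    suffices h : ∀ a, e (a * x) = 0 by simpa using h 1
    refine Submodule.span_induction (p := fun x _ => ∀ a, e (a * x) = 0) ?_ ?_ ?_ ?_ hx
    · rintro _ (⟨i, hi, rfl⟩ | ⟨j, rfl⟩) a
      · exact hJ i hi a
      · exact heY a j
    · intro a
      rw [mul_zero, map_zero]
    · intro x y _ _ hx hy a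
      rw [mul_add, map_add, hx, hy, add_zero]
    · intro b x _ hx a
      rw [smul_eq_mul, ← mul_assoc, hx]
  refine ⟨e, heT, hspan I fun i hi a => ?_⟩
  set t : Hecke n κ := heckeT κ i.succ - algebraMap ℂ _ (κ.at i.succ : ℂ) with ht
  have hup : ∀ y, len (y * simple i) = len y + 1 → e (heckeTW κ y * t) = 0 := by
    intro y hy
    rw [ht, mul_sub, map_sub, ← heckeTW_mul_simple κ hy, heT, ← Algebra.commutes,
      ← Algebra.smul_def, map_smul, heT, chiRep_mul_simple κ hd hi hy, smul_eq_mul, sub_self]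
  have hTw : ∀ y, e (heckeTW κ y * t) = 0 := by
    intro y
    rcases len_right_or y i with hl | hl
    · exact hup y hl
    -- At a right descent, $T_y=T_{ys_i}T_i$ and $T_i(T_i-\kappa_i)=-\kappa_i^{-1}(T_i-\kappa_i)$,
    -- so the ascent case applies.
    · have ey : y * simple i * simple i = y := by rw [mul_assoc, simple_mul_self, mul_one]
      have hl' : len (y * simple i * simple i) = len (y * simple i) + 1 := by rw [ey, hl]
      have h1 := heckeTW_mul_simple κ hl'
      rw [ey] at h1
      have h2 : heckeT κ i.succ * t = (-(κ.at i.succ : ℂ)⁻¹) • t := by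
        rw [ht, Algebra.algebraMap_eq_smul_one, mul_sub, heckeT_mul_self, mul_smul_comm, mul_one,
          smul_sub, smul_smul, neg_mul, inv_mul_cancel₀ (Units.ne_zero _)]
        module
      rw [h1, mul_assoc, h2, mul_smul_comm, map_smul, hup _ hl', smul_zero]
  have hu : t • genVec κ ∅ γ = psRep κ ∅ γ (heckeT κ i.succ) (genVec κ ∅ γ) -
      (κ.at i.succ : ℂ) • genVec κ ∅ γ := by
    rw [ht, sub_smul, algebraMap_smul_genVec, psRep_apply]
  have hE := heckeT_sub_eigen κ (ρ := psRep κ ∅ γ) (v := genVec κ ∅ γ)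
    (fun j => heckeY_genVec κ ∅ γ j) hγ hi
  rw [← hu] at hE
  have hmem := mem_span_heckeTW κ (O := ℂ) (ρ := psRep κ ∅ γ)
    (fun h c m => map_smul (psRep κ ∅ γ h) c m) (heckeYs_eigen κ hE) a
  obtain ⟨c, hc⟩ := (Submodule.mem_span_range_iff_exists_fun _).1 hmem
  -- Modulo the left ideal generated by the $Y_j-\gamma_j$ alone, $a(T_i-\kappa_i)$ is a combination
  -- of the $T_w(T_i-\kappa_i)$.
  have h0 : (a - ∑ w, c w • heckeTW κ w) * t ∈ charIdeal κ ∅ γ := by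
    rw [← smul_genVec_eq_zero, mul_smul, sub_smul, Finset.sum_smul, sub_eq_zero, ← psRep_apply,
      ← hc]
    exact Finset.sum_congr rfl fun w _ => (smul_assoc (c w) (heckeTW κ w) _).symm
  have h1 := hspan ∅ (fun i hi => absurd hi (Set.notMem_empty i)) _ h0
  rw [sub_mul, map_sub, sub_eq_zero, Finset.sum_mul, map_sum] at h1
  rw [h1]
  refine Finset.sum_eq_zero fun w _ => ?_
  rw [smul_mul_assoc, map_smul, hTw, smul_zero]

/-- The vectors `v_d`, for `d ∈ W_0^I`, form a basis of the principal series module. -/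
theorem exists_basis (hγ : γ ∈ torusI κ I) :
    ∃ b : Module.Basis (minReps I) ℂ (PrincipalSeries κ I γ), ∀ d, b d = vvec κ I γ d := by
  classical
  have hli : LinearIndependent ℂ fun d : minReps I => vvec κ I γ d := by
    rw [Fintype.linearIndependent_iff]
    intro c hc d
    have h0 : (∑ d : minReps I, c d • heckeTW κ (d : W0 n)) ∈ charIdeal κ I γ := by
      rw [← smul_genVec_eq_zero, Finset.sum_smul, ← hc]
      exact Finset.sum_congr rfl fun w _ => smul_assoc _ _ _
    obtain ⟨e, h1, h2⟩ := exists_functional κ hγ d.2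
    have h3 := h2 _ h0
    rw [map_sum, Finset.sum_eq_single d] at h3
    · rwa [map_smul, h1, chiRep_self, smul_eq_mul, mul_one] at h3
    · intro d' _ hne
      rw [map_smul, h1, chiRep_ne κ d.2 d'.2 fun h => hne (Subtype.ext h.symm), smul_zero]
    · simp
  refine ⟨Module.Basis.mk hli ?_, fun d => by rw [Module.Basis.mk_apply]⟩
  intro x _
  obtain ⟨h, rfl⟩ := exists_smul_genVec κ I γ x
  have hmem := mem_span_heckeTW κ (O := ℂ) (ρ := psRep κ I γ)
    (fun h c m => map_smul (psRep κ I γ h) c m)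
    (heckeYs_eigen κ (v := genVec κ I γ) (γ := γ) (heckeY_genVec κ I γ)) h
  refine Submodule.span_le.2 ?_ hmem
  rintro _ ⟨w, rfl⟩
  obtain ⟨d, hd, v, hv, rfl⟩ := exists_minReps_mul (I := I) w
  change heckeTW κ (d * v) • genVec κ I γ ∈ _
  rw [heckeTW_mul κ (hd v hv), mul_smul, heckeTW_genVec κ hv, smul_comm]
  exact Submodule.smul_mem _ _ (Submodule.subset_span ⟨⟨d, hd⟩, rfl⟩)

end Basis

/-! ### The invariant solutions of the reflection quantum KZ equations -/

/-- Write $C_{s_j}=A\,T_j^{-1}+B$. These are the constant term and the $T_j^{-1}$-term of the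
identity $(T_j^{-1}+c_j-\kappa_j^{-1})\,C_{s_j}=c_j$, where $c_j$ has the inverted parameters. -/
theorem bax_mid_relations {k x : ℂ} (hk : k ≠ 0) (h1 : x ≠ 1) (hb : k⁻¹ * (1 - k ^ 2 * x) ≠ 0) :
    (cMid k⁻¹ x - k⁻¹) * (0 / (k⁻¹ * (1 - k ^ 2 * x)) - (k - k⁻¹) * (x / (k⁻¹ * (1 - k ^ 2 * x)))) +
      (1 / (k⁻¹ * (1 - k ^ 2 * x)) - x / (k⁻¹ * (1 - k ^ 2 * x))) = cMid k⁻¹ x ∧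
    (cMid k⁻¹ x - k) * (1 / (k⁻¹ * (1 - k ^ 2 * x)) - x / (k⁻¹ * (1 - k ^ 2 * x))) +
      (0 / (k⁻¹ * (1 - k ^ 2 * x)) - (k - k⁻¹) * (x / (k⁻¹ * (1 - k ^ 2 * x)))) = 0 := by
  have h2 : 1 - x ≠ 0 := sub_ne_zero.2 h1.symm
  have h3 : 1 - k ^ 2 * x ≠ 0 := right_ne_zero_of_mul hb
  unfold cMid
  constructor <;> field_simp <;> ring

theorem bax_end_relations {k u x : ℂ} (hk : k ≠ 0) (hu : u ≠ 0) (h1 : x ^ 2 ≠ 1)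
    (hb : k⁻¹ * ((1 - k * u * x) * (1 + k * u⁻¹ * x)) ≠ 0) :
    (cEnd k⁻¹ u⁻¹ x - k⁻¹) * ((u⁻¹ - u) * x / (k⁻¹ * ((1 - k * u * x) * (1 + k * u⁻¹ * x))) -
      (k - k⁻¹) * (x ^ 2 / (k⁻¹ * ((1 - k * u * x) * (1 + k * u⁻¹ * x))))) +
      (1 / (k⁻¹ * ((1 - k * u * x) * (1 + k * u⁻¹ * x))) -
        x ^ 2 / (k⁻¹ * ((1 - k * u * x) * (1 + k * u⁻¹ * x)))) = cEnd k⁻¹ u⁻¹ x ∧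
    (cEnd k⁻¹ u⁻¹ x - k) * (1 / (k⁻¹ * ((1 - k * u * x) * (1 + k * u⁻¹ * x))) -
      x ^ 2 / (k⁻¹ * ((1 - k * u * x) * (1 + k * u⁻¹ * x)))) +
      ((u⁻¹ - u) * x / (k⁻¹ * ((1 - k * u * x) * (1 + k * u⁻¹ * x))) -
      (k - k⁻¹) * (x ^ 2 / (k⁻¹ * ((1 - k * u * x) * (1 + k * u⁻¹ * x))))) = 0 := by
  have h2 : 1 - x ^ 2 ≠ 0 := sub_ne_zero.2 h1.symm
  have h3 : 1 - k * u * x ≠ 0 := left_ne_zero_of_mul (right_ne_zero_of_mul hb)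
  have h4 : 1 + k * u⁻¹ * x ≠ 0 := right_ne_zero_of_mul (right_ne_zero_of_mul hb)
  have h5 : u + k * x ≠ 0 := by
    intro h
    apply h4
    field_simp
    rw [h, mul_zero]
  have e : 1 + k * u⁻¹ * x = (u + k * x) / u := by field_simp
  rw [e]
  unfold cEnd
  constructor <;> field_simp <;> ring

/-! ### The identity between $C_{s_j}$ and $c_j$, for all $j$. -/

section Relations

variable {n : ℕ} [NeZero n] (qh : ℂˣ) (κ : Kappa) (u0 un : ℂˣ)

theorem bax_relations (j : Fin (n + 1)) {t : Torus n} (h1 : (spectral qh j t : ℂ) ≠ 1)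
    (h2 : (spectral qh j t : ℂ) ^ 2 ≠ 1) (hb : baxDen κ u0 un j (spectral qh j t) ≠ 0) :
    (cFun qh κ⁻¹ u0⁻¹ un⁻¹ j t - (κ.at j : ℂ)⁻¹) *
      (baxId u0 un j (spectral qh j t) / baxDen κ u0 un j (spectral qh j t) -
        ((κ.at j : ℂ) - (κ.at j : ℂ)⁻¹) *
          (baxT j (spectral qh j t) / baxDen κ u0 un j (spectral qh j t))) +
      (1 / baxDen κ u0 un j (spectral qh j t) -
        baxT j (spectral qh j t) / baxDen κ u0 un j (spectral qh j t)) =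
        cFun qh κ⁻¹ u0⁻¹ un⁻¹ j t ∧
    (cFun qh κ⁻¹ u0⁻¹ un⁻¹ j t - (κ.at j : ℂ)) * (1 / baxDen κ u0 un j (spectral qh j t) -
        baxT j (spectral qh j t) / baxDen κ u0 un j (spectral qh j t)) +
      (baxId u0 un j (spectral qh j t) / baxDen κ u0 un j (spectral qh j t) -
        ((κ.at j : ℂ) - (κ.at j : ℂ)⁻¹) *
          (baxT j (spectral qh j t) / baxDen κ u0 un j (spectral qh j t))) = 0 := by
  revert h1 h2 hb
  refine Fin.cases ?_ (fun i => ?_) j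
  · intro h1 h2 hb
    have h0 : ((0 : Fin (n + 1)) : ℕ) = 0 := rfl
    unfold baxDen at *
    simp only [cFun, baxId, baxT, h0, if_true, at_zero] at *
    have := bax_end_relations κ.zero.ne_zero u0.ne_zero h2 hb
    rw [← Units.val_inv_eq_inv_val κ.zero, ← Units.val_inv_eq_inv_val u0] at this
    rw [← Units.val_inv_eq_inv_val κ.zero, ← Units.val_inv_eq_inv_val u0]
    exact this
  · intro h1 h2 hb
    have h0 : (i.succ : ℕ) ≠ 0 := by simp
    unfold baxDen at *
    by_cases h : i.val + 1 < n
    · have h' : (i.succ : ℕ) < n := h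
      simp only [cFun, baxId, baxT, if_neg h0, if_pos h', at_mid κ i h] at *
      have := bax_mid_relations κ.mid.ne_zero h1 hb
      rw [← Units.val_inv_eq_inv_val] at this
      rw [← Units.val_inv_eq_inv_val]
      exact this
    · have h' : ¬ (i.succ : ℕ) < n := h
      simp only [cFun, baxId, baxT, if_neg h0, if_neg h', at_last κ i h] at *
      have := bax_end_relations κ.last.ne_zero un.ne_zero h2 hb
      rw [← Units.val_inv_eq_inv_val κ.last, ← Units.val_inv_eq_inv_val un] at this
      rw [← Units.val_inv_eq_inv_val κ.last, ← Units.val_inv_eq_inv_val un]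
      exact this

theorem generic_baxDen (j : Fin (n + 1)) :
    Generic fun t : Torus n => baxDen κ u0 un j (spectral qh j t) ≠ 0 := by
  obtain ⟨X, hX, hX'⟩ := spectral_extends (n := n) qh j
  obtain ⟨k, e, he, hk⟩ := spectral_scale (n := n) qh j
  obtain ⟨D, hD0, hD⟩ := exists_baxDen κ u0 un j
  simpa only [hD] using generic_poly _ X hX hX' k e he hk D hD0

end Relations

/-! ### Invariance under $\nabla(s_j)$ as an equation between Hecke operators. -/

section KZ

variable {n : ℕ} [NeZero n] (qh : ℂˣ) (κ : Kappa) (u0 un : ℂˣ)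
  {V : Type*} [AddCommGroup V] [Module ℂ V] [Module (Hecke n κ) V] [IsScalarTower ℂ (Hecke n κ) V]

variable (V) in
/-- The operator `a ⊗ T_j⁻¹ + b ⊗ 1` on `M(T) ⊗ V`. -/
def pairOp (j : Fin (n + 1)) (a b : Mero n) : Module.End ℂ (Mero n ⊗[ℂ] V) :=
  TensorProduct.map (LinearMap.mulLeft ℂ a) (Algebra.lsmul ℂ ℂ V (heckeTinv κ j)) +
    TensorProduct.map (LinearMap.mulLeft ℂ b) LinearMap.id

omit [NeZero n] in
theorem pairOp_tmul (j : Fin (n + 1)) (a b g : Mero n) (v : V) :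
    pairOp κ V j a b (g ⊗ₜ v) = (a * g) ⊗ₜ (heckeTinv κ j • v) + (b * g) ⊗ₜ v := rfl

omit [NeZero n] in
theorem heckeTinv_mul_self (j : Fin (n + 1)) : heckeTinv κ j * heckeTinv κ j =
    1 - ((κ.at j : ℂ) - (κ.at j : ℂ)⁻¹) • heckeTinv κ j := by
  conv_lhs => enter [1]; rw [heckeTinv_eq]
  rw [sub_mul, heckeT_mul_heckeTinv, smul_mul_assoc, one_mul]

omit [NeZero n] in
-- These operators multiply as in the commutative algebra over $\mathcal M(T)$ generated by
-- $T_j^{-1}$ with $T_j^{-2}=1-(\kappa_j-\kappa_j^{-1})T_j^{-1}$.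
theorem pairOp_mul (j : Fin (n + 1)) (a b a' b' : Mero n) (f : Mero n ⊗[ℂ] V) :
    pairOp κ V j a b (pairOp κ V j a' b' f) = pairOp κ V j
      (a * b' + b * a' - algebraMap ℂ _ ((κ.at j : ℂ) - (κ.at j : ℂ)⁻¹) * (a * a'))
      (a * a' + b * b') f := by
  induction f with
  | zero => simp only [map_zero]
  | add x y hx hy => simp only [map_add, hx, hy]
  | tmul g v =>
    rw [pairOp_tmul, map_add, pairOp_tmul, pairOp_tmul, pairOp_tmul, smul_smul,
      heckeTinv_mul_self, sub_smul, one_smul, smul_assoc, TensorProduct.tmul_sub,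
      TensorProduct.tmul_smul, TensorProduct.smul_tmul']
    simp only [add_mul, sub_mul, TensorProduct.add_tmul, TensorProduct.sub_tmul,
      Algebra.smul_def, mul_assoc]
    abel

omit [NeZero n] in
theorem pairOp_zero_mul (j : Fin (n + 1)) (a b c : Mero n) (f : Mero n ⊗[ℂ] V) :
    pairOp κ V j a b (pairOp κ V j 0 c f) = pairOp κ V j 0 c (pairOp κ V j a b f) := by
  rw [pairOp_mul, pairOp_mul]
  congr 1
  · congr 1 <;> ring

omit [NeZero n] in
-- Multiplication by a non-zero-divisor is injective, and tensoring with the complex vector space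
-- $V$ preserves injectivity.
theorem pairOp_injective (j : Fin (n + 1)) {c : Mero n} (hc : c ∈ nonZeroDivisors (Mero n))
    {f : Mero n ⊗[ℂ] V} (h : pairOp κ V j 0 c f = 0) : f = 0 := by
  have h1 : Function.Injective (LinearMap.mulLeft ℂ c) := by
    rw [← LinearMap.ker_eq_bot, LinearMap.ker_eq_bot']
    intro m hm
    rw [LinearMap.mulLeft_apply, mul_comm] at hm
    exact (mem_nonZeroDivisors_iff_right.1 hc) m hm
  have h2 := Module.Flat.rTensor_preserves_injective_linearMap (M := V) _ h1
  refine h2 ?_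
  rw [map_zero, ← h, pairOp]
  have : LinearMap.mulLeft ℂ (0 : Mero n) = 0 := by simp
  rw [this, TensorProduct.map_zero_left, zero_add]
  rfl

/-- The coefficient of `T_j⁻¹` in `C_{s_j}`. -/
def baxFst (j : Fin (n + 1)) : Mero n :=
  toMero n ⟨_, isMero_bax qh κ u0 un j (N := fun _ => 1) ⟨1, fun _ => Polynomial.eval_one⟩⟩ -
    toMero n ⟨_, isMero_bax qh κ u0 un j (exists_baxT j)⟩

/-- The coefficient of the identity in `C_{s_j}`, if `T_j` is written in terms of `T_j⁻¹`. -/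
def baxSnd (j : Fin (n + 1)) : Mero n :=
  toMero n ⟨_, isMero_bax qh κ u0 un j (exists_baxId u0 un j)⟩ -
    algebraMap ℂ _ ((κ.at j : ℂ) - (κ.at j : ℂ)⁻¹) *
      toMero n ⟨_, isMero_bax qh κ u0 un j (exists_baxT j)⟩

theorem baxOp_eq (j : Fin (n + 1)) :
    baxOp n qh κ u0 un V j = pairOp κ V j (baxFst qh κ u0 un j) (baxSnd qh κ u0 un j) := by
  refine TensorProduct.ext' fun g v => ?_
  obtain ⟨k, hk⟩ : ∃ k, k = (κ.at j : ℂ) - (κ.at j : ℂ)⁻¹ := ⟨_, rfl⟩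
  have hT : heckeT κ j • v = heckeTinv κ j • v + k • v := by
    rw [heckeTinv_eq, sub_smul, smul_assoc, one_smul, hk, sub_add_cancel]
  rw [pairOp_tmul, baxFst, baxSnd, baxOp]
  simp only [LinearMap.sub_apply, LinearMap.add_apply, TensorProduct.map_tmul,
    LinearMap.mulLeft_apply, LinearMap.id_apply]
  change _ ⊗ₜ (heckeTinv κ j • v) + _ ⊗ₜ v - _ ⊗ₜ (heckeT κ j • v) = _
  rw [hT, ← hk, TensorProduct.tmul_add, TensorProduct.tmul_smul k, TensorProduct.smul_tmul' k,
    sub_mul, sub_mul, TensorProduct.sub_tmul, TensorProduct.sub_tmul, Algebra.smul_def, mul_assoc]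
  abel

theorem bax_relations_mero (j : Fin (n + 1)) :
    (cMero qh κ⁻¹ u0⁻¹ un⁻¹ j - algebraMap ℂ _ (κ.at j : ℂ)⁻¹) * baxSnd qh κ u0 un j +
      baxFst qh κ u0 un j = cMero qh κ⁻¹ u0⁻¹ un⁻¹ j ∧
    (cMero qh κ⁻¹ u0⁻¹ un⁻¹ j - algebraMap ℂ _ (κ.at j : ℂ)) * baxFst qh κ u0 un j +
      baxSnd qh κ u0 un j = 0 := by
  have e : ∀ c : ℂ, algebraMap ℂ (Mero n) c = toMero n (algebraMap ℂ _ c) := fun c =>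
    (AlgHom.commutes _ c).symm
  have hgen := (generic_spectral (n := n) qh j).and (generic_baxDen (n := n) qh κ u0 un j)
  constructor
  · rw [baxFst, baxSnd, cMero, e, e]
    simp only [← map_sub, ← map_mul, ← map_add]
    exact mk_eq_of_generic (hgen.mono fun t ht =>
      (bax_relations qh κ u0 un j ht.1.1 ht.1.2 ht.2).1)
  · rw [baxFst, baxSnd, cMero, e, e, ← map_zero (toMero n)]
    simp only [← map_sub, ← map_mul, ← map_add]
    exact mk_eq_of_generic (hgen.mono fun t ht =>
      (bax_relations qh κ u0 un j ht.1.1 ht.1.2 ht.2).2)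

/-- The equation `∇(s_j) f = f` in terms of the Koornwinder operators. -/
theorem nablaSimple_fixed_iff (j : Fin (n + 1)) (f : Mero n ⊗[ℂ] V) :
    nablaSimple n qh κ u0 un V j f = f ↔
      TensorProduct.map (koornOp qh κ⁻¹ u0⁻¹ un⁻¹ j) (LinearMap.id : V →ₗ[ℂ] V) f =
        TensorProduct.map LinearMap.id (Algebra.lsmul ℂ ℂ V (heckeTinv κ j)) f := by
  set c := cMero qh κ⁻¹ u0⁻¹ un⁻¹ j with hc
  set K : Mero n := algebraMap ℂ _ (κ.at j : ℂ)⁻¹ with hK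
  set S : Module.End ℂ (Mero n ⊗[ℂ] V) :=
    TensorProduct.map (meroRefl qh j).toLinearMap LinearMap.id with hS
  obtain ⟨h1, h2⟩ := bax_relations_mero (n := n) qh κ u0 un j
  have hN : ∀ f, nablaSimple n qh κ u0 un V j f =
      pairOp κ V j (baxFst qh κ u0 un j) (baxSnd qh κ u0 un j) (S f) := fun f => by
    rw [← baxOp_eq]
    rfl
  have hE : ∀ f : Mero n ⊗[ℂ] V,
      -- Collecting terms, the difference of the two sides is
      -- $c_j\,s_jf-(T_j^{-1}+c_j-\kappa_j^{-1})f$.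
      TensorProduct.map (koornOp qh κ⁻¹ u0⁻¹ un⁻¹ j) (LinearMap.id : V →ₗ[ℂ] V) f -
        TensorProduct.map LinearMap.id (Algebra.lsmul ℂ ℂ V (heckeTinv κ j)) f =
      pairOp κ V j 0 c (S f) - pairOp κ V j 1 (c - K) f := by
    intro f
    induction f with
    | zero => simp only [map_zero, sub_zero]
    | add x y hx hy =>
      simp only [map_add]
      rw [add_sub_add_comm, hx, hy, add_sub_add_comm]
    | tmul g v =>
      rw [hS, TensorProduct.map_tmul, TensorProduct.map_tmul, TensorProduct.map_tmul, pairOp_tmul,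
        pairOp_tmul, koornOp_apply, inv_at, Units.val_inv_eq_inv_val, Algebra.smul_def, ← hK, ← hc]
      change _ ⊗ₜ v - g ⊗ₜ (heckeTinv κ j • v) = _ + (c * meroRefl qh j g) ⊗ₜ v - _
      rw [zero_mul, TensorProduct.zero_tmul, one_mul, mul_sub, sub_mul]
      simp only [TensorProduct.add_tmul, TensorProduct.sub_tmul]
      abel
  -- Up to the cancellable factor $c_j$, the operators $T_j^{-1}+c_j-\kappa_j^{-1}$ and $C_{s_j}$
  -- are inverse to each other, which gives both directions.
  have hPC : ∀ f, pairOp κ V j 1 (c - K) (pairOp κ V j (baxFst qh κ u0 un j)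
      (baxSnd qh κ u0 un j) f) = pairOp κ V j 0 c f := by
    intro f
    rw [pairOp_mul]
    congr 1
    congr 1
    · rw [map_sub]
      linear_combination h2
    · linear_combination h1
  have hCP : ∀ f, pairOp κ V j (baxFst qh κ u0 un j) (baxSnd qh κ u0 un j)
      (pairOp κ V j 1 (c - K) f) = pairOp κ V j 0 c f := by
    intro f
    rw [pairOp_mul]
    congr 1
    congr 1
    · rw [map_sub]
      linear_combination h2
    · linear_combination h1
  rw [hN, ← sub_eq_zero (b := TensorProduct.map LinearMap.id _ f), hE]
  constructor
  · intro h
    rw [← hPC, h, sub_self]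
  · intro h
    rw [← sub_eq_zero]
    refine pairOp_injective κ j (cMero_mem qh κ⁻¹ u0⁻¹ un⁻¹ j) ?_
    rw [map_sub, ← pairOp_zero_mul, ← hc, ← hCP f, ← map_sub, h, map_zero]

/-- The affine reflection is $s_0=\tau(e_1)\epsilon_1$ with $\epsilon_1\in W_0$ the first sign
change, so translations and $W_0$ together account for all simple reflections. Invariance is
required for every word, hence vectors fixed by the $\nabla(s_j)$ are invariant at once. -/
theorem mem_solKZInv_iff (f : Mero n ⊗[ℂ] V) :
    f ∈ solKZInv n qh κ u0 un V ↔ ∀ j, nablaSimple n qh κ u0 un V j f = f := by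
  constructor
  · rintro ⟨h1, h2⟩
    have h1' := (Submodule.mem_iInf _).1 h1
    have h2' := (Submodule.mem_iInf _).1 h2
    have hs : ∀ i : Fin n, nablaSimple n qh κ u0 un V i.succ f = f := by
      intro i
      have := h2' (simple i) [i.succ] (by simp [affWord, affSimple])
      simpa [nablaWord] using this
    have hw : ∀ l : List (Fin n), nablaWord n qh κ u0 un V (l.map Fin.succ) f = f ∧
        affWord (l.map Fin.succ) = SemidirectProduct.inr (word l) := by
      intro l
      induction l with
      | nil => exact ⟨rfl, (map_one _).symm⟩
      | cons i l ih =>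
        constructor
        · rw [List.map_cons, nablaWord, List.map_cons, List.prod_cons, Module.End.mul_apply]
          exact (congrArg _ ih.1).trans (hs i)
        · rw [List.map_cons, affWord, List.map_cons, List.prod_cons, word_cons, map_mul]
          exact congrArg (affSimple i.succ * ·) ih.2
    intro j
    refine Fin.cases ?_ hs j
    obtain ⟨l, hl, -⟩ := exists_reduced (SemidirectProduct.inl (Pi.mulSingle 0 (-1)) : W0 n)
    obtain ⟨e1, e2⟩ := hw l
    -- The word $s_0$ followed by a word for $\epsilon_1$ represents $\tau(e_1)$. Its tail already
    -- fixes $f$, so $s_0$ does.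
    have := h1' (Pi.single 0 1) (0 :: l.map Fin.succ) (by
      rw [affWord, List.map_cons, List.prod_cons]
      change affSimple 0 * affWord _ = _
      rw [e2, hl]
      change transl _ * SemidirectProduct.inr _ * SemidirectProduct.inr _ = _
      rw [mul_assoc, ← map_mul, ← map_mul, ← Pi.mulSingle_mul]
      simp)
    rw [nablaWord, List.map_cons, List.prod_cons, Module.End.mul_apply] at this
    rwa [show ((l.map Fin.succ).map (nablaSimple n qh κ u0 un V)).prod f = f from e1] at this
  · intro h
    have hw : ∀ l : List (Fin (n + 1)), nablaWord n qh κ u0 un V l f = f := by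
      intro l
      induction l with
      | nil => rfl
      | cons i l ih =>
        rw [nablaWord, List.map_cons, List.prod_cons, Module.End.mul_apply]
        exact (congrArg _ ih).trans (h i)
    exact ⟨(Submodule.mem_iInf _).2 fun l w _ => hw w, (Submodule.mem_iInf _).2 fun v w _ => hw w⟩

end KZ

/-! ### The dual of a principal series module -/

section Dual

variable {n : ℕ}

/-- The product of the signs of a signed permutation. -/
def signProd (w : W0 n) : ℤˣ := ∏ k, w.left k

theorem signProd_mul (w v : W0 n) : signProd (w * v) = signProd w * signProd v := by
  unfold signProd
  simp only [SemidirectProduct.mul_left, Pi.mul_apply, Finset.prod_mul_distrib]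
  congr 1
  exact Equiv.prod_comp w.right⁻¹ v.left

theorem signProd_simple (i : Fin n) :
    signProd (simple i) = if i.val + 1 < n then 1 else -1 := by
  unfold signProd simple
  split_ifs with h
  · exact Finset.prod_const_one
  · simp only [SemidirectProduct.left_inl]
    rw [Finset.prod_eq_single i (fun k _ hk => Pi.mulSingle_eq_of_ne hk _) (by simp),
      Pi.mulSingle_eq_same]

/-- The product of the signs is a homomorphism that separates $s_n$ from the other simple
reflections. Conjugate simple reflections therefore carry the same Hecke parameter. -/
theorem last_iff_of_conj {w : W0 n} {i j : Fin n} (h : simple j * w = w * simple i) :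
    j.val + 1 < n ↔ i.val + 1 < n := by
  have h1 := congrArg signProd h
  rw [signProd_mul, signProd_mul, mul_comm, mul_left_cancel_iff, signProd_simple,
    signProd_simple] at h1
  split_ifs at h1 with h2 h3 h3
  · exact iff_of_true h2 h3
  · exact absurd h1 (by decide)
  · exact absurd h1 (by decide)
  · exact iff_of_false h2 h3

theorem at_eq_of_conj (κ : Kappa) {w : W0 n} {i j : Fin n} (h : simple j * w = w * simple i) :
    κ.at j.succ = κ.at i.succ := by
  have := last_iff_of_conj h
  by_cases hj : j.val + 1 < n
  · rw [at_mid κ j hj, at_mid κ i (this.1 hj)]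
  · rw [at_last κ j hj, at_last κ i (mt this.2 hj)]

variable [NeZero n] (κ : Kappa) (I : Set (Fin n)) (γ : Torus n)

/-- Transposition makes the dual a module over the opposite algebra, and `exists_sharp` pulls it
back to $H(\underline\kappa^{-1})$. -/
theorem exists_dualRep : ∃ Ψ : Hecke n κ⁻¹ →ₐ[ℂ] Module.End ℂ (Module.Dual ℂ (PrincipalSeries κ I γ)),
    (∀ j ξ x, Ψ (heckeT κ⁻¹ j) ξ x = ξ (heckeTinv κ j • x)) ∧
    ∀ j ξ x, Ψ (heckeY κ⁻¹ j) ξ x = ξ (heckeYs κ (j, -1) • x) := by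
  obtain ⟨φ, h1, h2⟩ := exists_sharp (n := n) κ
  let D : (Hecke n κ)ᵐᵒᵖ →ₐ[ℂ] Module.End ℂ (Module.Dual ℂ (PrincipalSeries κ I γ)) :=
    { toFun := fun h => Module.Dual.transpose (R := ℂ) (psRep κ I γ h.unop)
      map_one' := by
        refine LinearMap.ext fun ξ => LinearMap.ext fun x => ?_
        change ξ (psRep κ I γ 1 x) = ξ x
        rw [map_one, Module.End.one_apply]
      map_mul' := fun a b => by
        refine LinearMap.ext fun ξ => LinearMap.ext fun x => ?_
        change ξ (psRep κ I γ (b.unop * a.unop) x) = ξ (psRep κ I γ b.unop (psRep κ I γ a.unop x))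
        rw [map_mul, Module.End.mul_apply]
      map_zero' := by
        refine LinearMap.ext fun ξ => LinearMap.ext fun x => ?_
        change ξ (psRep κ I γ 0 x) = 0
        rw [map_zero, LinearMap.zero_apply, map_zero]
      map_add' := fun a b => by
        refine LinearMap.ext fun ξ => LinearMap.ext fun x => ?_
        change ξ (psRep κ I γ (a.unop + b.unop) x) =
          ξ (psRep κ I γ a.unop x) + ξ (psRep κ I γ b.unop x)
        rw [map_add, LinearMap.add_apply, map_add]
      commutes' := fun c => by
        refine LinearMap.ext fun ξ => LinearMap.ext fun x => ?_
        change ξ (psRep κ I γ (algebraMap ℂ _ c) x) = c • ξ x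
        rw [AlgHom.commutes, Module.algebraMap_end_apply, map_smul] }
  have hD : ∀ h ξ x, D (MulOpposite.op h) ξ x = ξ (h • x) := fun h ξ x => rfl
  refine ⟨D.comp φ, fun j ξ x => ?_, fun j ξ x => ?_⟩
  · rw [AlgHom.comp_apply, h1, hD]
  · rw [AlgHom.comp_apply, h2, hD]
    simp [heckeYs]

variable {κ I γ}

omit [NeZero n] in
theorem heckeTinv_smul {j : Fin (n + 1)} {c : ℂ} (hc : c ≠ 0) {x : PrincipalSeries κ I γ}
    (h : heckeT κ j • x = c • x) : heckeTinv κ j • x = c⁻¹ • x := by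
  have h1 : heckeTinv κ j • (c • x) = x := by
    rw [← h, smul_smul, heckeTinv_mul_heckeT, one_smul]
  rwa [smul_comm, ← eq_inv_smul_iff₀ hc] at h1

omit [NeZero n] in
theorem heckeTinv_smul' (j : Fin (n + 1)) (x : PrincipalSeries κ I γ) : heckeTinv κ j • x =
    heckeT κ j • x - ((κ.at j : ℂ) - (κ.at j : ℂ)⁻¹) • x := by
  rw [heckeTinv_eq, sub_smul, smul_assoc, one_smul]

variable {b : Module.Basis (minReps I) ℂ (PrincipalSeries κ I γ)}

omit [NeZero n] in
open Classical in
theorem coord_vvec (hb : ∀ d, b d = vvec κ I γ d) (e : minReps I) {d : W0 n} (hd : d ∈ minReps I) :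
    b.coord e (vvec κ I γ d) = if d = e then 1 else 0 := by
  rw [show vvec κ I γ d = b ⟨d, hd⟩ from (hb ⟨d, hd⟩).symm, Module.Basis.coord_apply,
    Module.Basis.repr_self, Finsupp.single_apply]
  simp only [Subtype.ext_iff]

omit [NeZero n] in
/-- The action of `T_j⁻¹` on the basis vectors. -/
theorem heckeTinv_vvec {d : W0 n} (hd : d ∈ minReps I) (j : Fin n) :
    (simple j * d ∈ minReps I ∧ len (simple j * d) = len d + 1 ∧ heckeTinv κ j.succ • vvec κ I γ d =
      vvec κ I γ (simple j * d) - ((κ.at j.succ : ℂ) - (κ.at j.succ : ℂ)⁻¹) • vvec κ I γ d) ∨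
    (simple j * d ∈ minReps I ∧ len d = len (simple j * d) + 1 ∧
      heckeTinv κ j.succ • vvec κ I γ d = vvec κ I γ (simple j * d)) ∨
    ∃ i ∈ I, simple j * d = d * simple i ∧ len (simple j * d) = len d + 1 ∧
      heckeTinv κ j.succ • vvec κ I γ d = (κ.at j.succ : ℂ)⁻¹ • vvec κ I γ d := by
  rcases deodhar hd j with h | ⟨h1, i, hi, h2⟩
  · rcases len_left_or j d with hl | hl
    · refine Or.inl ⟨h, hl, ?_⟩
      rw [heckeTinv_smul', vvec_eq, vvec_eq, heckeTW_simple_mul κ hl, mul_smul]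
    · refine Or.inr (Or.inl ⟨h, hl, ?_⟩)
      have e : simple j * (simple j * d) = d := by rw [← mul_assoc, simple_mul_self, one_mul]
      have h3 := heckeTW_simple_mul κ (i := j) (w := simple j * d) (by rw [e, hl])
      rw [e] at h3
      rw [vvec_eq, vvec_eq, h3, smul_smul, ← mul_assoc, heckeTinv_mul_heckeT, one_mul]
  · refine Or.inr (Or.inr ⟨i, hi, h2, h1, heckeTinv_smul (Units.ne_zero _) ?_⟩)
    rw [vvec_eq, smul_smul, ← heckeTW_simple_mul κ h1, h2, heckeTW_mul_simple κ (by rw [← h2, h1]),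
      mul_smul, heckeT_genVec κ γ hi, smul_comm, at_eq_of_conj κ h2]

omit [NeZero n] in
theorem mul_simple_notMem {d : W0 n} (hd : d ∈ minReps I) {i : Fin n} (hi : i ∈ I) :
    d * simple i ∉ minReps I := fun h => by
  have h1 := mem_minReps_iff.1 hd i hi
  have h2 := mem_minReps_iff.1 h i hi
  rw [mul_assoc, simple_mul_self, mul_one] at h2
  omega

omit [NeZero n] in
-- Among the cases of `heckeTinv_vvec`, the vector $v_e$ appears in $T_j^{-1}v_d$ only for $d=s_je$,
-- and then with coefficient one.
theorem coord_heckeTinv_descent (hb : ∀ d, b d = vvec κ I γ d) {e e' : minReps I} {j : Fin n}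
    (he : (e' : W0 n) = simple j * e) (hl : len (e : W0 n) = len (e' : W0 n) + 1)
    (x : PrincipalSeries κ I γ) : b.coord e (heckeTinv κ j.succ • x) = b.coord e' x := by
  classical
  have key : (b.coord e) ∘ₗ psRep κ I γ (heckeTinv κ j.succ) = b.coord e' := by
    refine b.ext fun d => ?_
    rw [hb, LinearMap.comp_apply, psRep_apply, coord_vvec hb e' d.2]
    have hiff : simple j * (d : W0 n) = e ↔ (d : W0 n) = e' := by
      rw [he]
      constructor
      · intro h
        rw [← h, ← mul_assoc, simple_mul_self, one_mul]
      · intro h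
        rw [h, ← mul_assoc, simple_mul_self, one_mul]
    rcases heckeTinv_vvec (κ := κ) (γ := γ) d.2 j with ⟨h1, h2, h3⟩ | ⟨h1, h2, h3⟩ | ⟨i, hi, h1, h2, h3⟩
    · have hne : (d : W0 n) ≠ e := fun h => by
        rw [h, ← he] at h2
        omega
      rw [h3, map_sub, map_smul, coord_vvec hb e h1, coord_vvec hb e d.2, if_neg hne, smul_zero,
        sub_zero]
      simp only [hiff]
    · rw [h3, coord_vvec hb e h1]
      simp only [hiff]
    · have hne : (d : W0 n) ≠ e := fun h => by
        rw [h, ← he] at h2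
        omega
      have hne' : (d : W0 n) ≠ e' := fun h => by
        have := hiff.2 h
        rw [h1] at this
        exact mul_simple_notMem d.2 hi (this ▸ e.2)
      rw [h3, map_smul, coord_vvec hb e d.2, if_neg hne, if_neg hne', smul_zero]
  exact congrArg (fun ξ => ξ x) key

omit [NeZero n] in
-- For $j\in I$ the element $s_jw_0^I=w_0^Is_i$ leaves $W_0^I$. So $T_j^{-1}$ scales $v_{w_0^I}$,
-- and no other basis vector contributes to this coordinate.
theorem coord_w0I_heckeTinv (hb : ∀ d, b d = vvec κ I γ d) {j : Fin n} (hj : j ∈ I)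
    (x : PrincipalSeries κ I γ) : b.coord ⟨_, w0I_mem_minReps I⟩ (heckeTinv κ j.succ • x) =
      (κ.at j.succ : ℂ)⁻¹ * b.coord ⟨_, w0I_mem_minReps I⟩ x := by
  classical
  set e : minReps I := ⟨_, w0I_mem_minReps I⟩ with he
  obtain ⟨i, hi, hij⟩ := w0I_conj_inv hj
  have key : (b.coord e) ∘ₗ psRep κ I γ (heckeTinv κ j.succ) = (κ.at j.succ : ℂ)⁻¹ • b.coord e := by
    refine b.ext fun d => ?_
    rw [hb, LinearMap.comp_apply, psRep_apply, LinearMap.smul_apply, coord_vvec hb e d.2]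
    have hmem : simple j * (d : W0 n) ∈ minReps I → (d : W0 n) ≠ e ∧ simple j * (d : W0 n) ≠ e := by
      intro h
      constructor
      · intro h'
        rw [h', he, ← hij] at h
        exact mul_simple_notMem (w0I_mem_minReps I) hi h
      · intro h'
        have : (d : W0 n) = w0I I * simple i := by
          rw [hij, ← (show simple j * (d : W0 n) = w0I I from h'), ← mul_assoc, simple_mul_self,
            one_mul]
        exact mul_simple_notMem (w0I_mem_minReps I) hi (this ▸ d.2)
    rcases heckeTinv_vvec (κ := κ) (γ := γ) d.2 j with ⟨h1, h2, h3⟩ | ⟨h1, h2, h3⟩ | ⟨i, hi, h1, h2, h3⟩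
    · rw [h3, map_sub, map_smul, coord_vvec hb e h1, coord_vvec hb e d.2, if_neg (hmem h1).1,
        if_neg (hmem h1).2, smul_zero, smul_zero, sub_zero]
    · rw [h3, coord_vvec hb e h1, if_neg (hmem h1).1, if_neg (hmem h1).2, smul_zero]
    · rw [h3, map_smul, coord_vvec hb e d.2]
  exact congrArg (fun ξ => ξ x) key

/-- Since $w_0^I$ is longest in $W_0^I$, triangularity of $Y_j^{-1}$ shows that the coordinate at
$w_0^I$ sees only the diagonal term, of weight $w_0^I\gamma^{-1}$. -/
theorem coord_w0I_heckeYs (hb : ∀ d, b d = vvec κ I γ d) (j : Fin n)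
    (x : PrincipalSeries κ I γ) : b.coord ⟨_, w0I_mem_minReps I⟩ (heckeYs κ (j, -1) • x) =
      (signedAct n ℂˣ (w0I I) γ⁻¹ j : ℂ) * b.coord ⟨_, w0I_mem_minReps I⟩ x := by
  classical
  set e : minReps I := ⟨_, w0I_mem_minReps I⟩ with he
  have hw : ∀ d ∈ minReps I, weight γ (pairAct d (j, -1)) = (signedAct n ℂˣ d γ⁻¹ j : ℂ) := by
    intro d _
    rw [weight_pairAct, (weight_cases _ _).2, map_inv, Pi.inv_apply, Units.val_inv_eq_inv_val]
  -- A vector $T_x\otimes 1$ with $x\in w_0^IW_{0,I}$ has length at least that of $w_0^I$, so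
  -- shorter elements have no component on $v_{w_0^I}$.
  have hlow : ∀ k ≤ len (w0I I), ∀ y ∈ lenSpan κ ℂ (psRep κ I γ) (genVec κ I γ) k,
      b.coord e y = 0 := by
    intro k hk y hy
    refine Submodule.span_induction (p := fun y _ => b.coord e y = 0) ?_ ?_ ?_ ?_ hy
    · rintro _ ⟨x, hx, rfl⟩
      obtain ⟨d, hd, v, hv, rfl⟩ := exists_minReps_mul (I := I) x
      have hl := hd v hv
      rw [psRep_apply, heckeTW_mul κ hl, mul_smul, heckeTW_genVec κ hv, smul_comm, map_smul,
        ← vvec_eq, coord_vvec hb e hd, if_neg, smul_zero]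
      rintro rfl
      change len (w0I I * v) = len (w0I I) + len v at hl
      change len (w0I I * v) < k at hx
      omega
    · rw [map_zero]
    · intro a b _ _ ha hb
      rw [map_add, ha, hb, add_zero]
    · intro c a _ ha
      rw [map_smul, ha, smul_zero]
  have key : (b.coord e) ∘ₗ psRep κ I γ (heckeYs κ (j, -1)) =
      (signedAct n ℂˣ (w0I I) γ⁻¹ j : ℂ) • b.coord e := by
    refine b.ext fun d => ?_
    rw [hb, LinearMap.comp_apply, LinearMap.smul_apply]
    have htri := heckeYs_triangular κ (O := ℂ) (ρ := psRep κ I γ)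
      (fun h c m => map_smul (psRep κ I γ h) c m)
      (heckeYs_eigen κ (v := genVec κ I γ) (γ := γ) (heckeY_genVec κ I γ)) _ (d : W0 n) rfl (j, -1)
    have hl := len_mul_w0I_inv d.2
    have h0 := hlow _ (by omega) _ htri
    rw [map_sub, sub_eq_zero, map_smul, hw d d.2] at h0
    refine h0.trans ?_
    change _ • b.coord e (vvec κ I γ d) = _ • b.coord e (vvec κ I γ d)
    rw [coord_vvec hb e d.2]
    split_ifs with h
    · rw [h]
    · rw [smul_zero, smul_zero]
  exact congrArg (fun ξ => ξ x) key

omit [NeZero n] in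
-- Induction on the length of $d(w_0^I)^{-1}$. Stripping a letter $s_j$ on its left moves $d$ one
-- step closer to $w_0^I$, and `coord_heckeTinv_descent` shows that $T_j$ carries the functional of
-- $s_jd$ to that of $d$.
theorem coord_eq_heckeTW (hb : ∀ d, b d = vvec κ I γ d)
    {Ψ : Hecke n κ⁻¹ →ₐ[ℂ] Module.End ℂ (Module.Dual ℂ (PrincipalSeries κ I γ))}
    (hΨ : ∀ j ξ x, Ψ (heckeT κ⁻¹ j) ξ x = ξ (heckeTinv κ j • x)) (k : ℕ) :
    ∀ d : minReps I, len ((d : W0 n) * (w0I I)⁻¹) = k →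
      Ψ (heckeTW κ⁻¹ ((d : W0 n) * (w0I I)⁻¹)) (b.coord ⟨_, w0I_mem_minReps I⟩) = b.coord d := by
  induction k with
  | zero =>
    intro d hd
    have h1 := eq_one_of_len hd
    have h2 : d = ⟨_, w0I_mem_minReps I⟩ := Subtype.ext (mul_inv_eq_one.1 h1)
    rw [h1, heckeTW_one, map_one, Module.End.one_apply, h2]
  | succ k ih =>
    intro d hd
    obtain ⟨j, x, h1, h2, h3⟩ := exists_left_descent hd
    have hwinv : (w0I I)⁻¹ = w0I I := by rw [w0I_inv, w0I_eq', negOne_comm]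
    have hdm : (d : W0 n) * (w0I I)⁻¹ ∈ minReps I := by
      rw [hwinv]
      exact mul_w0I_mem_minReps d.2
    -- A descent of $x$ along $I$ would leave $s_jx$ no room for the ascent it must have there.
    have hx : x ∈ minReps I := by
      refine mem_minReps_iff.2 fun i hi => ?_
      have h4 := mem_minReps_iff.1 hdm i hi
      rw [h1, mul_assoc] at h4
      rcases len_right_or x i with h5 | h5
      · exact h5
      · rcases len_left_or j (x * simple i) with h6 | h6 <;> omega
    set d' : minReps I := ⟨x * w0I I, mul_w0I_mem_minReps hx⟩ with hd'
    have e1 : (d' : W0 n) * (w0I I)⁻¹ = x := mul_inv_cancel_right _ _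
    have e2 : (d : W0 n) = simple j * d' := by
      rw [hd', ← mul_assoc, ← h1, inv_mul_cancel_right]
    have hl : len (d' : W0 n) = len (d : W0 n) + 1 := by
      have a1 := len_mul_w0I_inv d.2
      have a2 := len_mul_w0I_inv d'.2
      rw [e1] at a2
      omega
    have hi := ih d' (by rw [e1, h2])
    rw [e1] at hi
    rw [h1, heckeTW_simple_mul κ⁻¹ h3, map_mul, Module.End.mul_apply, hi]
    refine LinearMap.ext fun y => ?_
    rw [hΨ, coord_heckeTinv_descent hb e2 hl]

/-- The inverse of the weight `γ`, transported by `w_0^I`, lies in the torus of the dual module. -/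
theorem signedAct_w0I_mem_torusI (hγ : γ ∈ torusI κ I) :
    signedAct n ℂˣ (w0I I) γ⁻¹ ∈ torusI κ⁻¹ I := by
  obtain ⟨b, hb⟩ := exists_basis κ hγ
  obtain ⟨Ψ, hΨT, hΨY⟩ := exists_dualRep κ I γ
  set ξ := b.coord ⟨_, w0I_mem_minReps I⟩ with hξ
  have hξT : ∀ j ∈ I, Ψ (heckeT κ⁻¹ j.succ) ξ = (κ.at j.succ : ℂ)⁻¹ • ξ := fun j hj =>
    LinearMap.ext fun x => by rw [hΨT, coord_w0I_heckeTinv hb hj]; rfl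
  have hξY : ∀ j, Ψ (heckeY κ⁻¹ j) ξ = (signedAct n ℂˣ (w0I I) γ⁻¹ j : ℂ) • ξ := fun j =>
    LinearMap.ext fun x => by rw [hΨY, coord_w0I_heckeYs hb]; rfl
  have hξ0 : ξ ≠ 0 := by
    intro h
    have h1 : ξ (b ⟨_, w0I_mem_minReps I⟩) = 1 := by
      rw [hξ, Module.Basis.coord_apply, Module.Basis.repr_self, Finsupp.single_eq_same]
    rw [h, LinearMap.zero_apply] at h1
    exact zero_ne_one h1
  refine fun j hj => ⟨fun hjn => ?_, fun hjn => ?_⟩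
  · set m : Fin n := ⟨j.val + 1, hjn⟩ with hm
    -- Applying $Y_j=T_jY_{j+1}T_j$ to the nonzero eigenvector $\xi_0$ compares the two neighbouring
    -- weights.
    have hst := congrArg Units.val ((yFamily_heckeYUnit (n := n) κ⁻¹).step j m rfl)
    rw [Units.val_mul, Units.val_mul, heckeYUnit_val, heckeYUnit_val] at hst
    change heckeY κ⁻¹ j = heckeT κ⁻¹ j.succ * heckeY κ⁻¹ m * heckeT κ⁻¹ j.succ at hst
    have h1 := hξY j
    rw [hst, map_mul, map_mul, Module.End.mul_apply, Module.End.mul_apply, hξT j hj, map_smul,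
      hξY, map_smul, map_smul, hξT j hj, smul_smul, smul_smul] at h1
    have h2 := smul_left_injective ℂ hξ0 h1
    rw [div_eq_iff_eq_mul]
    refine Units.ext ?_
    rw [← h2, at_mid κ j hjn, Units.val_mul, Units.val_pow_eq_pow_val]
    change _ = ((κ.mid⁻¹ : ℂˣ) : ℂ) ^ 2 * _
    rw [Units.val_inv_eq_inv_val]
    ring
  -- For the last index, conjugation forces $w_0^I$ to commute with $s_n$, hence to preserve the
  -- last coordinate up to sign. The ascent of $w_0^I$ at $n$ makes the sign positive, so the
  -- condition on $\gamma_n$ is simply inverted.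
  · obtain ⟨i, hi, hij⟩ := w0I_conj_inv hj
    have hjn' : ¬ j.val + 1 < n := by omega
    have hin' : ¬ i.val + 1 < n := mt (last_iff_of_conj hij.symm).2 hjn'
    obtain rfl : i = j := Fin.ext (by have := i.isLt; omega)
    have hlen := mem_minReps_iff.1 (w0I_mem_minReps I) i hi
    rw [hij] at hlen
    have hdesc : ¬ Desc i (vact (w0I I) (rho n)) := fun h => by
      have := desc_iff.1 h
      omega
    rw [desc_last hin', not_lt] at hdesc
    have hfix : (w0I I).right⁻¹ i = i := by
      have e : (simple i : W0 n) = SemidirectProduct.inl (Pi.mulSingle i (-1)) := by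
        rw [simple, dif_neg hin']
      have h1 := congrFun (congrArg SemidirectProduct.left hij) i
      rw [e, SemidirectProduct.mul_left, SemidirectProduct.mul_left] at h1
      have h2 : (w0I I).left i * (Pi.mulSingle i (-1) : Fin n → ℤˣ) ((w0I I).right⁻¹ i) =
          (Pi.mulSingle i (-1) : Fin n → ℤˣ) i * (w0I I).left i := h1
      rw [mul_comm, mul_right_cancel_iff, Pi.mulSingle_eq_same] at h2
      by_contra hne
      rw [Pi.mulSingle_eq_of_ne hne] at h2
      exact absurd h2 (by decide)
    have hsign : (w0I I).left i = 1 := by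
      rcases Int.units_eq_one_or ((w0I I).left i) with h | h
      · exact h
      · have hp := rho_pos i
        rw [vact, hfix, h] at hdesc
        simp at hdesc
        omega
    rw [signedAct_apply, hfix, hsign, Pi.inv_apply, (hγ i hi).2 hjn, Units.val_one, zpow_one,
      mul_inv_rev, mul_comm]
    rfl

end Dual

/-! ### The correspondence -/

instance {n : ℕ} (I : Set (Fin n)) : Fintype (minReps I) := Fintype.ofFinite _

section Coefficient

variable {A V ι : Type*} [AddCommGroup A] [Module ℂ A] [AddCommGroup V] [Module ℂ V]

/-- The contraction of `A ⊗ V` with a linear functional on `V`. -/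
def contract (A : Type*) {V : Type*} [AddCommGroup A] [Module ℂ A] [AddCommGroup V] [Module ℂ V]
    (ξ : Module.Dual ℂ V) : A ⊗[ℂ] V →ₗ[ℂ] A :=
  (TensorProduct.rid ℂ A).toLinearMap ∘ₗ LinearMap.lTensor A ξ

theorem contract_tmul (ξ : Module.Dual ℂ V) (a : A) (v : V) :
    contract A ξ (a ⊗ₜ v) = ξ v • a := by
  simp [contract]

theorem contract_add (ξ ξ' : Module.Dual ℂ V) (f : A ⊗[ℂ] V) :
    contract A (ξ + ξ') f = contract A ξ f + contract A ξ' f := by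
  induction f with
  | zero => simp only [map_zero, add_zero]
  | add x y hx hy => simp only [map_add, hx, hy]; abel
  | tmul a v => simp only [contract_tmul, LinearMap.add_apply, add_smul]

theorem contract_smul (c : ℂ) (ξ : Module.Dual ℂ V) (f : A ⊗[ℂ] V) :
    contract A (c • ξ) f = c • contract A ξ f := by
  induction f with
  | zero => simp only [map_zero, smul_zero]
  | add x y hx hy => simp only [map_add, hx, hy, smul_add]
  | tmul a v => simp only [contract_tmul, LinearMap.smul_apply, smul_assoc]

theorem contract_map_left (ξ : Module.Dual ℂ V) (B : Module.End ℂ A) (f : A ⊗[ℂ] V) :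
    contract A ξ (TensorProduct.map B LinearMap.id f) = B (contract A ξ f) := by
  induction f with
  | zero => simp only [map_zero]
  | add x y hx hy => simp only [map_add, hx, hy]
  | tmul a v => simp only [TensorProduct.map_tmul, contract_tmul, map_smul, LinearMap.id_apply]

theorem contract_map_right (ξ : Module.Dual ℂ V) (B : Module.End ℂ V) (f : A ⊗[ℂ] V) :
    contract A ξ (TensorProduct.map LinearMap.id B f) = contract A (ξ ∘ₗ B) f := by
  induction f with
  | zero => simp only [map_zero]
  | add x y hx hy => simp only [map_add, hx, hy]
  | tmul a v => simp only [TensorProduct.map_tmul, contract_tmul, LinearMap.id_apply,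
      LinearMap.comp_apply]

theorem sum_contract_tmul [Fintype ι] (b : Module.Basis ι ℂ V) (f : A ⊗[ℂ] V) :
    ∑ d, contract A (b.coord d) f ⊗ₜ b d = f := by
  induction f with
  | zero => simp
  | add x y hx hy =>
    simp only [map_add, TensorProduct.add_tmul, Finset.sum_add_distrib, hx, hy]
  | tmul a v =>
    simp only [contract_tmul, TensorProduct.smul_tmul, ← TensorProduct.tmul_sum,
      Module.Basis.coord_apply, b.sum_repr]

theorem eq_of_contract [Fintype ι] (b : Module.Basis ι ℂ V) {f g : A ⊗[ℂ] V}
    (h : ∀ ξ, contract A ξ f = contract A ξ g) : f = g := by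
  rw [← sum_contract_tmul b f, ← sum_contract_tmul b g]
  exact Finset.sum_congr rfl fun d _ => by rw [h]

end Coefficient

/-! ### Maps out of a principal series module. -/

section PrincipalSeriesLift

variable {n : ℕ} {κ : Kappa} {I : Set (Fin n)} {γ : Torus n} {M : Type*} [AddCommGroup M]
  [Module ℂ M]

/-- The universal property of the principal series modules. -/
theorem exists_psLift {ρ : Hecke n κ →ₐ[ℂ] Module.End ℂ M} {m : M}
    (hT : ∀ i ∈ I, ρ (heckeT κ i.succ) m = (κ.at i.succ : ℂ) • m)
    (hY : ∀ j, ρ (heckeY κ j) m = (γ j : ℂ) • m) :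
    ∃ G : PrincipalSeries κ I γ →ₗ[ℂ] M, ∀ h, G (h • genVec κ I γ) = ρ h m := by
  have h0 : ∀ x ∈ charIdeal κ I γ, ρ x m = 0 := by
    intro x hx
    refine Submodule.span_induction (p := fun x _ => ρ x m = 0) ?_ ?_ ?_ ?_ hx
    · rintro _ (⟨i, hi, rfl⟩ | ⟨j, rfl⟩)
      · rw [map_sub, AlgHom.commutes, LinearMap.sub_apply, Module.algebraMap_end_apply, hT i hi,
          sub_self]
      · rw [map_sub, AlgHom.commutes, LinearMap.sub_apply, Module.algebraMap_end_apply, hY, sub_self]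
    · rw [map_zero, LinearMap.zero_apply]
    · intro x y _ _ hx hy
      rw [map_add, LinearMap.add_apply, hx, hy, add_zero]
    · intro a x _ hx
      rw [smul_eq_mul, map_mul, Module.End.mul_apply, hx, map_zero]
  choose r hr using exists_smul_genVec κ I γ
  have hG : ∀ h, ρ (r (h • genVec κ I γ)) m = ρ h m := by
    intro h
    have h1 := hr (h • genVec κ I γ)
    rw [← sub_eq_zero, ← sub_smul, smul_genVec_eq_zero] at h1
    have h2 := h0 _ h1
    rw [map_sub, LinearMap.sub_apply, sub_eq_zero] at h2
    exact h2.symm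
  refine ⟨{ toFun := fun x => ρ (r x) m, map_add' := fun x y => ?_, map_smul' := fun c x => ?_ }, hG⟩
  · rw [hr x, hr y, ← add_smul, hG, hG, hG, map_add, LinearMap.add_apply]
  · rw [hr x, ← smul_assoc, hG, hG, map_smul, LinearMap.smul_apply]
    rfl

end PrincipalSeriesLift

/-! ### Invariant solutions as equivariant maps from the dual module. -/

section Correspondence

variable {n : ℕ} [NeZero n] {qh : ℂˣ} {κ : Kappa} {u0 un : ℂˣ} {I : Set (Fin n)} {γ : Torus n}

theorem mem_spKI_iff {J : Set (Fin n)} {φ : Mero n} : φ ∈ spKI qh κ u0 un J γ ↔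
    (∀ j, varpi qh κ⁻¹ u0⁻¹ un⁻¹ (heckeY κ⁻¹ j) φ = (γ j : ℂ) • φ) ∧
    ∀ i ∈ J, varpi qh κ⁻¹ u0⁻¹ un⁻¹ (heckeT κ⁻¹ i.succ) φ = (κ.at i.succ : ℂ)⁻¹ • φ := by
  simp only [spKI, spK, Submodule.mem_inf, Submodule.mem_iInf, LinearMap.mem_ker,
    LinearMap.sub_apply, LinearMap.smul_apply, LinearMap.id_apply, sub_eq_zero]

theorem cmMap_eq {b : Module.Basis (minReps I) ℂ (PrincipalSeries κ I γ)}
    (hb : ∀ d, b d = vvec κ I γ d) (φ : Mero n) : cmMap qh κ u0 un I γ φ =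
      ∑ d : minReps I, varpi qh κ⁻¹ u0⁻¹ un⁻¹ (heckeTW κ⁻¹ ((d : W0 n) * (w0I I)⁻¹)) φ ⊗ₜ b d := by
  simp only [hb]
  rw [cmMap, LinearMap.sum_apply, ← Finset.sum_subtype (Set.toFinite (minReps I)).toFinset
    (fun x => Set.Finite.mem_toFinset _)
    (fun w => varpi qh κ⁻¹ u0⁻¹ un⁻¹ (heckeTW κ⁻¹ (w * (w0I I)⁻¹)) φ ⊗ₜ[ℂ] vvec κ I γ w)]
  rfl

theorem contract_cmMap {b : Module.Basis (minReps I) ℂ (PrincipalSeries κ I γ)}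
    (hb : ∀ d, b d = vvec κ I γ d) (φ : Mero n) (d : minReps I) :
    contract (Mero n) (b.coord d) (cmMap qh κ u0 un I γ φ) =
      varpi qh κ⁻¹ u0⁻¹ un⁻¹ (heckeTW κ⁻¹ ((d : W0 n) * (w0I I)⁻¹)) φ := by
  classical
  rw [cmMap_eq hb, map_sum, Finset.sum_eq_single d]
  · rw [contract_tmul, Module.Basis.coord_apply, Module.Basis.repr_self, Finsupp.single_eq_same,
      one_smul]
  · intro d' _ hne
    rw [contract_tmul, Module.Basis.coord_apply, Module.Basis.repr_self,
      Finsupp.single_eq_of_ne hne.symm, zero_smul]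
  · simp

/-- The coordinate at $w_0^I$ of the image is $\varpi(T_1)\phi=\phi$, with $1\in W_0$ the identity
element. -/
theorem cmMap_injective (hγ : γ ∈ torusI κ I) : Function.Injective (cmMap qh κ u0 un I γ) := by
  obtain ⟨b, hb⟩ := exists_basis κ hγ
  intro φ ψ h
  have h1 := congrArg (contract (Mero n) (b.coord ⟨_, w0I_mem_minReps I⟩)) h
  rw [contract_cmMap hb, contract_cmMap hb] at h1
  simpa only [mul_inv_cancel, heckeTW_one, map_one, Module.End.one_apply] using h1

/-- Since the module has a finite basis, a tensor is determined by its contractions. Contracting the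
equation of `nablaSimple_fixed_iff` with every $\xi$ states that $\xi\mapsto\langle\xi,f\rangle$ is
equivariant for each $T_j$. -/
theorem mem_solKZInv_iff_contract
    {Ψ : Hecke n κ⁻¹ →ₐ[ℂ] Module.End ℂ (Module.Dual ℂ (PrincipalSeries κ I γ))}
    (hΨ : ∀ j ξ x, Ψ (heckeT κ⁻¹ j) ξ x = ξ (heckeTinv κ j • x))
    (b : Module.Basis (minReps I) ℂ (PrincipalSeries κ I γ))
    (f : Mero n ⊗[ℂ] PrincipalSeries κ I γ) :
    f ∈ solKZInv n qh κ u0 un (PrincipalSeries κ I γ) ↔ ∀ j ξ,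
      varpi qh κ⁻¹ u0⁻¹ un⁻¹ (heckeT κ⁻¹ j) (contract (Mero n) ξ f) =
        contract (Mero n) (Ψ (heckeT κ⁻¹ j) ξ) f := by
  rw [mem_solKZInv_iff]
  refine forall_congr' fun j => ?_
  have h1 : ∀ ξ, Ψ (heckeT κ⁻¹ j) ξ =
      ξ ∘ₗ Algebra.lsmul ℂ ℂ (PrincipalSeries κ I γ) (heckeTinv κ j) :=
    fun ξ => LinearMap.ext fun x => hΨ j ξ x
  rw [nablaSimple_fixed_iff]
  constructor
  · intro h ξ
    rw [varpi_heckeT, ← contract_map_left, h, contract_map_right, h1]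
  · intro h
    refine eq_of_contract b fun ξ => ?_
    rw [contract_map_left, contract_map_right, ← h1, ← h, varpi_heckeT]

/-- The principal series module of weight $w_0^I\gamma^{-1}$ maps to $\mathcal M(T)$ by
$1\otimes1\mapsto\phi$ and to the dual module by $1\otimes1\mapsto\xi_0$. Contraction with the
proposed solution intertwines the two maps, and $\xi_0$ generates the dual, so contraction is
equivariant. -/
theorem cmMap_mem_solKZInv (hγ : γ ∈ torusI κ I) {φ : Mero n}
    (hφ : φ ∈ spKI qh κ u0 un I (signedAct n ℂˣ (w0I I) γ⁻¹)) :
    cmMap qh κ u0 un I γ φ ∈ solKZInv n qh κ u0 un (PrincipalSeries κ I γ) := by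
  obtain ⟨b, hb⟩ := exists_basis κ hγ
  obtain ⟨Ψ, hΨT, hΨY⟩ := exists_dualRep κ I γ
  set γ' := signedAct n ℂˣ (w0I I) γ⁻¹ with hγ'
  obtain ⟨b', hb'⟩ := exists_basis κ⁻¹ (show γ' ∈ torusI κ⁻¹ I from signedAct_w0I_mem_torusI hγ)
  set ξ₀ := b.coord ⟨_, w0I_mem_minReps I⟩ with hξ
  obtain ⟨h1, h2⟩ := mem_spKI_iff.1 hφ
  obtain ⟨G, hG⟩ := exists_psLift (κ := κ⁻¹) (I := I) (γ := γ')
    (ρ := varpi qh κ⁻¹ u0⁻¹ un⁻¹) (m := φ)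
    (fun i hi => by rw [inv_at, Units.val_inv_eq_inv_val]; exact h2 i hi) h1
  obtain ⟨Θ, hΘ⟩ := exists_psLift (κ := κ⁻¹) (I := I) (γ := γ') (ρ := Ψ) (m := ξ₀)
    (fun i hi => LinearMap.ext fun x => by
      rw [hΨT, coord_w0I_heckeTinv hb hi, inv_at, Units.val_inv_eq_inv_val]; rfl)
    (fun j => LinearMap.ext fun x => by rw [hΨY, coord_w0I_heckeYs hb]; rfl)
  set f := cmMap qh κ u0 un I γ φ with hf
  have hcoord : ∀ d : minReps I,
      Ψ (heckeTW κ⁻¹ ((d : W0 n) * (w0I I)⁻¹)) ξ₀ = b.coord d := fun d =>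
    coord_eq_heckeTW hb hΨT _ d rfl
  let F : Module.Dual ℂ (PrincipalSeries κ I γ) →ₗ[ℂ] Mero n :=
    { toFun := fun ξ => contract (Mero n) ξ f
      map_add' := fun ξ ξ' => contract_add ξ ξ' f
      map_smul' := fun c ξ => contract_smul c ξ f }
  -- It suffices to compare on the basis $v_e$. There $e=d(w_0^I)^{-1}$ for a unique $d\in W_0^I$,
  -- and both sides are the coordinate of the proposed solution at $d$.
  have hFG : F ∘ₗ Θ = G := by
    refine b'.ext fun e => ?_
    have hwinv : (w0I I)⁻¹ = w0I I := by rw [w0I_inv, w0I_eq', negOne_comm]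
    set d : minReps I := ⟨(e : W0 n) * w0I I, mul_w0I_mem_minReps e.2⟩ with hd
    have he : (e : W0 n) = d * (w0I I)⁻¹ := (mul_inv_cancel_right _ _).symm
    rw [hb', LinearMap.comp_apply, vvec_eq, hΘ, hG, he, hcoord]
    exact contract_cmMap hb φ d
  have hsurj : ∀ ξ, ∃ h, Ψ h ξ₀ = ξ := by
    intro ξ
    refine ⟨∑ d : minReps I, ξ (b d) • heckeTW κ⁻¹ ((d : W0 n) * (w0I I)⁻¹), ?_⟩
    rw [map_sum, LinearMap.sum_apply]
    simp only [map_smul, LinearMap.smul_apply, hcoord]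
    exact b.sum_dual_apply_smul_coord ξ
  rw [mem_solKZInv_iff_contract hΨT b]
  intro j ξ
  obtain ⟨h, rfl⟩ := hsurj ξ
  have key : ∀ h, contract (Mero n) (Ψ h ξ₀) f = varpi qh κ⁻¹ u0⁻¹ un⁻¹ h φ := fun h => by
    rw [← hG, ← hFG, LinearMap.comp_apply, hΘ]
    rfl
  rw [key, ← Module.End.mul_apply, ← map_mul, ← key, map_mul, Module.End.mul_apply]

/-- Equivariance under the generators extends to the whole algebra. Contracting $f$ with $\xi_0$
therefore gives a function with the eigenvalues of $\xi_0$, and the other coordinates of $f$ are its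
images under the $T_{d(w_0^I)^{-1}}$. -/
theorem exists_cmMap_eq (hγ : γ ∈ torusI κ I) {f : Mero n ⊗[ℂ] PrincipalSeries κ I γ}
    (hf : f ∈ solKZInv n qh κ u0 un (PrincipalSeries κ I γ)) :
    ∃ φ ∈ spKI qh κ u0 un I (signedAct n ℂˣ (w0I I) γ⁻¹), cmMap qh κ u0 un I γ φ = f := by
  obtain ⟨b, hb⟩ := exists_basis κ hγ
  obtain ⟨Ψ, hΨT, hΨY⟩ := exists_dualRep κ I γ
  set ξ₀ := b.coord ⟨_, w0I_mem_minReps I⟩ with hξ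
  have hall : ∀ h ξ, varpi qh κ⁻¹ u0⁻¹ un⁻¹ h (contract (Mero n) ξ f) =
      contract (Mero n) (Ψ h ξ) f := by
    refine hecke_induction κ⁻¹ ?_ ?_ ?_ ?_
    · intro c ξ
      rw [AlgHom.commutes, AlgHom.commutes, Module.algebraMap_end_apply,
        Module.algebraMap_end_apply, contract_smul]
    · exact (mem_solKZInv_iff_contract hΨT b f).1 hf
    · intro x y hx hy ξ
      rw [map_add, map_add, LinearMap.add_apply, LinearMap.add_apply, hx, hy, contract_add]
    · intro x y hx hy ξ
      rw [map_mul, map_mul, Module.End.mul_apply, Module.End.mul_apply, hy, hx]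
  refine ⟨contract (Mero n) ξ₀ f, mem_spKI_iff.2 ⟨fun j => ?_, fun i hi => ?_⟩, ?_⟩
  · rw [hall, ← contract_smul]
    congr 1
    congr 1
    exact LinearMap.ext fun x => by rw [hΨY, coord_w0I_heckeYs hb]; rfl
  · rw [hall, ← contract_smul]
    congr 1
    congr 1
    exact LinearMap.ext fun x => by rw [hΨT, coord_w0I_heckeTinv hb hi]; rfl
  · rw [cmMap_eq hb, ← sum_contract_tmul b f]
    refine Finset.sum_congr rfl fun d _ => ?_
    rw [sum_contract_tmul b f, hall, coord_eq_heckeTW hb hΨT _ d rfl]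

end Correspondence

end CherednikMatsuo

end

theorem theorem5p3 (n : ℕ) [NeZero n] (hn : 2 ≤ n) (qh : ℂˣ) (κ : CherednikMatsuo.Kappa)
    (u0 un : ℂˣ) (I : Set (Fin n)) (γ : CherednikMatsuo.Torus n)
    (hγ : γ ∈ CherednikMatsuo.torusI κ I) :
    CherednikMatsuo.signedAct n ℂˣ (CherednikMatsuo.w0I I) γ⁻¹ ∈
        CherednikMatsuo.torusI κ⁻¹ (CherednikMatsuo.starSet I) ∧
      ∃ α : CherednikMatsuo.spKI qh κ u0 un (CherednikMatsuo.starSet I)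
            (CherednikMatsuo.signedAct n ℂˣ (CherednikMatsuo.w0I I) γ⁻¹) ≃ₗ[ℂ]
          CherednikMatsuo.solKZInv n qh κ u0 un (CherednikMatsuo.PrincipalSeries κ I γ),
        ∀ φ, (α φ : CherednikMatsuo.Mero n ⊗[ℂ] CherednikMatsuo.PrincipalSeries κ I γ) =
          CherednikMatsuo.cmMap qh κ u0 un I γ φ := by
  rw [CherednikMatsuo.starSet_eq]
  refine ⟨CherednikMatsuo.signedAct_w0I_mem_torusI hγ, LinearEquiv.ofBijective
    ((CherednikMatsuo.cmMap qh κ u0 un I γ).restrict fun φ hφ =>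
      CherednikMatsuo.cmMap_mem_solKZInv hγ hφ) ⟨fun φ ψ h => ?_, fun f => ?_⟩, fun φ => rfl⟩
  · exact Subtype.ext (CherednikMatsuo.cmMap_injective hγ (congrArg Subtype.val h))
  · obtain ⟨φ, hφ, e⟩ := CherednikMatsuo.exists_cmMap_eq hγ f.2
    exact ⟨⟨φ, hφ⟩, Subtype.ext e⟩
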